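/- Let $D\ge 1$ be a fixed integer. There are an algorithm (a pair of programs for a unit-cost real RAM: one for preprocessing, one for queries) and a constant $C$, both depending only on $D$, such that for every real $\varepsilon$ with $0<\varepsilon\le 1$ and every nonempty list $P$ of $n$ points in $\mathbb R^D$ (given by their coordinates, repetitions allowed) the following holds. Given $P$ and $\varepsilon$, the preprocessing program builds, in at most $C\,(n+\varepsilon^{3/2-D})$ time, a data structure; for every query point $q\in\mathbb R^D$, the query program then finds from the data structure and $q$ alone, in at most $C\,\varepsilon^{(1-D)/2}$ time, a point $r\in P$ that is an $\varepsilon$-approximate farthest neighbour of $q$, i.e. $$\|q-r\|\ \ge\ (1-\varepsilon)\,\|q-x\|\qquad\text{for all }x\in P,$$ and it leaves the data structure unchanged for later queries. The data structure together with the working memory of the query program occupies at most $C\,\varepsilon^{(1-D)/2}$ memory cells. The real RAM has cells for exact real numbers and cells for words (natural numbers below $(n+\lceil 1/\varepsilon\rceil+1)^{c}$ for a constant $c$ depending only on $D$), with indirect addressing by words. Unit-cost operations are reads, writes, comparisons, $+,-,\times,/$ on reals, $+,-,\times$, integer division and remainder on words, the conversion of a word to a real number, and rounding down of a nonnegative real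 number whose integer part fits in a word; programs contain no real constants. -/

import Mathlib

/-!
A unit-cost real RAM with structured control.  The memory has *word cells*, which hold natural
numbers below a word bound, and *real cells*, which hold exact real numbers; both kinds of cell
are addressed by words.  A program has no real literals: it is a finite piece of syntax over
natural-number literals.  Any operation that leaves the model (an address outside the memory,
a word that does not fit, a division by zero) makes the computation stuck.
-/

namespace RealRAM

/-- The two size parameters of the machine: words are the natural numbers below `wordBound`, and
there are `memSize` word cells and `memSize` real cells. -/
structure Machine where
  wordBound : ℕ
  memSize : ℕ

/-- The contents of the memory. Only the cells with address below `memSize` are accessible. -/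
structure State where
  word : ℕ → ℕ
  real : ℕ → ℝ

/-- Writing a word cell. -/
def State.setWord (σ : State) (i v : ℕ) : State :=
  { σ with word := Function.update σ.word i v }

/-- Writing a real cell. -/
noncomputable def State.setReal (σ : State) (i : ℕ) (x : ℝ) : State :=
  { σ with real := Function.update σ.real i x }

/-- The binary operations on words (`sub` is truncated subtraction). -/
inductive WordOp
  | add | sub | mul | div | mod

/-- The value of a word operation; division by zero is undefined. -/
def WordOp.eval : WordOp → ℕ → ℕ → Option ℕ
  | .add, x, y => some (x + y)
  | .sub, x, y => some (x - y)
  | .mul, x, y => some (x * y)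
  | .div, x, y => if y = 0 then none else some (x / y)
  | .mod, x, y => if y = 0 then none else some (x % y)

/-- The binary operations on real numbers. -/
inductive RealOp
  | add | sub | mul | div

open Classical in
/-- The value of a real operation; division by zero is undefined. -/
noncomputable def RealOp.eval : RealOp → ℝ → ℝ → Option ℝ
  | .add, x, y => some (x + y)
  | .sub, x, y => some (x - y)
  | .mul, x, y => some (x * y)
  | .div, x, y => if y = 0 then none else some (x / y)

/-- Word expressions: literals, the contents of an (indirectly addressed) word cell, and binary
operations. -/
inductive WExp
  | lit (n : ℕ)
  | read (addr : WExp)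
  | op (o : WordOp) (a b : WExp)

/-- A word, provided that it fits. -/
def Machine.fit (M : Machine) (v : ℕ) : Option ℕ :=
  if v < M.wordBound then some v else none

/-- The value of a word expression. -/
def WExp.eval (M : Machine) (σ : State) : WExp → Option ℕ
  | .lit n => M.fit n
  | .read a => (a.eval M σ).bind fun i => if i < M.memSize then some (σ.word i) else none
  | .op o a b => (a.eval M σ).bind fun x => (b.eval M σ).bind fun y => (o.eval x y).bind M.fit

/-- The time to evaluate a word expression: one unit for each literal, access and operation. -/
def WExp.cost : WExp → ℕ
  | .lit _ => 1
  | .read a => a.cost + 1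
  | .op _ a b => a.cost + b.cost + 1

/-- Real expressions: the contents of a real cell, the conversion of a word to a real number, and
binary operations. -/
inductive RExp
  | read (addr : WExp)
  | ofWord (a : WExp)
  | op (o : RealOp) (a b : RExp)

/-- The value of a real expression. -/
noncomputable def RExp.eval (M : Machine) (σ : State) : RExp → Option ℝ
  | .read a => (a.eval M σ).bind fun i => if i < M.memSize then some (σ.real i) else none
  | .ofWord a => (a.eval M σ).map fun n => (n : ℝ)
  | .op o a b => (a.eval M σ).bind fun x => (b.eval M σ).bind fun y => o.eval x y

/-- The time to evaluate a real expression: one unit for each access, conversion and operation. -/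
def RExp.cost : RExp → ℕ
  | .read a => a.cost + 1
  | .ofWord a => a.cost + 1
  | .op _ a b => a.cost + b.cost + 1

/-- The tests that control branches and loops. -/
inductive Test
  | wordLT (a b : WExp)
  | wordLE (a b : WExp)
  | realLT (a b : RExp)
  | realLE (a b : RExp)

open Classical in
/-- The outcome of a test. -/
noncomputable def Test.eval (M : Machine) (σ : State) : Test → Option Bool
  | .wordLT a b => (a.eval M σ).bind fun x => (b.eval M σ).map fun y => decide (x < y)
  | .wordLE a b => (a.eval M σ).bind fun x => (b.eval M σ).map fun y => decide (x ≤ y)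
  | .realLT a b => (a.eval M σ).bind fun x => (b.eval M σ).map fun y => decide (x < y)
  | .realLE a b => (a.eval M σ).bind fun x => (b.eval M σ).map fun y => decide (x ≤ y)

/-- The time of a test. -/
def Test.cost : Test → ℕ
  | .wordLT a b => a.cost + b.cost + 1
  | .wordLE a b => a.cost + b.cost + 1
  | .realLT a b => a.cost + b.cost + 1
  | .realLE a b => a.cost + b.cost + 1

/-- Programs. `setFloor a e` stores the integer part of the real number `e` in word cell `a`. -/
inductive Program
  | skip
  | setWord (addr : WExp) (e : WExp)
  | setReal (addr : WExp) (e : RExp)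
  | setFloor (addr : WExp) (e : RExp)
  | seq (c₁ c₂ : Program)
  | branch (b : Test) (c₁ c₂ : Program)
  | loop (b : Test) (c : Program)

/-- `Exec M c σ t τ`: on the machine `M`, the program `c` started in the memory state `σ` halts
in the memory state `τ` after `t` time units. There is at most one such pair `(t, τ)`, and none
if the computation gets stuck or runs forever. -/
inductive Exec (M : Machine) : Program → State → ℕ → State → Prop
  | skip (σ : State) : Exec M .skip σ 1 σ
  | setWord {addr e : WExp} {σ : State} {i v : ℕ} (hi : addr.eval M σ = some i)
      (hM : i < M.memSize) (hv : e.eval M σ = some v) :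
      Exec M (.setWord addr e) σ (addr.cost + e.cost + 1) (σ.setWord i v)
  | setReal {addr : WExp} {e : RExp} {σ : State} {i : ℕ} {x : ℝ} (hi : addr.eval M σ = some i)
      (hM : i < M.memSize) (hx : e.eval M σ = some x) :
      Exec M (.setReal addr e) σ (addr.cost + e.cost + 1) (σ.setReal i x)
  | setFloor {addr : WExp} {e : RExp} {σ : State} {i : ℕ} {x : ℝ} (hi : addr.eval M σ = some i)
      (hM : i < M.memSize) (hx : e.eval M σ = some x) (h0 : 0 ≤ x) (hW : ⌊x⌋₊ < M.wordBound) :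
      Exec M (.setFloor addr e) σ (addr.cost + e.cost + 1) (σ.setWord i ⌊x⌋₊)
  | seq {c₁ c₂ : Program} {σ ρ τ : State} {t₁ t₂ : ℕ} (h₁ : Exec M c₁ σ t₁ ρ)
      (h₂ : Exec M c₂ ρ t₂ τ) : Exec M (.seq c₁ c₂) σ (t₁ + t₂) τ
  | branchTrue {b : Test} {c₁ c₂ : Program} {σ τ : State} {t : ℕ} (hb : b.eval M σ = some true)
      (h : Exec M c₁ σ t τ) : Exec M (.branch b c₁ c₂) σ (b.cost + t) τ
  | branchFalse {b : Test} {c₁ c₂ : Program} {σ τ : State} {t : ℕ} (hb : b.eval M σ = some false)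
      (h : Exec M c₂ σ t τ) : Exec M (.branch b c₁ c₂) σ (b.cost + t) τ
  | loopTrue {b : Test} {c : Program} {σ ρ τ : State} {t₁ t₂ : ℕ} (hb : b.eval M σ = some true)
      (h₁ : Exec M c σ t₁ ρ) (h₂ : Exec M (.loop b c) ρ t₂ τ) :
      Exec M (.loop b c) σ (b.cost + t₁ + t₂) τ
  | loopFalse {b : Test} {c : Program} {σ : State} (hb : b.eval M σ = some false) :
      Exec M (.loop b c) σ b.cost σ

end RealRAM

namespace FarthestNeighbor

open RealRAM

/-- `r` is an `ε`-approximate (unweighted) farthest neighbour of `q` in `P`: a point of `P` with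
`d(q, r) ≥ (1 - ε) d(q, x)` for all `x` in `P`. -/
def IsApproxFarthest {X : Type*} [MetricSpace X] (ε : ℝ) (P : Set X) (q r : X) : Prop :=
  r ∈ P ∧ ∀ x ∈ P, (1 - ε) * dist q x ≤ dist q r

/-- The words of the machine, on `n` points with error parameter `ε`: the natural numbers below
`(n + ⌈1/ε⌉ + 1) ^ c`, that is, words of `c * log (n + ⌈1/ε⌉ + 1)` bits. -/
noncomputable def wordBound (c n : ℕ) (ε : ℝ) : ℕ := (n + ⌈1 / ε⌉₊ + 1) ^ c

/-- `σ` is the initial memory of the preprocessing phase: word cell `0` holds `n`, real cell `0`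
holds `ε`, the coordinates of the points fill the real cells from address `1` on, point after
point, and all other cells are `0`. -/
def IsInput {D n : ℕ} (ε : ℝ) (p : Fin n → EuclideanSpace ℝ (Fin D)) (σ : State) : Prop :=
  σ.word 0 = n ∧ (∀ a, 0 < a → σ.word a = 0) ∧
  σ.real 0 = ε ∧
  (∀ (i : Fin n) (j : Fin D), σ.real (1 + (i : ℕ) * D + (j : ℕ)) = p i j) ∧
  (∀ a, n * D < a → σ.real a = 0)

/-- The point `x` is written in the real cells `0, …, D - 1` of the memory. -/
def HoldsPoint {D : ℕ} (σ : State) (x : EuclideanSpace ℝ (Fin D)) : Prop :=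
  ∀ j : Fin D, σ.real (j : ℕ) = x j

/-- The data structure stored in the cells with addresses in `[k, s)`, of both kinds, is the same
in the two memory states. -/
def SameStructure (k s : ℕ) (σ τ : State) : Prop :=
  ∀ a, k ≤ a → a < s → σ.word a = τ.word a ∧ σ.real a = τ.real a

/-- An algorithm for farthest-neighbour queries: a preprocessing program and a query program, with
the number `work` of cells of each kind that the query program may overwrite (they are the cells
with addresses below `work`), and the factor `wordFactor` in the length of the machine words. -/
structure Algorithm where
  build : Program
  query : Program
  work : ℕ
  wordFactor : ℕ

/-- On the point set listed by `p` (repetitions are allowed), with error parameter `ε`, the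
algorithm `A` solves the `ε`-approximate farthest-neighbour query problem with preprocessing time
at most `buildTime`, query time at most `queryTime` and space at most `space`.

The preprocessing program reads the input and leaves a data structure in the cells with addresses
in `[A.work, s)`. The query program runs in a memory of `s` cells of each kind, so that nothing
but these cells is passed on to it; it finds the query point in the real cells `0, …, D - 1`,
anything at all in the other working cells, and it leaves its answer in the real cells
`0, …, D - 1` and the data structure unchanged, ready for the next query. -/
def Algorithm.Solves {D n : ℕ} (A : Algorithm) (ε : ℝ) (p : Fin n → EuclideanSpace ℝ (Fin D))
    (buildTime queryTime space : ℝ) : Prop :=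
  ∀ σ₀ : State, IsInput ε p σ₀ →
    ∃ (t : ℕ) (τ : State),
      Exec ⟨wordBound A.wordFactor n ε, wordBound A.wordFactor n ε⟩ A.build σ₀ t τ ∧
      (t : ℝ) ≤ buildTime ∧
      ∃ s : ℕ, (s : ℝ) + (s : ℝ) ≤ space ∧ D ≤ A.work ∧ A.work ≤ s ∧
        s ≤ wordBound A.wordFactor n ε ∧
        ∀ (q : EuclideanSpace ℝ (Fin D)) (σ : State), HoldsPoint σ q → SameStructure A.work s σ τ →
          ∃ (t' : ℕ) (σ' : State),
            Exec ⟨wordBound A.wordFactor n ε, s⟩ A.query σ t' σ' ∧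
            (t' : ℝ) ≤ queryTime ∧
            SameStructure A.work s σ' τ ∧
            ∃ r, HoldsPoint σ' r ∧ IsApproxFarthest ε (Set.range p) q r

end FarthestNeighbor

/-!
The data structure is a coreset: a list of points of `P`, of size `O(ε ^ ((1 - D) / 2))`, that
contains an `ε`-approximate farthest neighbour of every `q`. A query scans the list.

*Which points to choose.* Let `K ^ 2 * ε ≥ 1` with `K = O(ε ^ (-1 / 2))`. Scale the bounding box of
the points such that its largest extent becomes `M = 8 * D * K ^ 2`, and put a grid of width `K`
on each of the `2 * D` facets of a box that is larger by a constant factor. For each of the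
`O(K ^ (D - 1))` grid points, choose a nearest point of `P`. To see that these points
suffice, let `p` be a farthest point from `q`, and follow the ray from `p` in the direction away
from `q` until it meets a facet, in a point `z`. A point `r` of `P` that is nearest to `z` satisfies
`⟪r - p, p - q⟫ ≥ 0`. If `r` is nearest to a grid point at a distance `O(K)` from `z` instead, then,
as the distance from `p` to `z` is at least `M ≥ K ^ 2`, this costs only a constant in the scaled
units, that is, a small multiple of `ε` times the extent of the box (`face_bound`). The same is
true if all coordinates parallel to the facet are rounded to integers
(`Grid.Sized.exists_extreme`). As `dist q p` is at least half of the extent of the box, `r` is an approximate farthest neighbour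
(`Grid.Sized.exists_approx`).

*How to find them.* For one facet, the problem is a discrete Voronoi diagram: maximize
`-(h p) ^ 2 - ∑ k, (x k p - Y k) ^ 2` over `p`, for all grid points `Y`, where `h p` is the distance
from the facet and the `x k p` are integers. One direction is treated after the other
(`Face.Buckets`, `Face.Winners`): after round `k`, there is one winner for all grid positions in
the first `k` directions and all integer coordinates in the remaining ones. In a round, the scores
of the items of a group, as functions of the next grid position, are translates of one parabola.
So two of them cross at most once (`Item.score_mono`), and a scan over the items in sorted order
with a stack computes their upper envelope in amortized constant time per item (`push_run`). The
winners of a round are produced in the order of their coordinates, so that only the first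
round needs sorting; a radix sort with two passes is enough (`digitPass_run`, `bucketPass_run`). The
groups of all rounds have `O(K ^ (2 * D - 3))` entries, as a grid position replaces one of the `K ^ 2`
integer coordinates in every round by one of `O(K)` positions. This, together with `O(n)`,
is the preprocessing time (`faces_run`). In dimension `1`, the two ends of the bounding interval
are the coreset.

*The machine model.* Programs are verified with a program logic for time bounds: `Run E c σ T post`
says that `c` halts with time to spare, where `T` counts credits of 256 time units and the
postcondition may speak about the credits that are left. All words in memory are kept below a
bound `Q`, a fixed power of `n + ⌈1 / ε⌉ + 1`, whose 40th power fits into a word, so that the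
intermediate results of short expressions cannot overflow (`WExp.eval_eq`). The memory is divided
into 64 interleaved regions (`State.w`, `State.x`), which serve as variables and arrays of
unlimited length. A query runs in a memory that ends with the data structure and must not
rely on the contents of its working cells, hence it clears them first (`query_exec`).
-/

set_option linter.constructorNameAsVariable false

namespace RealRAM

section

/-! ### A program logic with time credits -/

/-- The total version of `WordOp.eval`. -/
def WordOp.val : WordOp → ℕ → ℕ → ℕ
  | .add, x, y => x + y
  | .sub, x, y => x - y
  | .mul, x, y => x * y
  | .div, x, y => x / y
  | .mod, x, y => x % y

/-- Whether the operation has to avoid zero as its second operand. -/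
def WordOp.partial? : WordOp → Bool
  | .div => true
  | .mod => true
  | _ => false

/-- The total version of `RealOp.eval`. -/
noncomputable def RealOp.val : RealOp → ℝ → ℝ → ℝ
  | .add, x, y => x + y
  | .sub, x, y => x - y
  | .mul, x, y => x * y
  | .div, x, y => x / y

/-- Whether the operation has to avoid zero as its second operand. -/
def RealOp.partial? : RealOp → Bool
  | .div => true
  | _ => false

/-- The value of a word expression on a machine without any bounds. -/
def WExp.val (σ : State) : WExp → ℕ
  | .lit n => n
  | .read a => σ.word (a.val σ)
  | .op o a b => o.val (a.val σ) (b.val σ)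

/-- The value of a real expression on a machine without any bounds. -/
noncomputable def RExp.val (σ : State) : RExp → ℝ
  | .read a => σ.real (a.val σ)
  | .ofWord a => (a.val σ : ℝ)
  | .op o a b => o.val (a.val σ) (b.val σ)

/-- The number of leaves of an expression. If all words in memory are at most `Q`, then the
values of word expressions with `l` leaves are at most `Q ^ l`. -/
def WExp.leaves : WExp → ℕ
  | .lit _ => 1
  | .read a => a.leaves
  | .op _ a b => a.leaves + b.leaves

/-- A machine with `m` cells of each kind and word bound `W`, on which the programs keep all
words in memory at most `Q`, so that intermediate results of moderate size never overflow. -/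
structure Env where
  Q : ℕ
  W : ℕ
  m : ℕ
  hQ : 100 ≤ Q
  hW : Q ^ 40 < W

/-- The underlying machine. -/
def Env.machine (E : Env) : Machine := ⟨E.W, E.m⟩

/-- The machine has as many cells as words to address them. -/
class Env.Full (E : Env) : Prop where
  eq : E.m = E.W

/-- All words in memory are at most `Q`. -/
def Env.Small (E : Env) (σ : State) : Prop := ∀ a, σ.word a ≤ E.Q

/-- The address `a` is available. -/
def Env.InMem (E : Env) (a : ℕ) : Prop := E.m = E.W ∨ a < E.m

/-- Sufficient conditions for the evaluation of a (not too large) expression to succeed. -/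
def WExp.Good (E : Env) (σ : State) : WExp → Prop
  | .lit n => n ≤ E.Q
  | .read a => a.Good E σ ∧ E.InMem (a.val σ)
  | .op o a b => a.Good E σ ∧ b.Good E σ ∧ (o.partial? = true → b.val σ ≠ 0)

/-- A bound for the number of leaves of the word expressions in a real expression. -/
def RExp.leaves : RExp → ℕ
  | .read a => a.leaves
  | .ofWord a => a.leaves
  | .op _ a b => max a.leaves b.leaves

/-- Sufficient conditions for the evaluation of a (not too large) expression to succeed. -/
def RExp.Good (E : Env) (σ : State) : RExp → Prop
  | .read a => a.Good E σ ∧ E.InMem (a.val σ)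
  | .ofWord a => a.Good E σ
  | .op o a b => a.Good E σ ∧ b.Good E σ ∧ (o.partial? = true → b.val σ ≠ 0)

/-- All literals are small and there are no divisions. -/
def WExp.clean : WExp → Bool
  | .lit n => n.ble 100
  | .read a => a.clean
  | .op o a b => a.clean && b.clean && !o.partial?

/-- All literals are small and there are no divisions. -/
def RExp.clean : RExp → Bool
  | .read a => a.clean
  | .ofWord a => a.clean
  | .op o a b => a.clean && b.clean && !o.partial?

/-- The expression is small enough to be evaluated in a constant number of steps, without
overflow. -/
def WExp.short (e : WExp) : Bool := e.leaves.ble 40 && e.cost.ble 100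

/-- The expression is small enough to be evaluated in a constant number of steps, without
overflow. -/
def RExp.short (e : RExp) : Bool := e.leaves.ble 40 && e.cost.ble 100

theorem WExp.val_le {E : Env} {σ : State} (hσ : E.Small σ) :
    ∀ e : WExp, e.Good E σ → e.val σ ≤ E.Q ^ e.leaves := by
  have hQ := E.hQ
  have one_le : ∀ e : WExp, 1 ≤ e.leaves := by
    intro e; induction e <;> simp only [WExp.leaves] <;> omega
  have Q_le : ∀ e : WExp, E.Q ≤ E.Q ^ e.leaves := fun e => Nat.le_self_pow (by have := one_le e; omega) _
  intro e
  induction e with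
  | lit n => intro h; simpa [WExp.val, WExp.leaves, WExp.Good] using h
  | read a ih => intro h; exact (hσ _).trans (Q_le a)
  | op o a b iha ihb =>
    rintro ⟨ha, hb, -⟩
    have h1 := iha ha
    have h2 := ihb hb
    have hA := Q_le a
    have hB := Q_le b
    simp only [WExp.val, WExp.leaves, pow_add]
    have h3 : E.Q ^ a.leaves ≤ E.Q ^ a.leaves * E.Q ^ b.leaves :=
      Nat.le_mul_of_pos_right _ (by omega)
    cases o with
    | add =>
      simp only [WordOp.val]
      nlinarith [Nat.mul_le_mul (show 2 ≤ E.Q ^ a.leaves by omega) (show 2 ≤ E.Q ^ b.leaves by omega)]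
    | sub => simp only [WordOp.val]; omega
    | mul => exact Nat.mul_le_mul h1 h2
    | div => exact (Nat.div_le_self _ _).trans (h1.trans h3)
    | mod => exact (Nat.mod_le _ _).trans (h1.trans h3)

theorem WExp.eval_eq {E : Env} {σ : State} (hσ : E.Small σ) :
    ∀ e : WExp, e.Good E σ → e.leaves ≤ 40 → e.eval E.machine σ = some (e.val σ) := by
  have hQ := E.hQ
  have lt_W : ∀ e : WExp, e.Good E σ → e.leaves ≤ 40 → e.val σ < E.W := fun e he hl =>
    ((e.val_le hσ he).trans (Nat.pow_le_pow_right (by omega) hl)).trans_lt E.hW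
  intro e
  induction e with
  | lit n =>
    intro h hl
    have := lt_W _ h hl
    simp only [WExp.val] at this
    simp [WExp.eval, Machine.fit, Env.machine, WExp.val, this]
  | read a ih =>
    rintro ⟨h, h'⟩ hl
    have : a.val σ < E.m := by
      have := lt_W a h hl
      rcases h' with h' | h' <;> omega
    rw [WExp.eval, ih h hl, Option.bind_some]
    simp [Env.machine, WExp.val, this]
  | op o a b iha ihb =>
    intro h hl
    have := lt_W _ h hl
    obtain ⟨ha, hb, ho⟩ := h
    simp only [WExp.leaves] at hl
    simp only [WExp.eval, iha ha (by omega), ihb hb (by omega), Option.bind_some]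
    simp only [WExp.val] at this
    cases o <;> simp_all [WordOp.eval, WordOp.val, WordOp.partial?, Machine.fit, Env.machine, WExp.val]

theorem RExp.eval_eq {E : Env} {σ : State} (hσ : E.Small σ) :
    ∀ e : RExp, e.Good E σ → e.leaves ≤ 40 → e.eval E.machine σ = some (e.val σ) := by
  intro e
  induction e with
  | read a =>
    rintro ⟨h, h'⟩ hl
    have h1 := WExp.eval_eq hσ (.read a) ⟨h, h'⟩ hl
    have h2 := WExp.eval_eq hσ a h hl
    simp only [WExp.eval, h2, Option.bind_some] at h1
    simp only [RExp.eval, h2, Option.bind_some, RExp.val]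
    split_ifs at h1 ⊢
    rfl
  | ofWord a =>
    intro h hl
    simp [RExp.eval, WExp.eval_eq hσ a h hl, RExp.val]
  | op o a b iha ihb =>
    rintro ⟨ha, hb, ho⟩ hl
    simp only [RExp.leaves] at hl
    simp only [RExp.eval, iha ha (by omega), ihb hb (by omega), Option.bind_some, RExp.val]
    cases o <;> simp_all [RealOp.eval, RealOp.val, RealOp.partial?]

theorem WExp.good_of_clean {E : Env} [hE : E.Full] {σ : State} :
    ∀ e : WExp, e.clean = true → e.Good E σ := by
  have := E.hQ
  intro e
  induction e with
  | lit n => intro h; have := Nat.le_of_ble_eq_true h; simp only [WExp.Good]; omega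
  | read a ih => intro h; exact ⟨ih h, .inl hE.eq⟩
  | op o a b iha ihb =>
    intro h
    simp only [WExp.clean, Bool.and_eq_true, Bool.not_eq_true'] at h
    exact ⟨iha h.1.1, ihb h.1.2, by simp [h.2]⟩

theorem RExp.good_of_clean {E : Env} [hE : E.Full] {σ : State} :
    ∀ e : RExp, e.clean = true → e.Good E σ := by
  intro e
  induction e with
  | read a => intro h; exact ⟨a.good_of_clean h, .inl hE.eq⟩
  | ofWord a => intro h; exact a.good_of_clean h
  | op o a b iha ihb =>
    intro h
    simp only [RExp.clean, Bool.and_eq_true, Bool.not_eq_true'] at h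
    exact ⟨iha h.1.1, ihb h.1.2, by simp [h.2]⟩

theorem WExp.leaves_of_short {e : WExp} (h : e.short = true) : e.leaves ≤ 40 ∧ e.cost ≤ 100 := by
  simp only [WExp.short, Bool.and_eq_true] at h
  exact ⟨Nat.le_of_ble_eq_true h.1, Nat.le_of_ble_eq_true h.2⟩

theorem RExp.leaves_of_short {e : RExp} (h : e.short = true) : e.leaves ≤ 40 ∧ e.cost ≤ 100 := by
  simp only [RExp.short, Bool.and_eq_true] at h
  exact ⟨Nat.le_of_ble_eq_true h.1, Nat.le_of_ble_eq_true h.2⟩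

/-- The total version of `Test.eval`, as a proposition. -/
def Test.holds (σ : State) : Test → Prop
  | .wordLT a b => a.val σ < b.val σ
  | .wordLE a b => a.val σ ≤ b.val σ
  | .realLT a b => a.val σ < b.val σ
  | .realLE a b => a.val σ ≤ b.val σ

/-- Sufficient conditions for the evaluation of a test to succeed. -/
def Test.Good (E : Env) (σ : State) : Test → Prop
  | .wordLT a b => a.Good E σ ∧ b.Good E σ
  | .wordLE a b => a.Good E σ ∧ b.Good E σ
  | .realLT a b => a.Good E σ ∧ b.Good E σ
  | .realLE a b => a.Good E σ ∧ b.Good E σ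

/-- All literals are small and there are no divisions. -/
def Test.clean : Test → Bool
  | .wordLT a b => a.clean && b.clean
  | .wordLE a b => a.clean && b.clean
  | .realLT a b => a.clean && b.clean
  | .realLE a b => a.clean && b.clean

/-- The test is small enough to be evaluated in a constant number of steps. -/
def Test.short : Test → Bool
  | .wordLT a b => a.short && b.short
  | .wordLE a b => a.short && b.short
  | .realLT a b => a.short && b.short
  | .realLE a b => a.short && b.short

open Classical in
theorem Test.eval_eq {E : Env} {σ : State} (hσ : E.Small σ) (b : Test) (hb : b.Good E σ)
    (hs : b.short = true) :
    b.eval E.machine σ = some (decide (b.holds σ)) ∧ 1 ≤ b.cost ∧ b.cost ≤ 256 := by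
  cases b with
  | wordLT a b =>
    simp only [Test.short, Bool.and_eq_true] at hs
    have h1 := WExp.leaves_of_short hs.1
    have h2 := WExp.leaves_of_short hs.2
    refine ⟨?_, by simp [Test.cost], by simp only [Test.cost]; omega⟩
    simp [Test.eval, a.eval_eq hσ hb.1 h1.1, b.eval_eq hσ hb.2 h2.1, Test.holds]
    congr
  | wordLE a b =>
    simp only [Test.short, Bool.and_eq_true] at hs
    have h1 := WExp.leaves_of_short hs.1
    have h2 := WExp.leaves_of_short hs.2
    refine ⟨?_, by simp [Test.cost], by simp only [Test.cost]; omega⟩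
    simp [Test.eval, a.eval_eq hσ hb.1 h1.1, b.eval_eq hσ hb.2 h2.1, Test.holds]
    congr
  | realLT a b =>
    simp only [Test.short, Bool.and_eq_true] at hs
    have h1 := RExp.leaves_of_short hs.1
    have h2 := RExp.leaves_of_short hs.2
    refine ⟨?_, by simp [Test.cost], by simp only [Test.cost]; omega⟩
    simp [Test.eval, a.eval_eq hσ hb.1 h1.1, b.eval_eq hσ hb.2 h2.1, Test.holds]
    congr
  | realLE a b =>
    simp only [Test.short, Bool.and_eq_true] at hs
    have h1 := RExp.leaves_of_short hs.1
    have h2 := RExp.leaves_of_short hs.2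
    refine ⟨?_, by simp [Test.cost], by simp only [Test.cost]; omega⟩
    simp [Test.eval, a.eval_eq hσ hb.1 h1.1, b.eval_eq hσ hb.2 h2.1, Test.holds]
    congr

theorem Test.good_of_clean {E : Env} [E.Full] {σ : State} (b : Test) (h : b.clean = true) :
    b.Good E σ := by
  cases b with
  | wordLT a b =>
    simp only [Test.clean, Bool.and_eq_true] at h
    exact ⟨a.good_of_clean h.1, b.good_of_clean h.2⟩
  | wordLE a b =>
    simp only [Test.clean, Bool.and_eq_true] at h
    exact ⟨a.good_of_clean h.1, b.good_of_clean h.2⟩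
  | realLT a b =>
    simp only [Test.clean, Bool.and_eq_true] at h
    exact ⟨a.good_of_clean h.1, b.good_of_clean h.2⟩
  | realLE a b =>
    simp only [Test.clean, Bool.and_eq_true] at h
    exact ⟨a.good_of_clean h.1, b.good_of_clean h.2⟩

/-- `Run E c σ T post`: started in `σ` with `T` credits of 256 time units each, the program `c`
halts in a state `τ` with at least `T'` credits left, where `post τ T'`. Leaving the surplus
credits to the rest of the computation makes amortized time bounds compositional. -/
def Run (E : Env) (c : Program) (σ : State) (T : ℕ) (post : State → ℕ → Prop) : Prop :=
  E.Small σ → ∃ t τ T', Exec E.machine c σ t τ ∧ t + 256 * T' ≤ 256 * T ∧ E.Small τ ∧ post τ T'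

variable {E : Env} {σ : State} {T : ℕ} {post : State → ℕ → Prop}

theorem Run.of_small {c : Program} (h : E.Small σ → Run E c σ T post) : Run E c σ T post :=
  fun hσ => h hσ hσ

theorem Run.mono {c : Program} {T₁ : ℕ} {post₁ : State → ℕ → Prop} (h : Run E c σ T₁ post₁)
    (hT : T₁ ≤ T) (hp : ∀ τ T', post₁ τ T' → post τ T') : Run E c σ T post := by
  intro hσ
  obtain ⟨t, τ, T', h1, h2, h3, h4⟩ := h hσ
  exact ⟨t, τ, T', h1, by omega, h3, hp _ _ h4⟩

/-- A program that needs `b` credits leaves the other ones to the rest of the computation. -/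
theorem Run.call {c : Program} {b : ℕ} {P : State → Prop} (h : Run E c σ b fun τ _ => P τ)
    (hT : b ≤ T) (hp : ∀ τ, P τ → post τ (T - b)) : Run E c σ T post := by
  intro hσ
  obtain ⟨t, τ, T', h1, h2, h3, h4⟩ := h hσ
  exact ⟨t, τ, T - b, h1, by omega, h3, hp _ h4⟩

theorem Run.skip (hT : 1 ≤ T) (h : post σ (T - 1)) : Run E .skip σ T post := fun hσ =>
  ⟨1, σ, T - 1, .skip σ, by omega, hσ, h⟩

theorem Run.seq {c₁ c₂ : Program} (h : Run E c₁ σ T fun τ T' => Run E c₂ τ T' post) :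
    Run E (.seq c₁ c₂) σ T post := by
  intro hσ
  obtain ⟨t, τ, T', h1, h2, h3, h4⟩ := h hσ
  obtain ⟨t', τ', T'', h1', h2', h3', h4'⟩ := h4 h3
  exact ⟨t + t', τ', T'', .seq h1 h1', by omega, h3', h4'⟩

theorem Run.branch_good {b : Test} {c₁ c₂ : Program} (hg : b.Good E σ) (hs : b.short = true)
    (hT : 1 ≤ T) (h₁ : b.holds σ → Run E c₁ σ (T - 1) post)
    (h₂ : ¬ b.holds σ → Run E c₂ σ (T - 1) post) : Run E (.branch b c₁ c₂) σ T post := by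
  classical
  intro hσ
  obtain ⟨h, -, hc⟩ := b.eval_eq hσ hg hs
  by_cases hb : b.holds σ
  · obtain ⟨t, τ, T', h1, h2, h3, h4⟩ := h₁ hb hσ
    exact ⟨_, τ, T', .branchTrue (by simpa [hb] using h) h1, by omega, h3, h4⟩
  · obtain ⟨t, τ, T', h1, h2, h3, h4⟩ := h₂ hb hσ
    exact ⟨_, τ, T', .branchFalse (by simpa [hb] using h) h1, by omega, h3, h4⟩

/-- The rule for loops with an invariant that may speak of the credits. Every test of the loop
condition uses up a credit, so there is no need for a separate termination measure. -/
theorem Run.loop_good {b : Test} {c : Program} (Inv : State → ℕ → Prop) (hs : b.short = true)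
    (h : ∀ τ T', Inv τ T' → b.Good E τ ∧ 1 ≤ T' ∧
      (b.holds τ → Run E c τ (T' - 1) Inv) ∧ (¬ b.holds τ → post τ (T' - 1)))
    (h0 : Inv σ T) : Run E (.loop b c) σ T post := by
  classical
  induction T using Nat.strong_induction_on generalizing σ with
  | _ T ih =>
    intro hσ
    obtain ⟨hg, hT, h1, h2⟩ := h σ T h0
    obtain ⟨he, hc', hc⟩ := b.eval_eq hσ hg hs
    by_cases hb : b.holds σ
    · obtain ⟨t, τ, T', k1, k2, k3, k4⟩ := h1 hb hσ
      obtain ⟨t', τ', T'', l1, l2, l3, l4⟩ := ih T' (by omega) k4 k3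
      exact ⟨_, τ', T'', .loopTrue (by simpa [hb] using he) k1 l1, by omega, l3, l4⟩
    · exact ⟨_, σ, T - 1, .loopFalse (by simpa [hb] using he), by omega, hσ, h2 hb⟩

theorem Env.Small.setWord (h : E.Small σ) {i v : ℕ} (hv : v ≤ E.Q) : E.Small (σ.setWord i v) := by
  intro a
  simp only [State.setWord, Function.update_apply]
  split_ifs
  · exact hv
  · exact h a

theorem Env.InMem.lt (hσ : E.Small σ) {a : WExp} (ha : a.Good E σ) (hl : a.leaves ≤ 40)
    (h : E.InMem (a.val σ)) : a.val σ < E.m := by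
  have hQ := E.hQ
  have := ((a.val_le hσ ha).trans (Nat.pow_le_pow_right (by omega) hl)).trans_lt E.hW
  rcases h with h | h <;> omega

theorem Run.setWord_good {a e : WExp} (ha : a.Good E σ) (hm : E.InMem (a.val σ))
    (has : a.short = true) (he : e.Good E σ) (hes : e.short = true) (hv : e.val σ ≤ E.Q)
    (hT : 1 ≤ T) (hp : post (σ.setWord (a.val σ) (e.val σ)) (T - 1)) :
    Run E (.setWord a e) σ T post := by
  intro hσ
  have h1 := WExp.leaves_of_short has
  have h2 := WExp.leaves_of_short hes
  exact ⟨_, _, T - 1, .setWord (a.eval_eq hσ ha h1.1) (hm.lt hσ ha h1.1) (e.eval_eq hσ he h2.1),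
    by omega, hσ.setWord hv, hp⟩

theorem Run.setReal_good {a : WExp} {e : RExp} (ha : a.Good E σ) (hm : E.InMem (a.val σ))
    (has : a.short = true) (he : e.Good E σ) (hes : e.short = true)
    (hT : 1 ≤ T) (hp : post (σ.setReal (a.val σ) (e.val σ)) (T - 1)) :
    Run E (.setReal a e) σ T post := by
  intro hσ
  have h1 := WExp.leaves_of_short has
  have h2 := RExp.leaves_of_short hes
  exact ⟨_, _, T - 1, .setReal (a.eval_eq hσ ha h1.1) (hm.lt hσ ha h1.1) (e.eval_eq hσ he h2.1),
    by omega, hσ, hp⟩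

theorem Run.setFloor_good {a : WExp} {e : RExp} (ha : a.Good E σ) (hm : E.InMem (a.val σ))
    (has : a.short = true) (he : e.Good E σ) (hes : e.short = true) (h0 : 0 ≤ e.val σ)
    (hv : ⌊e.val σ⌋₊ ≤ E.Q)
    (hT : 1 ≤ T) (hp : post (σ.setWord (a.val σ) ⌊e.val σ⌋₊) (T - 1)) :
    Run E (.setFloor a e) σ T post := by
  intro hσ
  have h1 := WExp.leaves_of_short has
  have h2 := RExp.leaves_of_short hes
  have hQ := E.hQ
  have hW : E.Q < E.W := (Nat.le_self_pow (by norm_num) _).trans_lt E.hW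
  exact ⟨_, _, T - 1, .setFloor (a.eval_eq hσ ha h1.1) (hm.lt hσ ha h1.1) (e.eval_eq hσ he h2.1)
    h0 (by simpa [Env.machine] using hv.trans_lt hW), by omega, hσ.setWord hv, hp⟩

end

section

/-! ### Registers and arrays -/

/-- The regions of the word memory of the preprocessing program. Cell `i` of the region `r` has
the address `64 * i + r.ctorIdx`, so that every region serves as an array of unlimited length; a
scalar variable is the cell `0` of its region. -/
inductive WReg
  | n | dim | i | j | k | K | M | G | T | A | NG | R | ax | sg | g | r | it | sp | fl | jj | ix
  | cx | ci | tmp | key | cn | oc | hb | hd | nx | xx | id | ka | st | sx | si | oi | ct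

/-- The regions of the real memory of the preprocessing program. -/
inductive XReg
  | eps | pt | lo | hi | L | iw | ff | sf | od | out | y | cf | h

theorem WReg.ctorIdx_lt (r : WReg) : r.ctorIdx < 64 := by cases r <;> decide

theorem XReg.ctorIdx_lt (r : XReg) : r.ctorIdx < 64 := by cases r <;> decide

theorem WReg.ctorIdx_inj {a b : WReg} (h : a.ctorIdx = b.ctorIdx) : a = b := by
  cases a <;> cases b <;> first | rfl | exact absurd h (by decide)

theorem XReg.ctorIdx_inj {a b : XReg} (h : a.ctorIdx = b.ctorIdx) : a = b := by
  cases a <;> cases b <;> first | rfl | exact absurd h (by decide)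

instance : DecidableEq WReg := fun a b =>
  decidable_of_iff (a.ctorIdx = b.ctorIdx) ⟨WReg.ctorIdx_inj, fun h => h ▸ rfl⟩

instance : DecidableEq XReg := fun a b =>
  decidable_of_iff (a.ctorIdx = b.ctorIdx) ⟨XReg.ctorIdx_inj, fun h => h ▸ rfl⟩

/-- The contents of a region of the word memory. -/
def State.w (σ : State) (r : WReg) (i : ℕ) : ℕ := σ.word (64 * i + r.ctorIdx)

/-- The contents of a region of the real memory. -/
def State.x (σ : State) (r : XReg) (i : ℕ) : ℝ := σ.real (64 * i + r.ctorIdx)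

/-- Writing a cell of a region. -/
def State.setW (σ : State) (r : WReg) (i v : ℕ) : State := σ.setWord (64 * i + r.ctorIdx) v

/-- Writing a cell of a region. -/
noncomputable def State.setX (σ : State) (r : XReg) (i : ℕ) (v : ℝ) : State :=
  σ.setReal (64 * i + r.ctorIdx) v

section
variable {σ : State}

@[simp] theorem State.w_setW_self (r : WReg) (i v : ℕ) :
    (σ.setW r i v).w r = Function.update (σ.w r) i v := by
  funext j
  simp only [State.w, State.setW, State.setWord, Function.update_apply]
  congr 1
  simp

@[simp] theorem State.w_setW_of_ne {r r' : WReg} (h : r' ≠ r) (i v : ℕ) :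
    (σ.setW r i v).w r' = σ.w r' := by
  funext j
  simp only [State.w, State.setW, State.setWord, Function.update_apply]
  rw [if_neg]
  intro h'
  have := r.ctorIdx_lt
  have := r'.ctorIdx_lt
  exact h (WReg.ctorIdx_inj (by omega))

@[simp] theorem State.w_setX (r' : WReg) (r : XReg) (i : ℕ) (v : ℝ) :
    (σ.setX r i v).w r' = σ.w r' := rfl

@[simp] theorem State.x_setW (r' : XReg) (r : WReg) (i v : ℕ) :
    (σ.setW r i v).x r' = σ.x r' := rfl

@[simp] theorem State.x_setX_self (r : XReg) (i : ℕ) (v : ℝ) :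
    (σ.setX r i v).x r = Function.update (σ.x r) i v := by
  funext j
  simp only [State.x, State.setX, State.setReal, Function.update_apply]
  congr 1
  simp

@[simp] theorem State.x_setX_of_ne {r r' : XReg} (h : r' ≠ r) (i : ℕ) (v : ℝ) :
    (σ.setX r i v).x r' = σ.x r' := by
  funext j
  simp only [State.x, State.setX, State.setReal, Function.update_apply]
  rw [if_neg]
  intro h'
  have := r.ctorIdx_lt
  have := r'.ctorIdx_lt
  exact h (XReg.ctorIdx_inj (by omega))

theorem Env.Small.w {E : Env} (h : E.Small σ) (r : WReg) (i : ℕ) : σ.w r i ≤ E.Q := h _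

end

instance (n : ℕ) : OfNat WExp n := ⟨.lit n⟩
instance : Add WExp := ⟨.op .add⟩
instance : Sub WExp := ⟨.op .sub⟩
instance : Mul WExp := ⟨.op .mul⟩
instance : Div WExp := ⟨.op .div⟩
instance : Mod WExp := ⟨.op .mod⟩
instance : Add RExp := ⟨.op .add⟩
instance : Sub RExp := ⟨.op .sub⟩
instance : Mul RExp := ⟨.op .mul⟩
instance : Div RExp := ⟨.op .div⟩

/-- A scalar word variable. -/
def V (r : WReg) : WExp := .read (.lit r.ctorIdx)

/-- The address of an array cell. -/
def cell (c : ℕ) (i : WExp) : WExp := .op .add (.op .mul (.lit 64) i) (.lit c)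

/-- An array of words. -/
def A (r : WReg) (i : WExp) : WExp := .read (cell r.ctorIdx i)

/-- A scalar real variable. -/
def XV (r : XReg) : RExp := .read (.lit r.ctorIdx)

/-- An array of reals. -/
def XA (r : XReg) (i : WExp) : RExp := .read (cell r.ctorIdx i)

/-- The conversion of a word to a real. -/
def toX (e : WExp) : RExp := .ofWord e

section
variable {σ : State}

@[simp] theorem val_V (r : WReg) : (V r).val σ = σ.w r 0 := by simp [V, WExp.val, State.w]
@[simp] theorem val_cell (c : ℕ) (i : WExp) : (cell c i).val σ = 64 * i.val σ + c := rfl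
@[simp] theorem val_A (r : WReg) (i : WExp) : (A r i).val σ = σ.w r (i.val σ) := rfl
@[simp] theorem val_XV (r : XReg) : (XV r).val σ = σ.x r 0 := by
  simp [XV, RExp.val, WExp.val, State.x]
@[simp] theorem val_XA (r : XReg) (i : WExp) : (XA r i).val σ = σ.x r (i.val σ) := rfl
@[simp] theorem val_toX (e : WExp) : (toX e).val σ = (e.val σ : ℝ) := rfl
@[simp] theorem WExp.val_ofNat (n : ℕ) : (ofNat(n) : WExp).val σ = OfNat.ofNat n := rfl
@[simp] theorem WExp.val_lit (n : ℕ) : (WExp.lit n).val σ = n := rfl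
@[simp] theorem WExp.val_add (a b : WExp) : (a + b).val σ = a.val σ + b.val σ := rfl
@[simp] theorem WExp.val_sub (a b : WExp) : (a - b).val σ = a.val σ - b.val σ := rfl
@[simp] theorem WExp.val_mul (a b : WExp) : (a * b).val σ = a.val σ * b.val σ := rfl
@[simp] theorem WExp.val_div (a b : WExp) : (a / b).val σ = a.val σ / b.val σ := rfl
@[simp] theorem WExp.val_mod (a b : WExp) : (a % b).val σ = a.val σ % b.val σ := rfl
@[simp] theorem RExp.val_add (a b : RExp) : (a + b).val σ = a.val σ + b.val σ := rfl
@[simp] theorem RExp.val_sub (a b : RExp) : (a - b).val σ = a.val σ - b.val σ := rfl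
@[simp] theorem RExp.val_mul (a b : RExp) : (a * b).val σ = a.val σ * b.val σ := rfl
@[simp] theorem RExp.val_div (a b : RExp) : (a / b).val σ = a.val σ / b.val σ := rfl
@[simp] theorem Test.holds_wordLT (a b : WExp) :
    (Test.wordLT a b).holds σ ↔ a.val σ < b.val σ := Iff.rfl
@[simp] theorem Test.holds_wordLE (a b : WExp) :
    (Test.wordLE a b).holds σ ↔ a.val σ ≤ b.val σ := Iff.rfl
@[simp] theorem Test.holds_realLT (a b : RExp) :
    (Test.realLT a b).holds σ ↔ a.val σ < b.val σ := Iff.rfl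

end

/-- An assignment to a scalar word variable. -/
def setV (r : WReg) (e : WExp) : Program := .setWord (.lit r.ctorIdx) e

/-- An assignment to an array cell. -/
def setA (r : WReg) (i e : WExp) : Program := .setWord (cell r.ctorIdx i) e

/-- An assignment to a scalar real variable. -/
def setXV (r : XReg) (e : RExp) : Program := .setReal (.lit r.ctorIdx) e

/-- An assignment to an array cell. -/
def setXA (r : XReg) (i : WExp) (e : RExp) : Program :=
  .setReal (cell r.ctorIdx i) e

/-- The assignment of the integer part of a real number to a scalar word variable. -/
def floorV (r : WReg) (e : RExp) : Program := .setFloor (.lit r.ctorIdx) e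

/-- Sequential composition of a list of programs. -/
def block : List Program → Program
  | [] => .skip
  | c :: cs => .seq c (block cs)

/-- The loop over `i = 0, …, bound - 1`. -/
def forUp (i : WReg) (bound : WExp) (body : Program) : Program :=
  block [setV i 0, .loop (.wordLT (V i) bound) (block [body, setV i (V i + 1)])]

/-- The loop over `i = bound - 1, …, 0`. -/
def forDown (i : WReg) (bound : WExp) (body : Program) : Program :=
  block [setV i bound, .loop (.wordLT 0 (V i)) (block [setV i (V i - 1), body])]

variable {E : Env} {σ : State} {T : ℕ} {post : State → ℕ → Prop}

theorem Run.weaken {c : Program} (h : Run E c σ T fun τ T' => ∃ T'' ≤ T', post τ T'') :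
    Run E c σ T post := by
  intro hσ
  obtain ⟨t, τ, T', h1, h2, h3, T'', h4, h5⟩ := h hσ
  exact ⟨t, τ, T'', h1, by omega, h3, h5⟩

/-- Credits that a program does not need can be put aside. -/
theorem Run.frame {c : Program} (h : Run E c σ T post) (U : ℕ) :
    Run E c σ (T + U) fun τ T' => ∃ T'', T' = T'' + U ∧ post τ T'' := by
  intro hσ
  obtain ⟨t, τ, T', h1, h2, h3, h4⟩ := h hσ
  exact ⟨t, τ, T' + U, h1, by omega, h3, T', rfl, h4⟩

theorem Run.nil (hT : 1 ≤ T) (h : post σ (T - 1)) : Run E (block []) σ T post := Run.skip hT h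

theorem Run.cons {c : Program} {cs : List Program}
    (h : Run E c σ T fun τ T' => Run E (block cs) τ T' post) :
    Run E (block (c :: cs)) σ T post := Run.seq h

theorem Env.good_lit (r : WReg) : (WExp.lit r.ctorIdx).Good E σ := by
  have := r.ctorIdx_lt
  have := E.hQ
  simp only [WExp.Good]; omega

theorem Env.good_lit' (r : XReg) : (WExp.lit r.ctorIdx).Good E σ := by
  have := r.ctorIdx_lt
  have := E.hQ
  simp only [WExp.Good]; omega

theorem Env.good_V (r : WReg) (h : E.InMem r.ctorIdx) : (V r).Good E σ := ⟨Env.good_lit r, h⟩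

theorem Env.good_one : (1 : WExp).Good E σ := by
  have h : 1 ≤ E.Q := by have := E.hQ; omega
  exact h

theorem Run.setV_inMem {r : WReg} {e : WExp} (hr : E.InMem r.ctorIdx) (hg : e.Good E σ)
    (hv : e.val σ ≤ E.Q) (hT : 1 ≤ T) (hp : post (σ.setW r 0 (e.val σ)) (T - 1))
    (hs : e.short = true := by rfl) : Run E (setV r e) σ T post :=
  Run.setWord_good (Env.good_lit r) hr rfl hg hs hv hT (by simpa [State.setW] using hp)

/-- The rule for ascending loops: every iteration may use up `b` credits in addition to the ones
that the invariant puts aside. -/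
theorem Run.forUp_good {i : WReg} {bd : WExp} {body : Program} {N b T₀ : ℕ}
    (Inv : ℕ → State → ℕ → Prop) (hi : E.InMem i.ctorIdx) (hN : N ≤ E.Q)
    (hg : ∀ τ, bd.Good E τ)
    (hbd : ∀ k τ T', k ≤ N → τ.w i 0 = k → Inv k τ T' → bd.val τ = N)
    (hT : T₀ + N * (b + 3) + 4 ≤ T) (h0 : Inv 0 (σ.setW i 0 0) T₀)
    (step : ∀ k τ T', k < N → τ.w i 0 = k → Inv k τ T' →
      Run E body τ (T' + b) fun ρ T'' => ρ.w i 0 = k ∧ Inv (k + 1) (ρ.setW i 0 (k + 1)) T'')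
    (hp : ∀ τ T', τ.w i 0 = N → Inv N τ T' → post τ T')
    (hs : (Test.wordLT (V i) bd).short = true := by rfl) :
    Run E (forUp i bd body) σ T post := by
  have hQ := E.hQ
  apply Run.weaken
  refine Run.cons (Run.setV_inMem hi (Nat.zero_le _) (by simp) (by omega) ?_)
  refine Run.cons (Run.loop_good (fun τ T' => ∃ k T'', k ≤ N ∧ τ.w i 0 = k ∧ Inv k τ T'' ∧
    T'' + (N - k) * (b + 3) + 3 ≤ T') hs ?_ ⟨0, T₀, by omega, by simp, by simpa using h0, by
      simp only [Nat.sub_zero]; omega⟩)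
  rintro τ T' ⟨k, T'', hk, hiw, hI, hT'⟩
  refine ⟨⟨Env.good_V i hi, hg τ⟩, by omega, fun hb => ?_, fun hb => ?_⟩
  · simp only [Test.holds_wordLT, val_V, hiw, hbd k τ T'' hk hiw hI] at hb
    have hNk : (N - k) * (b + 3) = (N - (k + 1)) * (b + 3) + (b + 3) := by
      rw [show N - k = N - (k + 1) + 1 by omega]; ring
    refine Run.cons (((step k τ T'' hb hiw hI).frame ((N - (k + 1)) * (b + 3) + 5)).mono
      (by omega) ?_)
    rintro ρ _ ⟨T₃, rfl, h4, h5⟩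
    refine Run.cons (Run.setV_inMem hi ⟨Env.good_V i hi, Env.good_one, by simp [WordOp.partial?]⟩
      (by simp [h4]; omega) (by omega) ?_)
    refine Run.nil (by omega) ⟨k + 1, T₃, by omega, by simp [h4], ?_, by omega⟩
    simpa [h4] using h5
  · simp only [Test.holds_wordLT, val_V, hiw, hbd k τ T'' hk hiw hI, not_lt] at hb
    obtain rfl : k = N := by omega
    exact Run.nil (by omega) ⟨T'', by omega, hp _ _ hiw hI⟩

variable [hE : E.Full]

theorem clean_V (r : WReg) : (V r).clean = true := by
  have := r.ctorIdx_lt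
  simp only [V, WExp.clean, Nat.ble_eq]
  omega

theorem clean_V_sub_one (r : WReg) : (V r - 1).clean = true := by
  have : (V r - 1).clean = ((V r).clean && true && true) := rfl
  rw [this, clean_V]; rfl

theorem Run.setV_good {r : WReg} {e : WExp} (hg : e.Good E σ) (hv : e.val σ ≤ E.Q) (hT : 1 ≤ T)
    (hp : post (σ.setW r 0 (e.val σ)) (T - 1)) (hs : e.short = true := by rfl) :
    Run E (setV r e) σ T post :=
  Run.setWord_good (Env.good_lit r) (.inl hE.eq) rfl hg hs hv hT
    (by simpa [State.setW] using hp)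

theorem Run.setV {r : WReg} {e : WExp} (hv : e.val σ ≤ E.Q) (hT : 1 ≤ T)
    (hp : post (σ.setW r 0 (e.val σ)) (T - 1)) (hc : e.clean = true := by rfl)
    (hs : e.short = true := by rfl) : Run E (setV r e) σ T post :=
  Run.setV_good (e.good_of_clean hc) hv hT hp hs

theorem Run.setA_good {r : WReg} {i e : WExp} (hg : e.Good E σ) (hv : e.val σ ≤ E.Q) (hT : 1 ≤ T)
    (hp : post (σ.setW r (i.val σ) (e.val σ)) (T - 1))
    (hci : (cell r.ctorIdx i).clean = true := by rfl)
    (hsi : (cell r.ctorIdx i).short = true := by rfl) (hs : e.short = true := by rfl) :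
    Run E (setA r i e) σ T post :=
  Run.setWord_good (WExp.good_of_clean _ hci) (.inl hE.eq) hsi hg hs hv hT hp

theorem Run.setA {r : WReg} {i e : WExp} (hv : e.val σ ≤ E.Q) (hT : 1 ≤ T)
    (hp : post (σ.setW r (i.val σ) (e.val σ)) (T - 1)) (hc : e.clean = true := by rfl)
    (hci : (cell r.ctorIdx i).clean = true := by rfl)
    (hsi : (cell r.ctorIdx i).short = true := by rfl) (hs : e.short = true := by rfl) :
    Run E (setA r i e) σ T post :=
  Run.setA_good (e.good_of_clean hc) hv hT hp hci hsi hs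

theorem Run.setXV_good {r : XReg} {e : RExp} (hg : e.Good E σ) (hT : 1 ≤ T)
    (hp : post (σ.setX r 0 (e.val σ)) (T - 1)) (hs : e.short = true := by rfl) :
    Run E (setXV r e) σ T post :=
  Run.setReal_good (Env.good_lit' r) (.inl hE.eq) rfl hg hs hT (by simpa [State.setX] using hp)

theorem Run.setXV {r : XReg} {e : RExp} (hT : 1 ≤ T)
    (hp : post (σ.setX r 0 (e.val σ)) (T - 1)) (hc : e.clean = true := by rfl)
    (hs : e.short = true := by rfl) : Run E (setXV r e) σ T post :=
  Run.setXV_good (e.good_of_clean hc) hT hp hs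

theorem Run.setXA {r : XReg} {i : WExp} {e : RExp} (hT : 1 ≤ T)
    (hp : post (σ.setX r (i.val σ) (e.val σ)) (T - 1)) (hc : e.clean = true := by rfl)
    (hci : (cell r.ctorIdx i).clean = true := by rfl)
    (hsi : (cell r.ctorIdx i).short = true := by rfl) (hs : e.short = true := by rfl) :
    Run E (setXA r i e) σ T post :=
  Run.setReal_good (WExp.good_of_clean _ hci) (.inl hE.eq) hsi (e.good_of_clean hc) hs hT hp

theorem Run.floorV_good {r : WReg} {e : RExp} (hg : e.Good E σ) (h0 : 0 ≤ e.val σ)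
    (hv : ⌊e.val σ⌋₊ ≤ E.Q) (hT : 1 ≤ T) (hp : post (σ.setW r 0 ⌊e.val σ⌋₊) (T - 1))
    (hs : e.short = true := by rfl) : Run E (floorV r e) σ T post :=
  Run.setFloor_good (Env.good_lit r) (.inl hE.eq) rfl hg hs h0 hv hT
    (by simpa [State.setW] using hp)

theorem Run.floorV {r : WReg} {e : RExp} (h0 : 0 ≤ e.val σ)
    (hv : ⌊e.val σ⌋₊ ≤ E.Q) (hT : 1 ≤ T) (hp : post (σ.setW r 0 ⌊e.val σ⌋₊) (T - 1))
    (hc : e.clean = true := by rfl) (hs : e.short = true := by rfl) :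
    Run E (floorV r e) σ T post :=
  Run.floorV_good (e.good_of_clean hc) h0 hv hT hp hs

theorem Run.branch {b : Test} {c₁ c₂ : Program} (hT : 1 ≤ T)
    (h₁ : b.holds σ → Run E c₁ σ (T - 1) post) (h₂ : ¬ b.holds σ → Run E c₂ σ (T - 1) post)
    (hc : b.clean = true := by rfl) (hs : b.short = true := by rfl) :
    Run E (.branch b c₁ c₂) σ T post :=
  Run.branch_good (b.good_of_clean hc) hs hT h₁ h₂

theorem Run.loop {b : Test} {c : Program} (Inv : State → ℕ → Prop)
    (h : ∀ τ T', Inv τ T' → 1 ≤ T' ∧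
      (b.holds τ → Run E c τ (T' - 1) Inv) ∧ (¬ b.holds τ → post τ (T' - 1)))
    (h0 : Inv σ T) (hc : b.clean = true := by rfl) (hs : b.short = true := by rfl) :
    Run E (.loop b c) σ T post :=
  Run.loop_good Inv hs (fun τ T' h' => ⟨b.good_of_clean hc, h τ T' h'⟩) h0

theorem Run.forUp {i : WReg} {bd : WExp} {body : Program} {N b T₀ : ℕ}
    (Inv : ℕ → State → ℕ → Prop) (hN : N ≤ E.Q)
    (hbd : ∀ k τ T', k ≤ N → τ.w i 0 = k → Inv k τ T' → bd.val τ = N)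
    (hT : T₀ + N * (b + 3) + 4 ≤ T) (h0 : Inv 0 (σ.setW i 0 0) T₀)
    (step : ∀ k τ T', k < N → τ.w i 0 = k → Inv k τ T' →
      Run E body τ (T' + b) fun ρ T'' => ρ.w i 0 = k ∧ Inv (k + 1) (ρ.setW i 0 (k + 1)) T'')
    (hp : ∀ τ T', τ.w i 0 = N → Inv N τ T' → post τ T')
    (hc : (Test.wordLT (V i) bd).clean = true := by rfl)
    (hs : (Test.wordLT (V i) bd).short = true := by rfl) :
    Run E (forUp i bd body) σ T post :=
  Run.forUp_good Inv (.inl hE.eq) hN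
    (fun _ => bd.good_of_clean ((Bool.and_eq_true _ _).mp hc).2) hbd hT h0 step hp hs

/-- The rule for descending loops; the invariant `Inv k` speaks of the state with `k` iterations
left. -/
theorem Run.forDown {i : WReg} {bd : WExp} {body : Program} {N b T₀ : ℕ}
    (Inv : ℕ → State → ℕ → Prop) (hN : N ≤ E.Q) (hbd : bd.val σ = N)
    (hT : T₀ + N * (b + 3) + 4 ≤ T) (h0 : Inv N (σ.setW i 0 N) T₀)
    (step : ∀ k τ T', k < N → τ.w i 0 = k + 1 → Inv (k + 1) τ T' →
      Run E body (τ.setW i 0 k) (T' + b) fun ρ T'' => ρ.w i 0 = k ∧ Inv k ρ T'')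
    (hp : ∀ τ T', τ.w i 0 = 0 → Inv 0 τ T' → post τ T')
    (hc : bd.clean = true := by rfl) (hs : bd.short = true := by rfl) :
    Run E (forDown i bd body) σ T post := by
  apply Run.weaken
  refine Run.cons (Run.setV (by omega) (by omega) ?_ hc hs)
  rw [hbd]
  have hc' : (Test.wordLT 0 (V i)).clean = true := by
    have : (Test.wordLT 0 (V i)).clean = (true && (V i).clean) := rfl
    rw [this, clean_V]; rfl
  refine Run.cons (Run.loop (fun τ T' => ∃ k T'', k ≤ N ∧ τ.w i 0 = k ∧ Inv k τ T'' ∧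
    T'' + k * (b + 3) + 3 ≤ T') ?_ ⟨N, T₀, by omega, by simp, by simpa using h0, by omega⟩ hc')
  rintro τ T' ⟨k, T'', hk, hi, hI, hT'⟩
  refine ⟨by omega, fun hb => ?_, fun hb => ?_⟩
  · simp only [Test.holds_wordLT, val_V, hi, WExp.val_ofNat] at hb
    obtain ⟨k, rfl⟩ : ∃ k', k = k' + 1 := ⟨k - 1, by omega⟩
    have hNk : (k + 1) * (b + 3) = k * (b + 3) + (b + 3) := by ring
    refine Run.cons (Run.setV (by simp [hi]; omega) (by omega) ?_ (clean_V_sub_one i))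
    simp only [WExp.val_sub, val_V, hi, WExp.val_ofNat, Nat.add_sub_cancel]
    refine Run.cons (((step k τ T'' hk hi hI).frame (k * (b + 3) + 4)).mono (by omega) ?_)
    rintro ρ _ ⟨T₃, rfl, h4, h5⟩
    exact Run.nil (by omega) ⟨k, T₃, by omega, h4, h5, by omega⟩
  · simp only [Test.holds_wordLT, val_V, hi, WExp.val_ofNat, not_lt] at hb
    obtain rfl : k = 0 := by omega
    exact Run.nil (by omega) ⟨T'', by omega, hp _ _ hi hI⟩

/-- The state `τ` differs from `σ` in the regions `S` and `S'` only. -/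
structure Frame (S : List WReg) (S' : List XReg) (σ τ : State) : Prop where
  w : ∀ r, r ∉ S → τ.w r = σ.w r
  x : ∀ r, r ∉ S' → τ.x r = σ.x r

namespace Frame
variable {S S₁ : List WReg} {S' S₁' : List XReg} {σ τ ρ : State}

theorem refl (σ : State) : Frame S S' σ σ := ⟨fun _ _ => rfl, fun _ _ => rfl⟩

theorem trans (h : Frame S S' σ τ) (h' : Frame S S' τ ρ) : Frame S S' σ ρ :=
  ⟨fun r hr => (h'.w r hr).trans (h.w r hr), fun r hr => (h'.x r hr).trans (h.x r hr)⟩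

theorem mono (h : Frame S₁ S₁' σ τ) (hS : S₁ ⊆ S := by decide) (hS' : S₁' ⊆ S' := by decide) :
    Frame S S' σ τ :=
  ⟨fun r hr => h.w r fun h => hr (hS h), fun r hr => h.x r fun h => hr (hS' h)⟩

theorem setW (h : Frame S S' σ τ) {r : WReg} {i v : ℕ} (hr : r ∈ S := by decide) :
    Frame S S' σ (τ.setW r i v) :=
  ⟨fun r' hr' => by
      have : r' ≠ r := by rintro rfl; exact hr' hr
      rw [State.w_setW_of_ne this, h.w r' hr'],
    fun r' hr' => h.x r' hr'⟩

theorem setX (h : Frame S S' σ τ) {r : XReg} {i : ℕ} {v : ℝ} (hr : r ∈ S' := by decide) :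
    Frame S S' σ (τ.setX r i v) :=
  ⟨fun r' hr' => h.w r' hr',
    fun r' hr' => by
      have : r' ≠ r := by rintro rfl; exact hr' hr
      rw [State.x_setX_of_ne this, h.x r' hr']⟩

end Frame

end

end RealRAM

namespace FarthestNeighbor
open RealRAM

section

/-! ### Upper envelopes of parabolas over a grid -/

/-- A candidate for the farthest-neighbour structure: the index `id` (counted from `1`) of a
point, the integer coordinate `x` in the direction that is being processed, and the contribution
`f` to the objective function of the directions that have been processed. -/
structure Item where
  x : ℕ
  f : ℝ
  id : ℕ

/-- The objective function after the next direction has been processed, when the grid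
position in this direction is `K * j - O`. -/
noncomputable def Item.score (K O : ℕ) (a : Item) (j : ℕ) : ℝ :=
  a.f - ((a.x : ℝ) - ((K : ℝ) * j - O)) ^ 2

variable {K O : ℕ}

/-- The scores of two items cross at most once. -/
theorem Item.score_mono {a b : Item} (h : b.x ≤ a.x) {i j : ℕ} (hij : i ≤ j)
    (hs : b.score K O i ≤ a.score K O i) : b.score K O j ≤ a.score K O j := by
  simp only [Item.score] at *
  have h1 : (b.x : ℝ) ≤ a.x := by exact_mod_cast h
  have h2 : (i : ℝ) ≤ j := by exact_mod_cast hij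
  have h3 : (0 : ℝ) ≤ K := by positivity
  nlinarith [mul_nonneg h3 (mul_nonneg (sub_nonneg.2 h1) (sub_nonneg.2 h2))]

theorem Item.score_mono_lt {a b : Item} (h : b.x ≤ a.x) {i j : ℕ} (hij : i ≤ j)
    (hs : b.score K O i < a.score K O i) : b.score K O j < a.score K O j := by
  simp only [Item.score] at *
  have h1 : (b.x : ℝ) ≤ a.x := by exact_mod_cast h
  have h2 : (i : ℝ) ≤ j := by exact_mod_cast hij
  have h3 : (0 : ℝ) ≤ K := by positivity
  nlinarith [mul_nonneg h3 (mul_nonneg (sub_nonneg.2 h1) (sub_nonneg.2 h2))]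

/-- `Cover K O hi l seen`: the stack `l` of pairs (start, item) describes the upper envelope of the
items in `seen` on the grid positions below `hi`. Every item on the stack is optimal from its start
up to the start of the item above it. -/
def Cover (K O : ℕ) : ℕ → List (ℕ × Item) → List Item → Prop
  | hi, [], _ => hi = 0
  | hi, (s, a) :: l, seen => s < hi ∧ a ∈ seen ∧
      (∀ j, s ≤ j → j < hi → ∀ b ∈ seen, b.score K O j ≤ a.score K O j) ∧ Cover K O s l seen

/-- The stack `l` describes the upper envelope of `seen` on the grid positions below `T`; it is
empty if there are no items. -/
def Envelope (K O T : ℕ) (l : List (ℕ × Item)) (seen : List Item) : Prop :=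
  (seen = [] ∧ l = []) ∨ Cover K O T l seen

/-- The item `a` is optimal from the position `hi` on. -/
def BeatsFrom (K O T hi : ℕ) (a : Item) (seen : List Item) : Prop :=
  ∀ j, hi ≤ j → j < T → ∀ b ∈ seen, b.score K O j ≤ a.score K O j

section
variable {T hi : ℕ} {l : List (ℕ × Item)} {seen : List Item}

theorem Cover.length_le (h : Cover K O hi l seen) : l.length ≤ hi := by
  induction l generalizing hi with
  | nil => simp
  | cons p l ih =>
    obtain ⟨h1, -, -, h2⟩ := h
    have := ih h2
    simp only [List.length_cons]; omega

theorem Envelope.length_le (h : Envelope K O T l seen) : l.length ≤ T := by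
  rcases h with ⟨-, rfl⟩ | h
  · simp
  · exact h.length_le

/-- Before an item is compared with the stack, it is known to be optimal nowhere. -/
theorem Envelope.exists_cover (h : Envelope K O T l seen) (a : Item) :
    ∃ hi ≤ T, Cover K O hi l seen ∧ BeatsFrom K O T hi a seen := by
  rcases h with ⟨rfl, rfl⟩ | h
  · exact ⟨0, Nat.zero_le _, rfl, by simp [BeatsFrom]⟩
  · exact ⟨T, le_rfl, h, fun j h1 h2 => by omega⟩

theorem Cover.insert {a : Item} (h : Cover K O hi l seen)
    (ha : ∀ j < hi, ∃ b ∈ seen, a.score K O j ≤ b.score K O j) : Cover K O hi l (a :: seen) := by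
  induction l generalizing hi with
  | nil => exact h
  | cons p l ih =>
    obtain ⟨h1, h2, h3, h4⟩ := h
    refine ⟨h1, List.mem_cons_of_mem _ h2, ?_, ih h4 fun j hj => ha j (by omega)⟩
    intro j hj hj' b hb
    rcases List.mem_cons.1 hb with rfl | hb
    · obtain ⟨c, hc, hbc⟩ := ha j hj'
      exact hbc.trans (h3 j hj hj' c hc)
    · exact h3 j hj hj' b hb

/-- If the new item beats the top of the stack at the start of the latter, then the top is
superfluous. -/
theorem Cover.pop {a b : Item} {s : ℕ} (h : Cover K O hi ((s, b) :: l) seen) (hx : b.x ≤ a.x)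
    (ha : BeatsFrom K O T hi a seen) (hs : b.score K O s ≤ a.score K O s) :
    Cover K O s l seen ∧ BeatsFrom K O T s a seen := by
  obtain ⟨h1, h2, h3, h4⟩ := h
  refine ⟨h4, fun j hj hj' c hc => ?_⟩
  by_cases hji : j < hi
  · exact (h3 j hj hji c hc).trans (Item.score_mono hx hj hs)
  · exact ha j (by omega) hj' c hc

theorem Cover.push_nil {a : Item} (hT : 0 < T) (h : Cover K O hi [] seen)
    (ha : BeatsFrom K O T hi a seen) : Envelope K O T [(0, a)] (a :: seen) := by
  have h : hi = 0 := h
  subst h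
  refine .inr ⟨hT, List.mem_cons_self .., fun j _ hj b hb => ?_, rfl⟩
  rcases List.mem_cons.1 hb with rfl | hb
  · exact le_rfl
  · exact ha j (Nat.zero_le _) hj b hb

/-- The new item is superfluous. -/
theorem Cover.push_of_le {a b : Item} {s : ℕ} (h : Cover K O hi ((s, b) :: l) seen)
    (hhi : hi ≤ T) (hx : b.x ≤ a.x) (ha : BeatsFrom K O T hi a seen)
    (he : a.score K O (T - 1) ≤ b.score K O (T - 1)) :
    Envelope K O T ((s, b) :: l) (a :: seen) := by
  obtain ⟨h1, h2, h3, h4⟩ := h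
  have hab : ∀ j < T, a.score K O j ≤ b.score K O j := by
    intro j hj
    by_contra! hlt
    exact absurd (Item.score_mono_lt hx (show j ≤ T - 1 by omega) hlt) (not_lt.2 he)
  refine .inr (Cover.insert (l := (s, b) :: l) ⟨by omega, h2, ?_, h4⟩ fun j hj => ⟨b, h2, hab j hj⟩)
  intro j hj hj' c hc
  by_cases hji : j < hi
  · exact h3 j hj hji c hc
  · exact (ha j (by omega) hj' c hc).trans (hab j hj')

/-- The new item takes over at `j₀`. -/
theorem Cover.push_of_lt {a b : Item} {s j₀ : ℕ} (h : Cover K O hi ((s, b) :: l) seen)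
    (ha : BeatsFrom K O T hi a seen)
    (hs : a.score K O s ≤ b.score K O s) (hj₀ : ∀ j, j₀ ≤ j ↔ b.score K O j < a.score K O j)
    (hT : j₀ < T) : Envelope K O T ((j₀, a) :: (s, b) :: l) (a :: seen) := by
  obtain ⟨h1, h2, h3, h4⟩ := h
  have hsj : s < j₀ := by
    by_contra! h
    exact absurd ((hj₀ s).1 h) (not_lt.2 hs)
  have hlt : ∀ j < j₀, a.score K O j ≤ b.score K O j := fun j hj => by
    by_contra! h
    exact absurd ((hj₀ j).2 h) (by omega)
  refine .inr ⟨hT, List.mem_cons_self .., ?_, ?_⟩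
  · intro j hj hj' c hc
    rcases List.mem_cons.1 hc with rfl | hc
    · exact le_rfl
    by_cases hji : j < hi
    · exact (h3 j (by omega) hji c hc).trans ((hj₀ j).1 hj).le
    · exact ha j (by omega) hj' c hc
  · refine Cover.insert (l := (s, b) :: l) ⟨hsj, h2, ?_, h4⟩ fun j hj => ⟨b, h2, hlt j hj⟩
    intro j hj hj' c hc
    by_cases hji : j < hi
    · exact h3 j hj hji c hc
    · exact (ha j (by omega) (by omega) c hc).trans (hlt j hj')

/-- The position from which on the new item is better. -/
theorem Item.lt_score_iff {a b : Item} (hK : 0 < K) (hx : b.x < a.x)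
    (h0 : a.score K O 0 ≤ b.score K O 0) (j : ℕ) :
    ⌊(b.f - a.f + ((a.x : ℝ) * a.x - b.x * b.x) + 2 * ((a.x : ℝ) - b.x) * O) /
        (2 * ((a.x : ℝ) - b.x) * K)⌋₊ + 1 ≤ j ↔ b.score K O j < a.score K O j := by
  have hx' : (0 : ℝ) < (a.x : ℝ) - b.x := by
    have : (b.x : ℝ) < a.x := by exact_mod_cast hx
    linarith
  have hK' : (0 : ℝ) < K := by exact_mod_cast hK
  simp only [Item.score, Nat.cast_zero] at *
  rw [Nat.succ_le_iff, Nat.floor_lt, div_lt_iff₀ (by positivity)]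
  · constructor <;> intro h <;> nlinarith
  · apply div_nonneg _ (by positivity)
    nlinarith

end

/-! ### The stack in memory -/

/-- The stack `l` (its top comes first) is stored in the arrays `st`, `sx`, `sf`, `si`. -/
def StackRep (σ : State) : List (ℕ × Item) → Prop
  | [] => True
  | (s, a) :: l => σ.w .st (l.length + 1) = s ∧ σ.w .sx (l.length + 1) = a.x ∧
      σ.x .sf (l.length + 1) = a.f ∧ σ.w .si (l.length + 1) = a.id ∧ StackRep σ l

theorem StackRep.congr {σ τ : State} {l : List (ℕ × Item)} (h : StackRep σ l)
    (h1 : ∀ k ≤ l.length, τ.w .st k = σ.w .st k) (h2 : ∀ k ≤ l.length, τ.w .sx k = σ.w .sx k)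
    (h3 : ∀ k ≤ l.length, τ.x .sf k = σ.x .sf k) (h4 : ∀ k ≤ l.length, τ.w .si k = σ.w .si k) :
    StackRep τ l := by
  induction l with
  | nil => trivial
  | cons p l ih =>
    obtain ⟨e1, e2, e3, e4, e5⟩ := h
    simp only [List.length_cons] at h1 h2 h3 h4
    refine ⟨by rw [h1 _ le_rfl, e1], by rw [h2 _ le_rfl, e2], by rw [h3 _ le_rfl, e3],
      by rw [h4 _ le_rfl, e4], ih e5 ?_ ?_ ?_ ?_⟩ <;> intro k hk
    exacts [h1 k (by omega), h2 k (by omega), h3 k (by omega), h4 k (by omega)]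

/-- The score of an item, at the position stored in the variable `y`. -/
def scoreE (x : WExp) (f : RExp) : RExp := f - (toX x - XV .y) * (toX x - XV .y)

/-- Set the variable `y` to the grid position with index `j`. -/
def setY (j : WExp) : Program := setXV .y (toX (V .K) * toX j - toX (2 * V .M))

/-- Compare the item in the node `it` with the items on the stack, from the top, and remove those
that it beats on their whole range. -/
def popLoop : Program :=
  .loop (.wordLT 0 (V .fl)) <| .branch (.wordLE (V .sp) 0) (setV .fl 0) <| block [
    setY (A .st (V .sp)),
    .branch (.realLT (scoreE (A .sx (V .sp)) (XA .sf (V .sp))) (scoreE (V .cx) (XV .cf)))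
      (setV .sp (V .sp - 1)) (setV .fl 0)]

/-- Write the item in the node `it` on the stack, with the start `s`. -/
def pushItem (s : WExp) : List Program :=
  [setA .st (V .sp + 1) s, setA .sx (V .sp + 1) (V .cx), setXA .sf (V .sp + 1) (XV .cf),
   setA .si (V .sp + 1) (V .ci), setV .sp (V .sp + 1)]

/-- The grid position at which the item in the node `it` becomes better than the top of the
stack. -/
def crossing : RExp :=
  (XA .sf (V .sp) - XV .cf +
    (toX (V .cx) * toX (V .cx) - toX (A .sx (V .sp)) * toX (A .sx (V .sp))) +
    toX 2 * (toX (V .cx) - toX (A .sx (V .sp))) * toX (2 * V .M)) /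
  (toX 2 * (toX (V .cx) - toX (A .sx (V .sp))) * toX (V .K))

/-- Insert the item in the node `it` into the envelope on the stack. -/
def push : Program := block [
  setV .cx (A .xx (V .it)), setXV .cf (XA .ff (V .it)), setV .ci (A .id (V .it)),
  setV .fl 1, popLoop,
  .branch (.wordLE (V .sp) 0) (block (pushItem 0)) <| block [
    setY (V .T - 1),
    .branch (.realLT (scoreE (A .sx (V .sp)) (XA .sf (V .sp))) (scoreE (V .cx) (XV .cf)))
      (block (floorV .tmp crossing :: pushItem (V .tmp + 1))) .skip]]

/-- The word variables that `push` may change. -/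
abbrev pushW : List WReg := [.cx, .ci, .fl, .sp, .tmp, .st, .sx, .si]

/-- The real variables that `push` may change. -/
abbrev pushX : List XReg := [.cf, .y, .sf]

/-- The parameters of the grid are in memory. -/
structure Params (K M T : ℕ) (σ : State) : Prop where
  K : σ.w .K 0 = K
  M : σ.w .M 0 = M
  T : σ.w .T 0 = T

theorem Params.of_frame {K M T : ℕ} {S : List WReg} {S' : List XReg} {σ τ : State}
    (h : Params K M T σ) (hF : Frame S S' σ τ) (hK : WReg.K ∉ S := by decide)
    (hM : WReg.M ∉ S := by decide) (hT : WReg.T ∉ S := by decide) : Params K M T τ :=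
  ⟨by rw [hF.w _ hK, h.K], by rw [hF.w _ hM, h.M], by rw [hF.w _ hT, h.T]⟩

variable {E : Env} [E.Full] {M T : ℕ}

theorem pushItem_run {σ : State} {U : ℕ} {s : WExp} {v : ℕ} {a : Item} {l : List (ℕ × Item)}
    (hT : l.length < E.Q) (hsp : σ.w .sp 0 = l.length) (hl : StackRep σ l) (hv : s.val σ = v)
    (hvQ : v ≤ E.Q)
    (hcx : σ.w .cx 0 = a.x) (hci : σ.w .ci 0 = a.id) (hcf : σ.x .cf 0 = a.f)
    (hc : s.clean = true := by rfl) (hs : s.short = true := by rfl) :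
    Run E (block (pushItem s)) σ (U + 6) fun τ T' => T' = U ∧ Frame pushW pushX σ τ ∧
      τ.w .sp 0 = l.length + 1 ∧ StackRep τ ((v, a) :: l) := by
  refine Run.of_small fun hσ => ?_
  have hx : a.x ≤ E.Q := hcx ▸ hσ.w _ _
  have hid : a.id ≤ E.Q := hci ▸ hσ.w _ _
  refine Run.cons (Run.setA (by omega) (by omega) ?_ hc rfl rfl hs)
  refine Run.cons (Run.setA (by simp; omega) (by omega) ?_)
  refine Run.cons (Run.setXA (by omega) ?_)
  refine Run.cons (Run.setA (by simp; omega) (by omega) ?_)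
  refine Run.cons (Run.setV (by simp; omega) (by omega) ?_)
  refine Run.nil (by omega) ⟨by omega, ?_, by simp [hsp], ?_⟩
  · exact Frame.setW <| Frame.setW <| Frame.setX <| Frame.setW <| Frame.setW <| Frame.refl _
  · refine ⟨by simp [hsp, hv], by simp [hsp, hcx], by simp [hsp, hcf], by simp [hsp, hci],
      hl.congr ?_ ?_ ?_ ?_⟩ <;> intro k hk <;> simp [hsp] <;>
      rw [Function.update_of_ne (by omega)]

theorem Item.score_eq {K M : ℕ} {a : Item} {j : ℕ} {y : ℝ} (hy : y = (K : ℝ) * j - (2 * M : ℕ)) :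
    a.f - ((a.x : ℝ) - y) * ((a.x : ℝ) - y) = a.score K (2 * M) j := by
  rw [hy, Item.score, sq]

theorem popLoop_run {K hi : ℕ} {σ : State} {U : ℕ} {a : Item} {l : List (ℕ × Item)} {seen : List Item}
    (hp : Params K M T σ) (hT : T ≤ E.Q) (hhi : hi ≤ T) (hsp : σ.w .sp 0 = l.length)
    (hl : StackRep σ l)
    (hcx : σ.w .cx 0 = a.x) (hcf : σ.x .cf 0 = a.f) (hfl : σ.w .fl 0 = 1)
    (hc : Cover K (2 * M) hi l seen) (hb : BeatsFrom K (2 * M) T hi a seen)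
    (hx : ∀ b ∈ seen, b.x ≤ a.x) :
    Run E popLoop σ (U + 8 * l.length + 20) fun τ T' => Frame [.fl, .sp] [.y] σ τ ∧
      ∃ hi' ≤ T, ∃ l', T' = U + 8 * l'.length ∧ τ.w .sp 0 = l'.length ∧ StackRep τ l' ∧
      Cover K (2 * M) hi' l' seen ∧ BeatsFrom K (2 * M) T hi' a seen ∧
      ∀ s b l'', l' = (s, b) :: l'' → a.score K (2 * M) s ≤ b.score K (2 * M) s := by
  have hQ := E.hQ
  apply Run.weaken
  refine Run.loop (fun τ T' => Frame [.fl, .sp] [.y] σ τ ∧ ∃ hi' ≤ T, ∃ l',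
      τ.w .sp 0 = l'.length ∧ StackRep τ l' ∧
      Cover K (2 * M) hi' l' seen ∧ BeatsFrom K (2 * M) T hi' a seen ∧
      ((τ.w .fl 0 = 1 ∧ U + 8 * l'.length + 15 ≤ T') ∨ (τ.w .fl 0 = 0 ∧
        U + 8 * l'.length + 5 ≤ T' ∧
        ∀ s b l'', l' = (s, b) :: l'' → a.score K (2 * M) s ≤ b.score K (2 * M) s))) ?_
    ⟨Frame.refl _, hi, hhi, l, hsp, hl, hc, hb, .inl ⟨hfl, by omega⟩⟩
  rintro τ T' ⟨hF, hi', hhi', l', hsp', hl', hc', hb', hfl'⟩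
  refine ⟨by omega, fun ht => ?_, fun ht => ?_⟩
  · simp only [Test.holds_wordLT, WExp.val_ofNat, val_V] at ht
    obtain ⟨hfl1, hT'⟩ : τ.w .fl 0 = 1 ∧ U + 8 * l'.length + 15 ≤ T' := by
      rcases hfl' with h | h
      · exact h
      · omega
    refine Run.branch (by omega) (fun h0 => ?_) (fun h0 => ?_)
    · simp only [Test.holds_wordLE, WExp.val_ofNat, val_V, hsp'] at h0
      obtain rfl : l' = [] := List.length_eq_zero_iff.1 (by omega)
      refine Run.setV (by simp) (by omega) ?_
      exact ⟨hF.setW, hi', hhi', [], by simpa using hsp', trivial, hc', hb',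
        .inr ⟨by simp, by simp only [List.length_nil] at *; omega, by simp⟩⟩
    · simp only [Test.holds_wordLE, WExp.val_ofNat, val_V, hsp'] at h0
      obtain ⟨⟨s, b⟩, l', rfl⟩ := List.exists_cons_of_length_pos (show 0 < l'.length by omega)
      have hp' := hp.of_frame hF
      have hc'' := hc'
      obtain ⟨e1, e2, e3, e4, e5⟩ := hl'
      obtain ⟨c1, c2, c3, c4⟩ := hc'
      simp only [List.length_cons] at hsp' hT' h0
      refine Run.cons (Run.setXV (by omega) ?_)
      have hcx' : τ.w .cx 0 = a.x := by rw [hF.w _ (by decide), hcx]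
      have hcf' : τ.x .cf 0 = a.f := by rw [hF.x _ (by decide), hcf]
      have hy : (toX (V .K) * toX (A .st (V .sp)) - toX (2 * V .M)).val τ =
          (K : ℝ) * s - (2 * M : ℕ) := by
        simp [hp'.K, hp'.M, hsp', e1]
      have hrep : StackRep (τ.setX .y 0 ((toX (V .K) * toX (A .st (V .sp)) - toX (2 * V .M)).val τ))
          ((s, b) :: l') := by
        refine StackRep.congr (σ := τ) ⟨e1, e2, e3, e4, e5⟩ ?_ ?_ ?_ ?_ <;> intro k hk <;> simp
      refine Run.cons (Run.branch (by omega) (fun hlt => ?_) (fun hlt => ?_))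
      · simp only [Test.holds_realLT, scoreE, RExp.val_sub, RExp.val_mul, val_toX, val_XV, val_XA,
          val_V, val_A, State.w_setX, State.x_setX_self, Function.update_self, hy, ne_eq,
          reduceCtorEq, not_false_eq_true, State.x_setX_of_ne, hsp', e2, e3, hcx', hcf'] at hlt
        rw [Item.score_eq rfl, Item.score_eq rfl] at hlt
        refine Run.setV (by simp [hsp']; have := Cover.length_le c4; omega) (by omega) ?_
        obtain ⟨d1, d2⟩ := hc''.pop (hx b c2) hb' hlt.le
        refine Run.nil (by omega) ⟨hF.setX.setW, s, by omega, l', by simp [hsp'], ?_,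
          d1, d2, .inl ⟨by simpa using hfl1, by omega⟩⟩
        refine e5.congr ?_ ?_ ?_ ?_ <;> intro k hk <;> simp
      · simp only [Test.holds_realLT, scoreE, RExp.val_sub, RExp.val_mul, val_toX, val_XV, val_XA,
          val_V, val_A, State.w_setX, State.x_setX_self, Function.update_self, hy, ne_eq,
          reduceCtorEq, not_false_eq_true, State.x_setX_of_ne, hsp', e2, e3, hcx', hcf',
          not_lt] at hlt
        rw [Item.score_eq rfl, Item.score_eq rfl] at hlt
        refine Run.setV (by simp) (by omega) ?_
        refine Run.nil (by omega) ⟨hF.setX.setW, hi', by omega, (s, b) :: l', by simpa using hsp',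
          ?_, hc'', hb', .inr ⟨by simp, by simp only [List.length_cons]; omega, ?_⟩⟩
        · refine hrep.congr ?_ ?_ ?_ ?_ <;> intro k hk <;> simp
        · intro s' b' l'' h
          simp only [List.cons.injEq, Prod.mk.injEq] at h
          obtain ⟨⟨rfl, rfl⟩, -⟩ := h
          exact hlt
  · simp only [Test.holds_wordLT, WExp.val_ofNat, val_V, not_lt] at ht
    rcases hfl' with ⟨h, -⟩ | ⟨-, h1, h2⟩
    · omega
    · exact ⟨U + 8 * l'.length, by omega, hF, hi', hhi', l', rfl, hsp', hl', hc', hb', h2⟩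

/-- Inserting an item into the envelope. The time is paid for by the removal of items from the
stack, up to a constant. -/
theorem push_run {K : ℕ} {σ : State} {U h : ℕ} {a : Item} {l : List (ℕ × Item)} {seen : List Item}
    (hp : Params K M T σ) (hK : 0 < K) (hT0 : 0 < T) (hT : T < E.Q) (hsp : σ.w .sp 0 = l.length)
    (hl : StackRep σ l) (hit : σ.w .it 0 = h)
    (hax : σ.w .xx h = a.x) (haf : σ.x .ff h = a.f) (hai : σ.w .id h = a.id)
    (hc : Envelope K (2 * M) T l seen) (hx : ∀ b ∈ seen, b.x ≤ a.x) :
    Run E push σ (U + 8 * l.length + 50) fun τ T' => Frame pushW pushX σ τ ∧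
      ∃ l', T' = U + 8 * l'.length ∧ τ.w .sp 0 = l'.length ∧ StackRep τ l' ∧
      Envelope K (2 * M) T l' (a :: seen) := by
  have hQ := E.hQ
  refine Run.of_small fun hσ => ?_
  apply Run.weaken
  refine Run.cons (Run.setV (hσ.w _ _) (by omega) ?_)
  refine Run.cons (Run.setXV (by omega) ?_)
  refine Run.cons (Run.setV (by simpa [hit] using hσ.w .id h) (by omega) ?_)
  refine Run.cons (Run.setV (by simp; omega) (by omega) ?_)
  simp only [val_A, val_V, val_XA, hit, hax, State.w_setX, ne_eq, reduceCtorEq, not_false_eq_true,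
    State.w_setW_of_ne, State.x_setW, haf, hai, WExp.val_ofNat]
  set σ₁ := (((σ.setW .cx 0 a.x).setX .cf 0 a.f).setW .ci 0 a.id).setW .fl 0 1 with hσ₁
  have hF₁ : Frame pushW pushX σ σ₁ :=
    Frame.setW <| Frame.setW <| Frame.setX <| Frame.setW <| Frame.refl _
  obtain ⟨hi, hhi, hc1, hb1⟩ := hc.exists_cover a
  refine Run.cons ((popLoop_run (U := U + 22) (a := a) (hp.of_frame hF₁) hT.le hhi (l := l)
    (by simpa [σ₁] using hsp)
    (hl.congr ?_ ?_ ?_ ?_) (by simp [σ₁]) (by simp [σ₁]) (by simp [σ₁]) hc1 hb1 hx).mono (by omega) ?_)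
  iterate 4 intro k _; simp [σ₁]
  rintro τ T' ⟨hF₂, hi', hhi', l', rfl, hsp', hl', hc', hb', htop⟩
  have hFτ : Frame pushW pushX σ τ := hF₁.trans hF₂.mono
  have hcx : τ.w .cx 0 = a.x := by rw [hF₂.w _ (by decide)]; simp [σ₁]
  have hci : τ.w .ci 0 = a.id := by rw [hF₂.w _ (by decide)]; simp [σ₁]
  have hcf : τ.x .cf 0 = a.f := by rw [hF₂.x _ (by decide)]; simp [σ₁]
  have hp' := hp.of_frame hFτ
  have hlen := hc'.length_le
  refine Run.cons (Run.branch (by omega) (fun h0 => ?_) (fun h0 => ?_))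
  · simp only [Test.holds_wordLE, WExp.val_ofNat, val_V, hsp'] at h0
    obtain rfl : l' = [] := List.length_eq_zero_iff.1 (by omega)
    refine (pushItem_run (E := E) (U := U + 15) (v := 0) (a := a) (l := []) (by simp; omega)
      (by simpa using hsp') trivial (by simp) (by omega) hcx hci hcf).mono (by simp) ?_
    rintro ρ _ ⟨rfl, hF₃, h3, h4⟩
    exact Run.nil (by omega) ⟨U + 8, by omega, hFτ.trans hF₃, _, by simp, by simpa using h3, h4,
      hc'.push_nil hT0 hb'⟩
  · simp only [Test.holds_wordLE, WExp.val_ofNat, val_V, hsp'] at h0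
    obtain ⟨⟨s, b⟩, l', rfl⟩ := List.exists_cons_of_length_pos (show 0 < l'.length by omega)
    have hs := htop s b l' rfl
    have hbs : b ∈ seen := hc'.2.1
    refine Run.cons (Run.setXV (by omega) ?_)
    have hy : (toX (V .K) * toX (V .T - 1) - toX (2 * V .M)).val τ =
        (K : ℝ) * (T - 1 : ℕ) - (2 * M : ℕ) := by
      simp [hp'.K, hp'.M, hp'.T]
    rw [hy]
    set τ₁ := τ.setX .y 0 ((K : ℝ) * (T - 1 : ℕ) - (2 * M : ℕ)) with hτ₁
    have hFτ₁ : Frame pushW pushX σ τ₁ := hFτ.setX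
    have hrep : StackRep τ₁ ((s, b) :: l') := by
      refine hl'.congr ?_ ?_ ?_ ?_ <;> intro k hk <;> simp [τ₁]
    have hp₁ := hp.of_frame hFτ₁
    have hsp₁ : τ₁.w .sp 0 = l'.length + 1 := by simpa [τ₁] using hsp'
    have hcx₁ : τ₁.w .cx 0 = a.x := by simpa [τ₁] using hcx
    have hci₁ : τ₁.w .ci 0 = a.id := by simpa [τ₁] using hci
    have hcf₁ : τ₁.x .cf 0 = a.f := by simpa [τ₁] using hcf
    have hy₁ : τ₁.x .y 0 = (K : ℝ) * (T - 1 : ℕ) - (2 * M : ℕ) := by simp [τ₁]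
    have hrep' := hrep
    obtain ⟨e1, e2, e3, e4, e5⟩ := hrep'
    simp only [List.length_cons] at hsp' hlen
    refine Run.cons (Run.branch (by omega) (fun hlt => ?_) (fun hlt => ?_))
    · simp only [Test.holds_realLT, scoreE, RExp.val_sub, RExp.val_mul, val_toX, val_XV, val_XA,
          val_V, val_A, hsp₁, e2, e3, hcx₁, hcf₁, hy₁] at hlt
      rw [Item.score_eq rfl, Item.score_eq rfl] at hlt
      have hlt' : b.x < a.x := by
        refine lt_of_le_of_ne (hx b hbs) fun he => ?_
        simp only [Item.score, he] at hlt hs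
        linarith
      have h0 : a.score K (2 * M) 0 ≤ b.score K (2 * M) 0 := by
        by_contra! hn
        exact absurd (Item.score_mono_lt hlt'.le (Nat.zero_le s) hn) (not_lt.2 hs)
      have hj₀ := Item.lt_score_iff hK hlt' h0
      have hxx : (0 : ℝ) < (a.x : ℝ) - b.x := sub_pos.2 (by exact_mod_cast hlt')
      have hval : crossing.val τ₁ = (b.f - a.f + ((a.x : ℝ) * a.x - b.x * b.x) +
          2 * ((a.x : ℝ) - b.x) * (2 * M : ℕ)) / (2 * ((a.x : ℝ) - b.x) * K) := by
        simp [crossing, hsp₁, e2, e3, hcx₁, hcf₁, hp₁.M, hp₁.K]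
      have hj1 : ⌊crossing.val τ₁⌋₊ + 1 ≤ T - 1 := by rw [hval]; exact (hj₀ _).2 hlt
      rw [← hval] at hj₀
      refine Run.cons (Run.floorV_good ?_ ?_ (by omega) (by omega) ?_)
      · refine ⟨RExp.good_of_clean _ rfl, RExp.good_of_clean _ rfl, fun _ => ?_⟩
        have : (0 : ℝ) < K := by exact_mod_cast hK
        simp only [RExp.val_sub, RExp.val_mul, val_toX, val_V, val_A, WExp.val_ofNat, hsp₁, e2,
          hcx₁, hp₁.K]
        positivity
      · rw [hval]
        apply div_nonneg
        · simp only [Item.score, Nat.cast_zero] at h0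
          nlinarith
        · positivity
      set j₀ := ⌊crossing.val τ₁⌋₊
      refine (pushItem_run (E := E) (U := U + 8 * l'.length + 18) (v := j₀ + 1) (a := a)
        (l := (s, b) :: l') (by simp; omega)
        (by simpa using hsp₁) (hrep.congr ?_ ?_ ?_ ?_) (by simp) (by omega)
        (by simpa using hcx₁) (by simpa using hci₁) (by simpa using hcf₁)).mono
        (by simp only [List.length_cons]; omega) ?_
      iterate 4 intro k _; simp
      rintro ρ _ ⟨rfl, hF₃, h3, h4⟩
      refine Run.nil (by omega) (Run.nil (by omega) ⟨_, ?_, hFτ₁.setW.trans hF₃, _, rfl,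
        by simpa using h3, h4, hc'.push_of_lt hb' hs hj₀ (by omega)⟩)
      simp only [List.length_cons]; omega
    · simp only [Test.holds_realLT, scoreE, RExp.val_sub, RExp.val_mul, val_toX, val_XV, val_XA,
          val_V, val_A, hsp₁, e2, e3, hcx₁, hcf₁, hy₁, not_lt] at hlt
      rw [Item.score_eq rfl, Item.score_eq rfl] at hlt
      refine Run.skip (by omega) (Run.nil (by omega) (Run.nil (by omega)
        ⟨_, ?_, hFτ₁, _, rfl, by simpa using hsp₁, hrep,
          hc'.push_of_le hhi' (hx b hbs) hb' hlt⟩))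
      simp only [List.length_cons]; omega

end

section

/-! ### One round: from buckets of items to the winners of all grid positions -/

/-- The linked list that starts at the node `h` holds the items `l`; the nodes are numbered from
`1`, and all of them are at most `c`. -/
def ListRep (σ : State) (c : ℕ) : ℕ → List Item → Prop
  | h, [] => h = 0
  | h, a :: l => 0 < h ∧ h ≤ c ∧ σ.w .xx h = a.x ∧ σ.x .ff h = a.f ∧ σ.w .id h = a.id ∧
      ListRep σ c (σ.w .nx h) l

theorem ListRep.congr {σ τ : State} {c h : ℕ} {l : List Item} (hl : ListRep σ c h l)
    (h1 : ∀ k ≤ c, τ.w .xx k = σ.w .xx k) (h2 : ∀ k ≤ c, τ.x .ff k = σ.x .ff k)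
    (h3 : ∀ k ≤ c, τ.w .id k = σ.w .id k) (h4 : ∀ k ≤ c, τ.w .nx k = σ.w .nx k) :
    ListRep τ c h l := by
  induction l generalizing h with
  | nil => exact hl
  | cons a l ih =>
    obtain ⟨e1, e2, e3, e4, e5, e6⟩ := hl
    refine ⟨e1, e2, by rw [h1 _ e2, e3], by rw [h2 _ e2, e4], by rw [h3 _ e2, e5], ?_⟩
    rw [h4 _ e2]
    exact ih e6

theorem ListRep.mono {σ : State} {c c' h : ℕ} {l : List Item} (hl : ListRep σ c h l)
    (hc : c ≤ c') : ListRep σ c' h l := by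
  induction l generalizing h with
  | nil => exact hl
  | cons a l ih =>
    obtain ⟨e1, e2, e3, e4, e5, e6⟩ := hl
    exact ⟨e1, e2.trans hc, e3, e4, e5, ih e6⟩

theorem ListRep.of_frame {σ τ : State} {S : List WReg} {S' : List XReg} {c h : ℕ} {l : List Item}
    (hl : ListRep σ c h l) (hF : Frame S S' σ τ) (h1 : WReg.xx ∉ S := by decide)
    (h2 : XReg.ff ∉ S' := by decide) (h3 : WReg.id ∉ S := by decide)
    (h4 : WReg.nx ∉ S := by decide) : ListRep τ c h l :=
  hl.congr (fun _ _ => by rw [hF.w _ h1]) (fun _ _ => by rw [hF.x _ h2])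
    (fun _ _ => by rw [hF.w _ h3]) (fun _ _ => by rw [hF.w _ h4])

/-- The concatenation of the `k` lists from the list `b` on. -/
def cat {α : Type*} (L : ℕ → List α) (b k : ℕ) : List α := (List.range' b k).flatMap L

section
variable {α : Type*} {L : ℕ → List α}

@[simp] theorem cat_zero (b : ℕ) : cat L b 0 = [] := rfl

theorem cat_succ (b k : ℕ) : cat L b (k + 1) = cat L b k ++ L (b + k) := by
  simp [cat, List.range'_concat]

theorem cat_succ' (b k : ℕ) : cat L b (k + 1) = L b ++ cat L (b + 1) k := by
  simp [cat, List.range'_succ]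

theorem cat_add (b k k' : ℕ) : cat L b (k + k') = cat L b k ++ cat L (b + k) k' := by
  induction k' with
  | zero => simp
  | succ k' ih => rw [← add_assoc, cat_succ, ih, cat_succ]; simp [add_assoc]

theorem mem_cat {a : α} {b k : ℕ} : a ∈ cat L b k ↔ ∃ i < k, a ∈ L (b + i) := by
  simp only [cat, List.mem_flatMap, List.mem_range'_1]
  constructor
  · rintro ⟨c, hc, h⟩
    exact ⟨c - b, by omega, by rwa [Nat.add_sub_cancel' hc.1]⟩
  · rintro ⟨i, hi, h⟩
    exact ⟨b + i, by omega, h⟩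

end

variable {E : Env} [E.Full] {K M T : ℕ}

/-- Insert all items of the linked list that starts at the node `it`. -/
def pushList : Program := .loop (.wordLT 0 (V .it)) (block [push, setV .it (A .nx (V .it))])

/-- The word variables that `pushList` may change. -/
abbrev pushListW : List WReg := .it :: pushW

theorem pushList_run {σ : State} {U c h : ℕ} {rem pre : List Item} {l : List (ℕ × Item)}
    (hp : Params K M T σ) (hK : 0 < K) (hT0 : 0 < T) (hT : T < E.Q) (hsp : σ.w .sp 0 = l.length)
    (hl : StackRep σ l) (hit : σ.w .it 0 = h) (hr : ListRep σ c h rem)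
    (hc : Envelope K (2 * M) T l pre.reverse)
    (hx : (pre ++ rem).Pairwise fun a b => a.x ≤ b.x) :
    Run E pushList σ (U + 8 * l.length + 55 * rem.length + 5) fun τ T' =>
      Frame pushListW pushX σ τ ∧ ∃ l', T' = U + 8 * l'.length ∧ τ.w .sp 0 = l'.length ∧
      StackRep τ l' ∧ Envelope K (2 * M) T l' (pre ++ rem).reverse := by
  have hQ := E.hQ
  refine Run.weaken <| Run.loop (fun τ T' => Frame pushListW pushX σ τ ∧
      ∃ h' l' pre' rem', pre' ++ rem' = pre ++ rem ∧
      τ.w .sp 0 = l'.length ∧ StackRep τ l' ∧ τ.w .it 0 = h' ∧ ListRep τ c h' rem' ∧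
      Envelope K (2 * M) T l' pre'.reverse ∧ U + 8 * l'.length + 55 * rem'.length + 5 ≤ T') ?_
    ⟨Frame.refl _, h, l, pre, rem, rfl, hsp, hl, hit, hr, hc, le_rfl⟩
  rintro τ T' ⟨hF, h', l', pre', rem', hpr, hsp', hl', hit', hr', hc', hT'⟩
  refine ⟨by omega, fun ht => ?_, fun ht => ?_⟩
  · simp only [Test.holds_wordLT, WExp.val_ofNat, val_V, hit'] at ht
    obtain _ | ⟨a, rem'⟩ := rem'
    · have : h' = 0 := hr'
      omega
    obtain ⟨e1, e2, e3, e4, e5, e6⟩ := hr'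
    simp only [List.length_cons] at hT'
    rw [← hpr] at hx
    refine Run.cons (((push_run (U := U + 55 * rem'.length + 8) (hp.of_frame hF) hK hT0 hT hsp' hl'
      hit' e3 e4 e5 hc' ?_)).mono (by omega) ?_)
    · intro b hb
      exact (List.pairwise_append.1 hx).2.2 b (List.mem_reverse.1 hb) a (List.mem_cons_self ..)
    rintro ρ _ ⟨hF', l₂, rfl, h1, h2, h3⟩
    refine Run.of_small fun hρ => ?_
    have hnx : ρ.w .nx h' = τ.w .nx h' := by rw [hF'.w _ (by decide)]
    have hit₂ : ρ.w .it 0 = h' := by rw [hF'.w _ (by decide), hit']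
    refine Run.cons (Run.setV (hρ.w _ _) (by omega) ?_)
    refine Run.nil (by omega) ⟨(hF.trans hF'.mono).setW, τ.w .nx h', l₂, pre' ++ [a], rem',
      by simpa using hpr, by simpa using h1, ?_, by simp [hit₂, hnx], ?_, by simpa using h3,
      by omega⟩
    · exact h2.congr (by simp) (by simp) (by simp) (by simp)
    · exact (e6.of_frame hF').congr (by simp) (by simp) (by simp) (by simp)
  · simp only [Test.holds_wordLT, WExp.val_ofNat, val_V, hit'] at ht
    obtain _ | ⟨a, rem'⟩ := rem'
    · simp only [List.append_nil] at hpr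
      subst hpr
      exact ⟨U + 8 * l'.length, by simp only [List.length_nil] at hT'; omega, hF, l', rfl, hsp',
        hl', hc'⟩
    · exact absurd hr'.1 ht

/-- The cell `ix` of the output arrays describes an optimal item of `stream` at the grid
position `j`; the index `0` signals that there are no items. -/
def Best (K O : ℕ) (stream : List Item) (σ : State) (j ix : ℕ) : Prop :=
  (stream = [] ∧ σ.w .oi ix = 0) ∨
  ∃ a ∈ stream, σ.w .oi ix = a.id ∧ σ.x .od ix = a.score K O j ∧
    ∀ b ∈ stream, b.score K O j ≤ a.score K O j

theorem Best.congr {O j ix : ℕ} {stream : List Item} {σ τ : State} (h : Best K O stream σ j ix)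
    (h1 : τ.w .oi ix = σ.w .oi ix) (h2 : τ.x .od ix = σ.x .od ix) : Best K O stream τ j ix := by
  simpa only [Best, h1, h2] using h

/-- Read off the envelope, from the last grid position to the first. -/
def emit : Program := forDown .jj (V .T) <| block [
  setV .ix (V .jj * V .NG + V .g),
  .branch (.wordLE (V .sp) 0) (setA .oi (V .ix) 0) <| block [
    setY (V .jj),
    setA .oi (V .ix) (A .si (V .sp)),
    setXA .od (V .ix) (scoreE (A .sx (V .sp)) (XA .sf (V .sp))),
    .branch (.wordLE (V .jj) (A .st (V .sp))) (setV .sp (V .sp - 1)) .skip]]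

/-- The word variables that `emit` may change. -/
abbrev emitW : List WReg := [.jj, .ix, .oi, .sp]

/-- The real variables that `emit` may change. -/
abbrev emitX : List XReg := [.y, .od]

theorem emit_run {σ : State} {l : List (ℕ × Item)} {stream : List Item} {NG g : ℕ}
    (hp : Params K M T σ) (hT : T < E.Q) (hNG : σ.w .NG 0 = NG) (hg : σ.w .g 0 = g)
    (hgN : g < NG) (hTN : T * NG ≤ E.Q) (hsp : σ.w .sp 0 = l.length) (hl : StackRep σ l)
    (hc : Envelope K (2 * M) T l stream) :
    Run E emit σ (T * 15 + 4) fun τ _ => Frame emitW emitX σ τ ∧ τ.w .sp 0 = 0 ∧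
      (∀ j < T, Best K (2 * M) stream τ j (j * NG + g)) ∧
      ∀ ix, (∀ j < T, ix ≠ j * NG + g) → τ.w .oi ix = σ.w .oi ix ∧ τ.x .od ix = σ.x .od ix := by
  refine Run.forDown (N := T) (b := 12) (T₀ := 0) (fun k τ _ => Frame emitW emitX σ τ ∧
    (∃ l', τ.w .sp 0 = l'.length ∧ StackRep τ l' ∧ Envelope K (2 * M) k l' stream) ∧
    (∀ j, k ≤ j → j < T → Best K (2 * M) stream τ j (j * NG + g)) ∧
    ∀ ix, (∀ j < T, ix ≠ j * NG + g) → τ.w .oi ix = σ.w .oi ix ∧ τ.x .od ix = σ.x .od ix)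
    (by omega) (by simp [hp.T]) (by omega) ?_ ?_ ?_
  · refine ⟨(Frame.refl _).setW, ⟨l, by simpa using hsp, ?_, hc⟩, by intros; omega, by simp⟩
    exact hl.congr (by simp) (by simp) (by simp) (by simp)
  · rintro k τ T' hk hjj ⟨hF, ⟨l', hsp', hl', hc'⟩, hB, hO⟩
    have hp' := hp.of_frame hF
    have hNG' : τ.w .NG 0 = NG := by rw [hF.w _ (by decide), hNG]
    have hg' : τ.w .g 0 = g := by rw [hF.w _ (by decide), hg]
    have hix : k * NG + g < T * NG := by
      have : (k + 1) * NG ≤ T * NG := Nat.mul_le_mul_right _ hk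
      linarith [add_mul k 1 NG]
    have hne : ∀ j, k + 1 ≤ j → j * NG + g ≠ k * NG + g := fun j hj => by
      have : (k + 1) * NG ≤ j * NG := Nat.mul_le_mul_right _ hj
      linarith [add_mul k 1 NG]
    refine Run.cons (Run.setV (by simp [hNG', hg']; omega) (by omega) ?_)
    simp only [WExp.val_add, WExp.val_mul, val_V, State.w_setW_self, Function.update_self, ne_eq,
      reduceCtorEq, not_false_eq_true, State.w_setW_of_ne, hNG', hg']
    set τ₁ := (τ.setW .jj 0 k).setW .ix 0 (k * NG + g) with hτ₁
    have hF₁ : Frame emitW emitX σ τ₁ := hF.setW.setW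
    have hsp₁ : τ₁.w .sp 0 = l'.length := by simpa [τ₁] using hsp'
    have hix₁ : τ₁.w .ix 0 = k * NG + g := by simp [τ₁]
    have hjj₁ : τ₁.w .jj 0 = k := by simp [τ₁]
    have hoi₁ : τ₁.w .oi = τ.w .oi := by simp [τ₁]
    have hod₁ : τ₁.x .od = τ.x .od := by simp [τ₁]
    have hl₁ : StackRep τ₁ l' := hl'.congr (by simp [τ₁]) (by simp [τ₁]) (by simp [τ₁])
      (by simp [τ₁])
    clear_value τ₁
    refine Run.cons (Run.branch (by omega) (fun h0 => ?_) (fun h0 => ?_))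
    · simp only [Test.holds_wordLE, WExp.val_ofNat, val_V, hsp₁] at h0
      obtain rfl : l' = [] := List.length_eq_zero_iff.1 (by omega)
      obtain ⟨rfl, -⟩ | hc' := hc'
      · refine Run.setA (by simp) (by omega) (Run.nil (by omega) ⟨by simpa using hjj₁, hF₁.setW,
          ⟨[], by simpa using hsp₁, trivial, .inl ⟨rfl, rfl⟩⟩, ?_, ?_⟩)
        · intro j hj hjT
          by_cases hjk : j = k
          · exact .inl ⟨rfl, by simp [hix₁, hjk]⟩
          · have := hne j (by omega)
            exact (hB j (by omega) hjT).congr (by simp [hix₁, Function.update_of_ne this, hoi₁]) (by simp [hod₁])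
        · intro ix hix'
          obtain ⟨o1, o2⟩ := hO ix hix'
          exact ⟨by simp [hix₁, hix' k hk, hoi₁, o1], by simp [hod₁, o2]⟩
      · exact absurd (show k + 1 = 0 from hc') (by omega)
    · simp only [Test.holds_wordLE, WExp.val_ofNat, val_V, hsp₁] at h0
      obtain ⟨⟨s, a⟩, l', rfl⟩ := List.exists_cons_of_length_pos (show 0 < l'.length by omega)
      obtain ⟨-, h⟩ | hc' := hc'
      · cases h
      have hl₁' := hl₁
      obtain ⟨e1, e2, e3, e4, e5⟩ := hl₁'
      obtain ⟨c1, c2, c3, c4⟩ := hc'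
      simp only [List.length_cons] at hsp₁
      have hp₁ := hp.of_frame hF₁
      refine Run.of_small fun hτ₁s => ?_
      have haid : a.id ≤ E.Q := e4 ▸ hτ₁s.w _ _
      refine Run.cons (Run.setXV (by omega) ?_)
      refine Run.cons (Run.setA (by simpa [hsp₁, e4] using haid) (by omega) ?_)
      refine Run.cons (Run.setXA (by omega) ?_)
      have hy : (toX (V .K) * toX (V .jj) - toX (2 * V .M)).val τ₁ =
          (K : ℝ) * k - (2 * M : ℕ) := by
        simp [hp₁.K, hp₁.M, hjj₁]
      rw [hy]
      simp only [val_V, State.w_setX, hix₁, val_A, hsp₁, e4, scoreE, RExp.val_sub, val_XA, val_toX,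
        RExp.val_mul, State.w_setW_of_ne, State.x_setW, ne_eq, reduceCtorEq,
        not_false_eq_true, State.x_setX_of_ne, State.x_setX_self, Function.update_self, val_XV,
        e2, e3]
      rw [Item.score_eq rfl]
      set τ₂ := (((τ₁.setX .y 0 ((K : ℝ) * k - (2 * M : ℕ))).setW .oi (k * NG + g) a.id).setX .od
        (k * NG + g) (a.score K (2 * M) k)) with hτ₂
      have hF₂ : Frame emitW emitX σ τ₂ := hF₁.setX.setW.setX
      have hl₂ : StackRep τ₂ ((s, a) :: l') := hl₁.congr (by simp [τ₂]) (by simp [τ₂])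
        (by simp [τ₂]) (by simp [τ₂])
      have hjj₂ : τ₂.w .jj 0 = k := by simpa [τ₂] using hjj₁
      have hsp₂ : τ₂.w .sp 0 = l'.length + 1 := by simpa [τ₂] using hsp₁
      have hB₂ : ∀ j, k ≤ j → j < T → Best K (2 * M) stream τ₂ j (j * NG + g) := by
        intro j hj hjT
        by_cases hjk : j = k
        · subst hjk
          exact .inr ⟨a, c2, by simp [τ₂], by simp [τ₂], fun b hb => c3 j (by omega) (by omega) b hb⟩
        · have := hne j (by omega)
          exact (hB j (by omega) hjT).congr (by simp [τ₂, Function.update_of_ne this, hoi₁])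
            (by simp [τ₂, Function.update_of_ne this, hod₁])
      have hO₂ : ∀ ix, (∀ j < T, ix ≠ j * NG + g) →
          τ₂.w .oi ix = σ.w .oi ix ∧ τ₂.x .od ix = σ.x .od ix := by
        intro ix hix'
        obtain ⟨o1, o2⟩ := hO ix hix'
        exact ⟨by simp [τ₂, hix' k hk, hoi₁, o1], by simp [τ₂, hix' k hk, hod₁, o2]⟩
      clear_value τ₂
      obtain ⟨f1, f2, f3, f4, f5⟩ := hl₂
      have hlen := c4.length_le
      refine Run.cons (Run.branch (by omega) (fun h1 => ?_) (fun h1 => ?_))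
      · simp only [Test.holds_wordLE, val_V, val_A, hjj₂, hsp₂, f1] at h1
        obtain rfl : s = k := by omega
        refine Run.setV (by simp [hsp₂]; omega) (by omega) (Run.nil (by omega) (Run.nil (by omega)
          ⟨by simpa using hjj₂, hF₂.setW, ⟨l', by simp [hsp₂], ?_, .inr c4⟩, ?_, ?_⟩))
        · exact f5.congr (by simp) (by simp) (by simp) (by simp)
        · exact fun j hj hjT => (hB₂ j hj hjT).congr (by simp) (by simp)
        · intro ix hix'
          simpa using hO₂ ix hix'
      · simp only [Test.holds_wordLE, val_V, val_A, hjj₂, hsp₂, f1] at h1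
        refine Run.skip (by omega) (Run.nil (by omega) (Run.nil (by omega)
          ⟨hjj₂, hF₂, ⟨(s, a) :: l', hsp₂, ⟨f1, f2, f3, f4, f5⟩, .inr ⟨by omega, c2, ?_, c4⟩⟩,
            hB₂, hO₂⟩))
        exact fun j hj hj' b hb => c3 j hj (by omega) b hb
  · rintro τ T' - ⟨hF, ⟨l', hsp', hl', hc'⟩, hB, hO⟩
    refine ⟨hF, ?_, fun j hj => hB j (Nat.zero_le _) hj, hO⟩
    have := hc'.length_le
    omega

/-- Insert the items of the group `g` of buckets into the envelope, and read it off. -/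
def group : Program := block [
  forUp .r (V .R) <| block [setV .it (A .hd (V .g * V .R + V .r)), pushList],
  emit]

/-- One round of the algorithm, for the `NG` groups of `R` buckets each. -/
def phase : Program := block [setV .sp 0, forUp .g (V .NG) group]

/-- The word variables that `group` may change. -/
abbrev groupW : List WReg := .r :: pushListW ++ emitW

/-- The real variables that `group` may change. -/
abbrev groupX : List XReg := pushX ++ emitX

/-- The array `hd` holds the starts of `N` linked lists, which hold the items `L`. -/
def BucketRep (σ : State) (N c : ℕ) (L : ℕ → List Item) : Prop :=
  ∀ b < N, ListRep σ c (σ.w .hd b) (L b)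

theorem BucketRep.of_frame {σ τ : State} {S : List WReg} {S' : List XReg} {N c : ℕ}
    {L : ℕ → List Item} (hl : BucketRep σ N c L) (hF : Frame S S' σ τ)
    (h1 : WReg.xx ∉ S := by decide)
    (h2 : XReg.ff ∉ S' := by decide) (h3 : WReg.id ∉ S := by decide)
    (h4 : WReg.nx ∉ S := by decide) (h5 : WReg.hd ∉ S := by decide) : BucketRep τ N c L :=
  fun b hb => by rw [hF.w _ h5]; exact (hl b hb).of_frame hF h1 h2 h3 h4

theorem group_run {σ : State} {NG R g c U : ℕ} {L : ℕ → List Item}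
    (hp : Params K M T σ) (hK : 0 < K) (hT0 : 0 < T) (hT : T < E.Q) (hNG : σ.w .NG 0 = NG)
    (hR : σ.w .R 0 = R) (hg : σ.w .g 0 = g) (hgN : g < NG) (hTN : T * NG ≤ E.Q)
    (hRQ : R ≤ E.Q) (hsp : σ.w .sp 0 = 0) (hL : BucketRep σ (NG * R) c L)
    (hx : (cat L (g * R) R).Pairwise fun a b => a.x ≤ b.x) :
    Run E group σ (U + 55 * (cat L (g * R) R).length + (R * 12 + T * 15 + 12)) fun τ T' =>
      T' = U ∧ Frame groupW groupX σ τ ∧ τ.w .sp 0 = 0 ∧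
      (∀ j < T, Best K (2 * M) (cat L (g * R) R) τ j (j * NG + g)) ∧
      ∀ ix, (∀ j < T, ix ≠ j * NG + g) → τ.w .oi ix = σ.w .oi ix ∧ τ.x .od ix = σ.x .od ix := by
  have hbR : g * R + R ≤ NG * R := by
    have := Nat.mul_le_mul_right R (show g + 1 ≤ NG from hgN)
    linarith [add_mul g 1 R]
  refine Run.weaken <| Run.cons <| Run.forUp (N := R) (b := 9) (T₀ := U + T * 15 + 8 +
    55 * (cat L (g * R) R).length) (fun k τ T' =>
    Frame (.r :: pushListW) pushX σ τ ∧ ∃ l, τ.w .sp 0 = l.length ∧ StackRep τ l ∧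
      Envelope K (2 * M) T l (cat L (g * R) k).reverse ∧
      U + T * 15 + 8 + 55 * (cat L (g * R + k) (R - k)).length + 8 * l.length ≤ T')
    hRQ ?_ (by omega) ?_ ?_ ?_
  · rintro k τ T' - - ⟨hF, -⟩
    simp [hF.w .R (by decide), hR]
  · refine ⟨(Frame.refl _).setW, [], by simpa using hsp, trivial, .inl ⟨rfl, rfl⟩, by simp⟩
  · rintro k τ T' hk hr ⟨hF, l, hsp', hl, hc, hT'⟩
    have hg' : τ.w .g 0 = g := by rw [hF.w _ (by decide), hg]
    have hR' : τ.w .R 0 = R := by rw [hF.w _ (by decide), hR]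
    have hLb := (hL.of_frame hF) (g * R + k) (by omega)
    have hsplit : cat L (g * R + k) (R - k) = L (g * R + k) ++ cat L (g * R + (k + 1)) (R - (k + 1)) := by
      rw [show R - k = R - (k + 1) + 1 by omega, cat_succ', add_assoc]
    have hsub : cat L (g * R) R = cat L (g * R) k ++ L (g * R + k) ++
        cat L (g * R + (k + 1)) (R - (k + 1)) := by
      rw [List.append_assoc, ← hsplit, ← cat_add, Nat.add_sub_cancel' hk.le]
    rw [hsplit, List.length_append] at hT'
    rw [hsub] at hx
    refine Run.of_small fun hτ => Run.weaken ?_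
    refine Run.cons (Run.setV (hτ.w _ _) (by omega) ?_)
    simp only [val_A, WExp.val_add, WExp.val_mul, val_V, hg', hR', hr]
    refine Run.cons ((pushList_run (U := T' - 8 * l.length - 55 * (L (g * R + k)).length + 3)
      (c := c) (T := T) (h := τ.w .hd (g * R + k))
      (rem := L (g * R + k)) (pre := cat L (g * R) k) (l := l) ((hp.of_frame hF).of_frame
      (Frame.setW (S := [.it]) (S' := []) (Frame.refl _))) hK hT0 hT (by simpa using hsp')
      (hl.congr (by simp) (by simp) (by simp) (by simp)) (by simp)
      (hLb.congr (by simp) (by simp) (by simp) (by simp)) hc (List.pairwise_append.1 hx).1).mono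
      (by omega) ?_)
    rintro ρ _ ⟨hF', l', rfl, h1, h2, h3⟩
    refine Run.nil (by omega) ⟨_, le_rfl, ?_, (hF.setW.trans hF'.mono).setW, l', by simpa using h1,
      h2.congr (by simp) (by simp) (by simp) (by simp), by rwa [cat_succ], by omega⟩
    rw [hF'.w _ (by decide)]
    simpa using hr
  · rintro τ T' - ⟨hF, l, hsp', hl, hc, hT'⟩
    refine Run.cons ((emit_run (g := g) (NG := NG) (hp.of_frame hF) hT
      (by rw [hF.w _ (by decide), hNG]) (by rw [hF.w _ (by decide), hg]) hgN hTN hsp' hl hc).call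
      (by omega) ?_)
    rintro ρ ⟨hF', h1, h2, h3⟩
    refine Run.nil (by omega) ⟨U, by omega, rfl, hF.mono.trans hF'.mono, h1, ?_, ?_⟩
    · intro j hj
      simpa [Best] using h2 j hj
    · intro ix hix
      obtain ⟨o1, o2⟩ := h3 ix hix
      exact ⟨by rw [o1, hF.w _ (by decide)], by rw [o2, hF.x _ (by decide)]⟩

/-- For every group and every grid position, a round finds an optimal item of the group. -/
theorem phase_run {σ : State} {NG R c I : ℕ} {L : ℕ → List Item}
    (hp : Params K M T σ) (hK : 0 < K) (hT0 : 0 < T) (hT : T < E.Q) (hNG : σ.w .NG 0 = NG)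
    (hR : σ.w .R 0 = R) (hNGQ : NG ≤ E.Q) (hTN : T * NG ≤ E.Q)
    (hRQ : R ≤ E.Q) (hL : BucketRep σ (NG * R) c L)
    (hI : (cat L 0 (NG * R)).length ≤ I)
    (hx : ∀ g < NG, (cat L (g * R) R).Pairwise fun a b => a.x ≤ b.x) :
    Run E phase σ (55 * I + NG * (R * 12 + T * 15 + 15) + 6) fun τ _ =>
      Frame (.g :: groupW) groupX σ τ ∧
      ∀ g < NG, ∀ j < T, Best K (2 * M) (cat L (g * R) R) τ j (j * NG + g) := by
  refine Run.cons (Run.setV (by simp) (by omega) (Run.cons ?_))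
  refine Run.forUp (N := NG) (b := R * 12 + T * 15 + 12) (T₀ := 55 * I + 1) (fun k τ T' =>
    Frame (.g :: groupW) groupX σ τ ∧ τ.w .sp 0 = 0 ∧
    (∀ g < k, ∀ j < T, Best K (2 * M) (cat L (g * R) R) τ j (j * NG + g)) ∧
    55 * (cat L (k * R) (NG * R - k * R)).length + 1 ≤ T')
    hNGQ ?_ (by
      have : NG * (R * 12 + T * 15 + 12 + 3) = NG * (R * 12 + T * 15 + 15) := rfl
      omega) ?_ ?_ ?_
  · rintro k τ T' - - ⟨hF, -⟩
    simp [hF.w .NG (by decide), hNG]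
  · exact ⟨(Frame.refl _).setW.setW, by simp, by simp, by simpa using hI⟩
  · rintro k τ T' hk hg ⟨hF, hsp, hB, hT'⟩
    have hkR : k * R + R ≤ NG * R := by
      have := Nat.mul_le_mul_right R (show k + 1 ≤ NG from hk)
      linarith [add_mul k 1 R]
    have hsplit : cat L (k * R) (NG * R - k * R) =
        cat L (k * R) R ++ cat L ((k + 1) * R) (NG * R - (k + 1) * R) := by
      rw [show NG * R - k * R = R + (NG * R - (k + 1) * R) by rw [add_mul]; omega, cat_add,
        add_mul, one_mul]
    rw [hsplit, List.length_append] at hT'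
    refine (group_run (U := T' - 55 * (cat L (k * R) R).length) (hp.of_frame hF) hK hT0 hT
      (by rw [hF.w _ (by decide), hNG]) (by rw [hF.w _ (by decide), hR]) hg hk hTN hRQ hsp
      (hL.of_frame hF) (hx k hk)).mono (by omega) ?_
    rintro ρ _ ⟨rfl, hF', h1, h2, h3⟩
    refine ⟨by rw [hF'.w _ (by decide), hg], (hF.trans hF'.mono).setW, by simpa using h1, ?_,
      by omega⟩
    intro g' hg' j hj
    by_cases hgk : g' = k
    · subst hgk
      exact (h2 j hj).congr (by simp) (by simp)
    · have hne : ∀ j' < T, j * NG + g' ≠ j' * NG + k := by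
        intro j' _ he
        have h4 := congrArg (· % NG) he
        simp only [Nat.mul_add_mod_self_right, Nat.mod_eq_of_lt hk,
          Nat.mod_eq_of_lt (show g' < NG by omega)] at h4
        exact hgk h4
      obtain ⟨o1, o2⟩ := h3 _ hne
      exact (hB g' (by omega) j hj).congr (by simp [o1]) (by simp [o2])
  · rintro τ T' - ⟨hF, -, hB, hT'⟩
    exact Run.nil (by omega) ⟨hF, hB⟩

end

section

/-! ### Nearest points of a face grid, one direction after the other -/

/-- The discretized input as seen from one face of a box around it. There are `n` points; the point
`p` has the distance `h p` from the face and the integer coordinates `x k p`, which are less than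
`G`, in the directions of the face. In every direction, the face carries a grid of the `T`
positions `K * j - 2 * M`. -/
structure Face where
  n : ℕ
  K : ℕ
  M : ℕ
  T : ℕ
  G : ℕ
  x : ℕ → ℕ → ℕ
  h : ℕ → ℝ

/-- The negative square of the distance of the point `p` from a point of the face grid, where only
the first `k` directions of the face are taken into account. The grid positions
are encoded by the digits of `c` in base `T`. -/
noncomputable def Face.obj (F : Face) : ℕ → ℕ → ℕ → ℝ
  | 0, p, _ => -(F.h p) ^ 2
  | k + 1, p, c => F.obj k p (c % F.T ^ k) -
      ((F.x k p : ℝ) - ((F.K : ℝ) * (c / F.T ^ k : ℕ) - (2 * F.M : ℕ))) ^ 2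

/-- The coordinates of the point `p` in the `e` directions from `k` on, as the digits of a number
in base `G`. -/
def Face.key (F : Face) : ℕ → ℕ → ℕ → ℕ
  | _, 0, _ => 0
  | k, e + 1, p => F.key (k + 1) e p * F.G + F.x k p

theorem Face.key_lt (F : Face) {m p : ℕ} (hx : ∀ k < m, F.x k p < F.G) :
    ∀ e k, k + e ≤ m → F.key k e p < F.G ^ e
  | 0, _, _ => by simp [Face.key]
  | e + 1, k, hk => by
    have h1 := F.key_lt hx e (k + 1) (by omega)
    have h2 := hx k (by omega)
    have h3 : (F.key (k + 1) e p + 1) * F.G ≤ F.G ^ e * F.G := Nat.mul_le_mul_right _ h1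
    rw [Face.key, pow_succ]
    linarith [add_mul (F.key (k + 1) e p) 1 F.G]

/-- The lists `L` (there are `R` for every group) hold the candidates after `k` rounds. A group
belongs to grid positions `c` in the first `k` directions and integer coordinates
in the last `e` directions; the coordinate in the direction in between is the one of the items. -/
structure Face.Buckets (F : Face) (k e R : ℕ) (L : ℕ → List Item) : Prop where
  sound : ∀ g < F.T ^ k * F.G ^ e, ∀ a ∈ cat L (g * R) R, ∃ p < F.n, ∃ c < F.T ^ k,
    g = c * F.G ^ e + F.key (k + 1) e p ∧ a.id = p + 1 ∧ a.x = F.x k p ∧ a.f = F.obj k p c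
  complete : ∀ p < F.n, ∀ c < F.T ^ k,
    ∃ a ∈ cat L ((c * F.G ^ e + F.key (k + 1) e p) * R) R, a.x = F.x k p ∧ F.obj k p c ≤ a.f
  sorted : ∀ g < F.T ^ k * F.G ^ e, (cat L (g * R) R).Pairwise fun a b => a.x ≤ b.x

/-- The output arrays describe, for all grid positions in the first `k` directions and all
integer coordinates in the last `e` directions, an optimal point with these coordinates. -/
structure Face.Winners (F : Face) (k e : ℕ) (σ : State) : Prop where
  sound : ∀ b < F.T ^ k * F.G ^ e, σ.w .oi b ≠ 0 → ∃ p < F.n, ∃ c < F.T ^ k,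
    b = c * F.G ^ e + F.key k e p ∧ σ.w .oi b = p + 1 ∧ σ.x .od b = F.obj k p c
  complete : ∀ p < F.n, ∀ c < F.T ^ k, σ.w .oi (c * F.G ^ e + F.key k e p) ≠ 0 ∧
    F.obj k p c ≤ σ.x .od (c * F.G ^ e + F.key k e p)

/-- The effect of a round. -/
theorem Face.Buckets.winners {F : Face} {k e R m : ℕ} {L : ℕ → List Item} {σ : State}
    (hL : F.Buckets k e R L) (hT : 0 < F.T)
    (hx : ∀ k < m, ∀ p < F.n, F.x k p < F.G) (hm : k + 1 + e ≤ m)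
    (hB : ∀ g < F.T ^ k * F.G ^ e, ∀ j < F.T,
      Best F.K (2 * F.M) (cat L (g * R) R) σ j (j * (F.T ^ k * F.G ^ e) + g)) :
    F.Winners (k + 1) e σ := by
  have hTk : 0 < F.T ^ k := by positivity
  have hobj : ∀ p c j, c < F.T ^ k → F.obj (k + 1) p (j * F.T ^ k + c) = F.obj k p c -
      ((F.x k p : ℝ) - ((F.K : ℝ) * j - (2 * F.M : ℕ))) ^ 2 := by
    intro p c j hc
    rw [Face.obj, Nat.mul_add_mod_self_right, Nat.mod_eq_of_lt hc, add_comm (j * _) c,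
      Nat.add_mul_div_right _ _ hTk, Nat.div_eq_of_lt hc, zero_add]
  constructor
  · intro b hb hb0
    set N := F.T ^ k * F.G ^ e with hN
    have hN0 : 0 < N := by
      rcases Nat.eq_zero_or_pos N with h | h
      · rw [pow_succ, mul_right_comm, ← hN, h, zero_mul] at hb; omega
      · exact h
    have hj : b / N < F.T := by
      rw [Nat.div_lt_iff_lt_mul hN0, hN]
      calc b < _ := hb
        _ = _ := by ring
    rcases hB (b % N) (Nat.mod_lt _ hN0) (b / N) hj with ⟨-, h⟩ | ⟨a, ha, h1, h2, -⟩
    · rw [Nat.div_add_mod'] at h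
      exact absurd h hb0
    · rw [Nat.div_add_mod'] at h1 h2
      obtain ⟨p, hp, c, hc, e1, e2, e3, e4⟩ := hL.sound _ (Nat.mod_lt _ hN0) a ha
      refine ⟨p, hp, b / N * F.T ^ k + c, ?_, ?_, by rw [h1, e2], ?_⟩
      · have := Nat.mul_le_mul_right (F.T ^ k) hj
        rw [pow_succ']
        calc _ < b / N * F.T ^ k + F.T ^ k := by omega
          _ = (b / N + 1) * F.T ^ k := by ring
          _ ≤ _ := this
      · conv_lhs => rw [← Nat.div_add_mod' b N, e1, hN]
        ring
      · rw [h2, hobj p c _ hc, Item.score, e3, e4]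
  · intro p hp c' hc'
    obtain ⟨j, c, hc, hj, rfl⟩ : ∃ j c, c < F.T ^ k ∧ j < F.T ∧ c' = j * F.T ^ k + c :=
      ⟨c' / F.T ^ k, c' % F.T ^ k, Nat.mod_lt _ hTk, by
        rw [Nat.div_lt_iff_lt_mul hTk, ← pow_succ']; exact hc', (Nat.div_add_mod' _ _).symm⟩
    have hg : c * F.G ^ e + F.key (k + 1) e p < F.T ^ k * F.G ^ e := by
      have h1 := F.key_lt (p := p) (fun k hk => hx k hk p hp) e (k + 1) (by omega)
      have h2 := Nat.mul_le_mul_right (F.G ^ e) (show c + 1 ≤ _ from hc)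
      linarith [add_mul c 1 (F.G ^ e)]
    have hix : (j * F.T ^ k + c) * F.G ^ e + F.key (k + 1) e p =
        j * (F.T ^ k * F.G ^ e) + (c * F.G ^ e + F.key (k + 1) e p) := by ring
    obtain ⟨a, ha, e1, e2⟩ := hL.complete p hp c hc
    rw [hix, hobj p c _ hc]
    rcases hB _ hg j hj with ⟨h, -⟩ | ⟨b, hb, h1, h2, h3⟩
    · rw [h] at ha; cases ha
    · obtain ⟨p', -, c', -, -, e4, -⟩ := hL.sound _ hg b hb
      refine ⟨by rw [h1, e4]; omega, ?_⟩
      rw [h2]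
      refine le_trans ?_ (h3 a ha)
      rw [Item.score, e1]
      linarith

/-- The winners of a round as the items of the next one. -/
noncomputable def winnerList (G : ℕ) (σ : State) (b : ℕ) : List Item :=
  if σ.w .oi b = 0 then [] else [⟨b % G, σ.x .od b, σ.w .oi b⟩]

theorem Face.Winners.buckets {F : Face} {k e m : ℕ} {σ : State} (hW : F.Winners k (e + 1) σ)
    (hx : ∀ k < m, ∀ p < F.n, F.x k p < F.G) (hm : k + 1 + e ≤ m) (hG : 0 < F.G) :
    F.Buckets k e F.G (winnerList F.G σ) := by
  have hmem : ∀ g a, a ∈ cat (winnerList F.G σ) (g * F.G) F.G ↔ ∃ r < F.G,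
      σ.w .oi (g * F.G + r) ≠ 0 ∧
      a = ⟨r, σ.x .od (g * F.G + r), σ.w .oi (g * F.G + r)⟩ := by
    intro g a
    rw [mem_cat]
    refine exists_congr fun r => and_congr_right fun hr => ?_
    have : (g * F.G + r) % F.G = r := by rw [Nat.mul_add_mod_self_right, Nat.mod_eq_of_lt hr]
    rw [winnerList, this]
    split_ifs with h <;> simp [h]
  have hkey : ∀ c p, c * F.G ^ (e + 1) + F.key k (e + 1) p =
      (c * F.G ^ e + F.key (k + 1) e p) * F.G + F.x k p := by
    intro c p
    rw [Face.key]; ring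
  refine ⟨?_, ?_, ?_⟩
  · intro g hg a ha
    obtain ⟨r, hr, h0, rfl⟩ := (hmem g a).1 ha
    have hb : g * F.G + r < F.T ^ k * F.G ^ (e + 1) := by
      have := Nat.mul_le_mul_right F.G (show g + 1 ≤ _ from hg)
      rw [pow_succ, ← mul_assoc]
      linarith [add_mul g 1 F.G]
    obtain ⟨p, hp, c, hc, e1, e2, e3⟩ := hW.sound _ hb h0
    have hxp := hx k (by omega) p hp
    rw [hkey] at e1
    have hr' : r = F.x k p := by
      have := congrArg (· % F.G) e1
      simpa only [Nat.mul_add_mod_self_right, Nat.mod_eq_of_lt hr, Nat.mod_eq_of_lt hxp] using this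
    refine ⟨p, hp, c, hc, ?_, e2, hr', e3⟩
    have h2 : g * F.G = (c * F.G ^ e + F.key (k + 1) e p) * F.G := by omega
    exact Nat.eq_of_mul_eq_mul_right hG h2
  · intro p hp c hc
    have hxp := hx k (by omega) p hp
    obtain ⟨h1, h2⟩ := hW.complete p hp c hc
    rw [hkey] at h1 h2
    exact ⟨_, (hmem _ _).2 ⟨F.x k p, hxp, h1, rfl⟩, rfl, h2⟩
  · intro g _
    rw [cat, List.pairwise_flatMap]
    constructor
    · intro b _
      rw [winnerList]
      split_ifs <;> simp
    · refine (List.pairwise_lt_range' (s := g * F.G) (n := F.G)).imp_of_mem ?_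
      intro b b' hb hb' hlt a ha a' ha'
      rw [List.mem_range'_1] at hb hb'
      obtain ⟨r, rfl⟩ := Nat.exists_eq_add_of_le hb.1
      obtain ⟨r', rfl⟩ := Nat.exists_eq_add_of_le hb'.1
      rw [winnerList] at ha ha'
      split_ifs at ha ha' <;> simp only [List.mem_singleton, List.not_mem_nil] at ha ha'
      subst ha ha'
      simp only [Nat.mul_add_mod_self_right, Nat.mod_eq_of_lt (show r < F.G by omega),
        Nat.mod_eq_of_lt (show r' < F.G by omega)]
      omega

theorem length_winnerList_le (G : ℕ) (σ : State) (b : ℕ) : (winnerList G σ b).length ≤ 1 := by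
  rw [winnerList]; split_ifs <;> simp

theorem length_cat_le {α : Type*} {L : ℕ → List α} (hL : ∀ b, (L b).length ≤ 1) (b k : ℕ) :
    (cat L b k).length ≤ k := by
  induction k with
  | zero => simp
  | succ k ih => rw [cat_succ, List.length_append]; have := hL (b + k); omega

variable {E : Env} [E.Full]

/-- Turn the winners of a round into the input of the next one. -/
def load : Program := block [
  setV .key (V .T * V .NG),
  forUp .i (V .key) (.branch (.wordLE (A .oi (V .i)) 0) (setA .hd (V .i) 0) <| block [
    setA .hd (V .i) (V .i + 1),
    setA .nx (V .i + 1) 0,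
    setA .xx (V .i + 1) (V .i % V .G),
    setXA .ff (V .i + 1) (XA .od (V .i)),
    setA .id (V .i + 1) (A .oi (V .i))]),
  setV .NG (V .key / V .G),
  setV .R (V .G)]

/-- The word variables that `load` may change. -/
abbrev loadW : List WReg := [.key, .i, .hd, .nx, .xx, .id, .NG, .R]

theorem load_run {σ : State} {T NG G : ℕ} (hT : σ.w .T 0 = T) (hNG : σ.w .NG 0 = NG)
    (hG : σ.w .G 0 = G) (hG0 : 0 < G) (hN : T * NG < E.Q) :
    Run E load σ (T * NG * 12 + 10) fun τ _ => Frame loadW [.ff] σ τ ∧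
      τ.w .key 0 = T * NG ∧ τ.w .NG 0 = T * NG / G ∧ τ.w .R 0 = G ∧
      BucketRep τ (T * NG) (T * NG) (winnerList G σ) := by
  refine Run.of_small fun hσ => ?_
  have hGQ : G ≤ E.Q := hG ▸ hσ.w _ _
  refine Run.cons (Run.setV (by simp [hT, hNG]; omega) (by omega) ?_)
  simp only [WExp.val_mul, val_V, hT, hNG]
  refine Run.cons (Run.forUp (N := T * NG) (b := 9) (T₀ := 4) (fun k τ T' => T' = 4 ∧
    Frame loadW [.ff] σ τ ∧ τ.w .key 0 = T * NG ∧
    ∀ b < k, ListRep τ k (τ.w .hd b) (winnerList G σ b)) hN.le ?_ (by omega) ?_ ?_ ?_)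
  · rintro k τ T' - - ⟨-, -, h, -⟩
    simp [h]
  · exact ⟨rfl, (Frame.refl _).setW.setW, by simp, by simp⟩
  · rintro k τ T' hk hi ⟨rfl, hF, hkey, hB⟩
    have hG' : τ.w .G 0 = G := by rw [hF.w _ (by decide), hG]
    have hoi : τ.w .oi = σ.w .oi := hF.w _ (by decide)
    have hod : τ.x .od = σ.x .od := hF.x _ (by decide)
    apply Run.weaken
    refine Run.branch (by omega) (fun h0 => ?_) (fun h0 => ?_)
    · simp only [Test.holds_wordLE, val_A, val_V, hi, hoi, WExp.val_ofNat,
        Nat.le_zero] at h0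
      refine Run.setA (by simp) (by omega) ⟨4, by omega, by simpa using hi, rfl, hF.setW.setW,
        by simpa using hkey, ?_⟩
      intro b hb
      by_cases hbk : b = k
      · subst hbk
        simp [hi, winnerList, h0, ListRep]
      · have := (hB b (by omega)).mono (Nat.le_succ k)
        simp only [val_V, hi, WExp.val_ofNat]
        rw [State.w_setW_of_ne (by decide), State.w_setW_self, Function.update_of_ne hbk]
        exact this.congr (by simp) (by simp) (by simp) (by simp)
    · simp only [Test.holds_wordLE, val_A, val_V, hi, hoi, WExp.val_ofNat,
        Nat.le_zero] at h0
      refine Run.cons (Run.setA (by simp [hi]; omega) (by omega) ?_)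
      refine Run.cons (Run.setA (by simp) (by omega) ?_)
      refine Run.cons (Run.setA_good ⟨WExp.good_of_clean _ rfl, WExp.good_of_clean _ rfl,
        fun _ => by simp [hG']; omega⟩ (by
          simpa [hG'] using (Nat.mod_lt _ hG0).le.trans hGQ) (by omega) ?_)
      refine Run.cons (Run.setXA (by omega) ?_)
      refine Run.cons (Run.setA (by simpa [hi, hoi] using hσ.w _ _) (by omega) ?_)
      refine Run.nil (by omega) ⟨4, by omega, by simpa using hi, rfl,
        hF.setW.setW.setW.setX.setW.setW, by simpa using hkey, ?_⟩
      intro b hb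
      by_cases hbk : b = k
      · subst hbk
        simp [hi, winnerList, h0, ListRep, hG', hod, hoi]
      · have := hB b (by omega)
        simp only [val_V, hi, WExp.val_ofNat]
        simp only [ne_eq, reduceCtorEq, not_false_eq_true, State.w_setW_of_ne, State.w_setX,
          State.w_setW_self, val_V, WExp.val_add, Function.update_of_ne hbk, hi, WExp.val_ofNat]
        refine (this.congr ?_ ?_ ?_ ?_).mono (Nat.le_succ k) <;> intro k' hk' <;> simp [hi] <;>
          rw [Function.update_of_ne (by omega)]
  · rintro τ T' - ⟨rfl, hF, hkey, hB⟩
    have hG' : τ.w .G 0 = G := by rw [hF.w _ (by decide), hG]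
    refine Run.cons (Run.setV_good ⟨WExp.good_of_clean _ rfl, WExp.good_of_clean _ rfl,
        fun _ => by simp [hG']; omega⟩ ?_ (by omega) ?_)
    · simp only [WExp.val_div, val_V, hkey, hG']
      exact (Nat.div_le_self _ _).trans hN.le
    refine Run.cons (Run.setV (by simp [hG', hGQ]) (by omega) ?_)
    refine Run.nil (by omega) ⟨hF.setW.setW, by simp [hkey], by simp [hkey, hG'],
      by simp [hG'], ?_⟩
    intro b hb
    exact (hB b hb).congr (by simp) (by simp) (by simp) (by simp)

end

section

/-! ### The first round: sorting the points -/

/-- The point `p` as an item of the first round. -/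
noncomputable def Face.item (F : Face) (p : ℕ) : Item := ⟨F.x 0 p, -(F.h p) ^ 2, p + 1⟩

/-- The first `i` points, sorted by the last digit of their first coordinate in base `K`. -/
noncomputable def Face.digitList (F : Face) : ℕ → ℕ → List Item
  | 0, _ => []
  | i + 1, b => if F.x 0 i % F.K = b then F.item i :: F.digitList i b else F.digitList i b

/-- The bucket of a point in the first round. There are `A` buckets in every group; they are ordered
by the leading digits of the first coordinate. -/
def Face.bucket (F : Face) (e A : ℕ) (p : ℕ) : ℕ := F.key 1 e p * A + F.x 0 p / F.K

/-- The items with last digit at least `k`, in the order in which they are distributed. -/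
noncomputable def Face.done (F : Face) (k : ℕ) : List Item :=
  (List.range' k (F.K - k)).reverse.flatMap (F.digitList F.n)

/-- The lists that arise when the items of `l` are put in front of their lists one by one. -/
noncomputable def Face.dist (F : Face) (e A : ℕ) (l : List Item) (b : ℕ) : List Item :=
  (l.filter fun a => F.bucket e A (a.id - 1) = b).reverse

section
variable {F : Face} {e A : ℕ}

theorem Face.mem_digitList {i b : ℕ} {a : Item} :
    a ∈ F.digitList i b ↔ ∃ p < i, F.x 0 p % F.K = b ∧ a = F.item p := by
  induction i with
  | zero => simp [Face.digitList]
  | succ i ih =>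
    rw [Face.digitList]
    split_ifs with h
    · rw [List.mem_cons, ih]
      constructor
      · rintro (rfl | ⟨p, hp, h'⟩)
        · exact ⟨i, by omega, h, rfl⟩
        · exact ⟨p, by omega, h'⟩
      · rintro ⟨p, hp, h', rfl⟩
        by_cases hpi : p = i
        · exact .inl (by rw [hpi])
        · exact .inr ⟨p, by omega, h', rfl⟩
    · rw [ih]
      constructor
      · rintro ⟨p, hp, h'⟩
        exact ⟨p, by omega, h'⟩
      · rintro ⟨p, hp, h', rfl⟩
        refine ⟨p, ?_, h', rfl⟩
        by_contra hpi
        obtain rfl : p = i := by omega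
        exact h h'

theorem length_cat {α : Type*} (L : ℕ → List α) (b k : ℕ) :
    (cat L b k).length = ∑ i ∈ Finset.range k, (L (b + i)).length := by
  induction k with
  | zero => simp
  | succ k ih => rw [cat_succ, List.length_append, ih, Finset.sum_range_succ]

theorem Face.length_cat_digitList (hK : 0 < F.K) (i : ℕ) :
    (cat (F.digitList i) 0 F.K).length = i := by
  rw [length_cat]
  induction i with
  | zero => simp [Face.digitList]
  | succ i ih =>
    have : ∀ b, (F.digitList (i + 1) b).length =
        (F.digitList i b).length + if F.x 0 i % F.K = b then 1 else 0 := by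
      intro b
      rw [Face.digitList]
      split_ifs <;> simp
    simp only [zero_add] at ih
    simp only [this, Finset.sum_add_distrib, ih, zero_add]
    rw [Finset.sum_ite_eq, if_pos (Finset.mem_range.2 (Nat.mod_lt _ hK))]

theorem Face.done_of_le {k : ℕ} (h : F.K ≤ k) : F.done k = [] := by
  simp [Face.done, Nat.sub_eq_zero_of_le h]

theorem Face.done_eq {k : ℕ} (h : k < F.K) : F.done k = F.done (k + 1) ++ F.digitList F.n k := by
  rw [Face.done, show F.K - k = F.K - (k + 1) + 1 by omega, List.range'_succ]
  simp [Face.done]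

theorem Face.mem_done {a : Item} (hK : 0 < F.K) :
    a ∈ F.done 0 ↔ ∃ p < F.n, a = F.item p := by
  simp only [Face.done, List.mem_flatMap, List.mem_reverse, List.mem_range'_1, Face.mem_digitList]
  constructor
  · rintro ⟨b, -, p, hp, -, rfl⟩
    exact ⟨p, hp, rfl⟩
  · rintro ⟨p, hp, rfl⟩
    refine ⟨_, ⟨Nat.zero_le _, ?_⟩, p, hp, rfl, rfl⟩
    have := Nat.mod_lt (F.x 0 p) hK
    omega

theorem Face.length_done (hK : 0 < F.K) : (F.done 0).length = F.n := by
  have h : (F.done 0).length = (cat (F.digitList F.n) 0 F.K).length := by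
    rw [Face.done, cat, List.length_flatMap, List.length_flatMap, Nat.sub_zero, List.map_reverse,
      List.sum_reverse]
  rw [h, F.length_cat_digitList hK]

theorem Face.done_sorted (k : ℕ) :
    (F.done k).Pairwise fun a b => b.x % F.K ≤ a.x % F.K := by
  rw [Face.done, List.pairwise_flatMap]
  constructor
  · intro b _
    rw [List.pairwise_iff_forall_sublist]
    intro a a' h
    have h1 := h.subset (List.mem_cons_self ..)
    have h2 := h.subset (List.mem_cons_of_mem _ (List.mem_cons_self ..))
    rw [Face.mem_digitList] at h1 h2
    obtain ⟨p, -, h1, rfl⟩ := h1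
    obtain ⟨p', -, h2, rfl⟩ := h2
    exact (h2.trans h1.symm).le
  · rw [List.pairwise_reverse]
    refine List.Pairwise.imp ?_ (List.pairwise_lt_range' (s := k) (n := F.K - k))
    intro b b' hb a ha a' ha'
    rw [Face.mem_digitList] at ha ha'
    obtain ⟨p, -, h1, rfl⟩ := ha
    obtain ⟨p', -, h2, rfl⟩ := ha'
    exact (h2.trans_lt hb).le.trans h1.symm.le

theorem Face.dist_snoc (l : List Item) (a : Item) (b : ℕ) :
    F.dist e A (l ++ [a]) b =
      if F.bucket e A (a.id - 1) = b then a :: F.dist e A l b else F.dist e A l b := by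
  rw [Face.dist, List.filter_append, List.filter_cons]
  split_ifs with h1 h2 h3 <;> simp_all [Face.dist]

theorem Face.length_dist_le (l : List Item) (N : ℕ) :
    (cat (F.dist e A l) 0 N).length ≤ l.length := by
  induction l using List.reverseRecOn with
  | nil => rw [length_cat]; simp [Face.dist]
  | append_singleton l a ih =>
    rw [length_cat] at *
    have : ∀ b, (F.dist e A (l ++ [a]) b).length =
        (F.dist e A l b).length + if F.bucket e A (a.id - 1) = b then 1 else 0 := by
      intro b
      rw [Face.dist_snoc]
      split_ifs <;> simp
    simp only [zero_add] at ih
    simp only [this, Finset.sum_add_distrib, zero_add, List.length_append, List.length_singleton]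
    rw [Finset.sum_ite_eq]
    split_ifs <;> omega

theorem Face.buckets_zero (hK : 0 < F.K) (hA : ∀ p < F.n, F.x 0 p / F.K < A) :
    F.Buckets 0 e A (F.dist e A (F.done 0)) := by
  have hmem : ∀ b a, a ∈ F.dist e A (F.done 0) b ↔
      ∃ p < F.n, F.bucket e A p = b ∧ a = F.item p := by
    intro b a
    simp only [Face.dist, List.mem_reverse, List.mem_filter, Face.mem_done hK, decide_eq_true_eq]
    constructor
    · rintro ⟨⟨p, hp, rfl⟩, h⟩
      exact ⟨p, hp, h, rfl⟩
    · rintro ⟨p, hp, h, rfl⟩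
      exact ⟨⟨p, hp, rfl⟩, h⟩
  have hdiv : ∀ p < F.n, ∀ g r, r < A → F.bucket e A p = g * A + r →
      g = F.key 1 e p ∧ r = F.x 0 p / F.K := by
    intro p hp g r hr h
    have hxA := hA p hp
    have h1 : r = F.x 0 p / F.K := by
      have := congrArg (· % A) h
      simpa only [Face.bucket, Nat.mul_add_mod_self_right, Nat.mod_eq_of_lt hr,
        Nat.mod_eq_of_lt hxA, eq_comm] using this
    refine ⟨?_, h1⟩
    have h2 : g * A = F.key 1 e p * A := by rw [Face.bucket] at h; omega
    exact Nat.eq_of_mul_eq_mul_right (by omega) h2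
  refine ⟨?_, ?_, ?_⟩
  · intro g _ a ha
    obtain ⟨r, hr, ha⟩ := mem_cat.1 ha
    obtain ⟨p, hp, h, rfl⟩ := (hmem _ _).1 ha
    exact ⟨p, hp, 0, by simp, by simpa using (hdiv p hp g r hr h).1, rfl, rfl, rfl⟩
  · intro p hp c hc
    obtain rfl : c = 0 := by simpa using hc
    refine ⟨F.item p, mem_cat.2 ⟨F.x 0 p / F.K, hA p hp, (hmem _ _).2 ⟨p, hp, ?_, rfl⟩⟩, rfl, le_rfl⟩
    simp [Face.bucket]
  · intro g _
    rw [cat, List.pairwise_flatMap]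
    constructor
    · intro b hb
      rw [List.mem_range'_1] at hb
      obtain ⟨r, rfl⟩ := Nat.exists_eq_add_of_le hb.1
      have h0 : (F.dist e A (F.done 0) (g * A + r)).Pairwise
          fun a b => a.x % F.K ≤ b.x % F.K := by
        rw [Face.dist, List.pairwise_reverse]
        exact (F.done_sorted 0).filter _
      refine h0.imp_of_mem ?_
      intro a a' ha ha' h
      obtain ⟨p, hp, h1, rfl⟩ := (hmem _ _).1 ha
      obtain ⟨p', hp', h2, rfl⟩ := (hmem _ _).1 ha'
      have h3 := (hdiv p hp g r (by omega) h1).2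
      have h4 := (hdiv p' hp' g r (by omega) h2).2
      have h5 := Nat.div_add_mod (F.x 0 p) F.K
      have h6 := Nat.div_add_mod (F.x 0 p') F.K
      simp only [Face.item] at h ⊢
      rw [← h3] at h5
      rw [← h4] at h6
      omega
    · refine (List.pairwise_lt_range' (s := g * A) (n := A)).imp_of_mem ?_
      intro b b' hb hb' hlt a ha a' ha'
      rw [List.mem_range'_1] at hb hb'
      obtain ⟨r, rfl⟩ := Nat.exists_eq_add_of_le hb.1
      obtain ⟨r', rfl⟩ := Nat.exists_eq_add_of_le hb'.1
      obtain ⟨p, hp, h1, rfl⟩ := (hmem _ _).1 ha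
      obtain ⟨p', hp', h2, rfl⟩ := (hmem _ _).1 ha'
      have h3 := (hdiv p hp g r (by omega) h1).2
      have h4 := (hdiv p' hp' g r' (by omega) h2).2
      simp only [Face.item]
      by_contra! hlt'
      have := Nat.div_le_div_right (c := F.K) hlt'.le
      omega

end

end

section

/-- The data that the search from the faces of the box depends on: the points, with the
coordinate `j` of the point `p` in cell `p * D + j`, the corner `lo` of the box and the
factor `iw` that scales the box to `[0, M]` in every direction. The grids on the faces and the
buckets of the first round are described by `K`, `T` and `A`. -/
structure Grid where
  n : ℕ
  D : ℕ
  K : ℕ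
  M : ℕ
  T : ℕ
  G : ℕ
  A : ℕ
  pt : ℕ → ℝ
  lo : ℕ → ℝ
  iw : ℝ

/-- The scaled coordinate `j` of the point `p`. -/
def Grid.coord (Γ : Grid) (p j : ℕ) : ℝ := (Γ.pt (p * Γ.D + j) - Γ.lo j) * Γ.iw

/-- The points as seen from one of the two faces orthogonal to the axis `ax`. -/
noncomputable def Grid.face (Γ : Grid) (ax sg : ℕ) : Face where
  n := Γ.n
  K := Γ.K
  M := Γ.M
  T := Γ.T
  G := Γ.G
  x k p := ⌊Γ.coord p ((ax + 1 + k) % Γ.D)⌋₊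
  h p := if sg = 0 then Γ.M + Γ.coord p ax else Γ.M + Γ.M - Γ.coord p ax

/-- The data are in memory. -/
structure Grid.InMem (Γ : Grid) (σ : State) : Prop where
  n : σ.w .n 0 = Γ.n
  D : σ.w .dim 0 = Γ.D
  K : σ.w .K 0 = Γ.K
  M : σ.w .M 0 = Γ.M
  T : σ.w .T 0 = Γ.T
  G : σ.w .G 0 = Γ.G
  A : σ.w .A 0 = Γ.A
  pt : σ.x .pt = Γ.pt
  lo : σ.x .lo = Γ.lo
  iw : σ.x .iw 0 = Γ.iw

theorem Grid.InMem.of_frame {Γ : Grid} {σ τ : State} {S : List WReg} {S' : List XReg}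
    (h : Γ.InMem σ) (hF : Frame S S' σ τ)
    (hS : ∀ r ∈ [WReg.n, .dim, .K, .M, .T, .G, .A], r ∉ S := by decide)
    (hS' : ∀ r ∈ [XReg.pt, .lo, .iw], r ∉ S' := by decide) : Γ.InMem τ :=
  ⟨by rw [hF.w _ (hS _ (by decide)), h.n], by rw [hF.w _ (hS _ (by decide)), h.D],
    by rw [hF.w _ (hS _ (by decide)), h.K], by rw [hF.w _ (hS _ (by decide)), h.M],
    by rw [hF.w _ (hS _ (by decide)), h.T], by rw [hF.w _ (hS _ (by decide)), h.G],
    by rw [hF.w _ (hS _ (by decide)), h.A], by rw [hF.x _ (hS' _ (by decide)), h.pt],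
    by rw [hF.x _ (hS' _ (by decide)), h.lo], by rw [hF.x _ (hS' _ (by decide)), h.iw]⟩

theorem Grid.InMem.params {Γ : Grid} {σ : State} (h : Γ.InMem σ) : Params Γ.K Γ.M Γ.T σ :=
  ⟨h.K, h.M, h.T⟩

/-- The data are consistent and fit into the machine words. The number of directions of a face
is `e + 1`. -/
structure Grid.Valid (Γ : Grid) (E : Env) (e : ℕ) : Prop where
  n : 2 * Γ.n < E.Q
  D : Γ.D = e + 2
  K : 0 < Γ.K
  T : 0 < Γ.T
  G : Γ.G = Γ.M + 1
  A : Γ.M / Γ.K < Γ.A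
  coord_nonneg : ∀ p < Γ.n, ∀ j < Γ.D, 0 ≤ Γ.coord p j
  coord_le : ∀ p < Γ.n, ∀ j < Γ.D, Γ.coord p j ≤ Γ.M
  DQ : Γ.D * 3 ≤ E.Q
  KQ : Γ.K ≤ E.Q
  MQ : Γ.M < E.Q
  TQ : Γ.T < E.Q
  NQ : Γ.G ^ e * Γ.A ≤ E.Q

theorem Grid.Valid.x_lt {Γ : Grid} {E : Env} {e : ℕ} (hv : Γ.Valid E e) (ax sg k p : ℕ)
    (hp : p < Γ.n) : (Γ.face ax sg).x k p < Γ.G := by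
  rw [hv.G, Nat.lt_succ_iff]
  refine Nat.floor_le_of_le (hv.coord_le p hp _ (Nat.mod_lt _ ?_))
  rw [hv.D]; omega

theorem _root_.RealRAM.State.setX_setX (σ : State) (r : XReg) (i : ℕ) (a b : ℝ) :
    (σ.setX r i a).setX r i b = σ.setX r i b := by
  simp [State.setX, State.setReal]

variable {E : Env} [E.Full]

/-- Compute the integer coordinate `k` of the point `i` in the directions of the face. -/
def coordP (k : WExp) : Program := block [
  setV .jj ((V .ax + 1 + k) % V .dim),
  floorV .cx ((XA .pt (V .i * V .dim + V .jj) - XA .lo (V .jj)) * XV .iw)]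

theorem coordP_run {Γ : Grid} {σ : State} {e ax p k : ℕ} {kE : WExp} (sg : ℕ) (hv : Γ.Valid E e)
    (hΓ : Γ.InMem σ) (hax : σ.w .ax 0 = ax) (hi : σ.w .i 0 = p) (hp : p < Γ.n)
    (hk : kE.val σ = k)
    (hc : (V .ax + 1 + kE).clean = true := by rfl)
    (hs : ((V .ax + 1 + kE) % V .dim).short = true := by rfl) :
    Run E (coordP kE) σ 3 fun τ _ => Frame [.jj, .cx] [] σ τ ∧
      τ.w .cx 0 = (Γ.face ax sg).x k p := by
  have hD0 : 0 < Γ.D := by rw [hv.D]; omega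
  have hlt : (ax + 1 + k) % Γ.D < Γ.D := Nat.mod_lt _ hD0
  have hDQ := hv.DQ
  have hval : ((V .ax + 1 + kE) % V .dim).val σ = (ax + 1 + k) % Γ.D := by
    simp [hax, hk, hΓ.D]
  refine Run.cons (Run.setV_good ⟨WExp.good_of_clean _ hc, WExp.good_of_clean _ rfl,
    fun _ => by simp [hΓ.D]; omega⟩ (by rw [hval]; omega) (by omega) ?_ hs)
  rw [hval]
  have hfl : (((XA .pt (V .i * V .dim + V .jj) - XA .lo (V .jj)) * XV .iw : RExp)).val
      (σ.setW .jj 0 ((ax + 1 + k) % Γ.D)) = Γ.coord p ((ax + 1 + k) % Γ.D) := by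
    simp [hi, hΓ.D, hΓ.pt, hΓ.lo, hΓ.iw, Grid.coord]
  have hx := hv.x_lt ax sg k p hp
  have hMQ := hv.MQ
  rw [hv.G] at hx
  refine Run.cons (Run.floorV (by rw [hfl]; exact hv.coord_nonneg p hp _ hlt) (by
    rw [hfl]; exact (Nat.lt_succ_iff.1 hx).trans hMQ.le) (by omega) ?_)
  rw [hfl]
  exact Run.nil (by omega) ⟨(Frame.refl _).setW.setW, by simp [Grid.face]⟩

/-- Compute the coordinates of the point `i`, and put it into the list for the last digit of
its first coordinate. -/
def insertPoint : Program := block [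
  setV .key 0,
  forDown .r (V .dim - 2) <| block [coordP (V .r + 1), setV .key (V .key * V .G + V .cx)],
  coordP 0,
  setA .ka (V .i + 1) (V .key * V .A + V .cx / V .K),
  setA .xx (V .i + 1) (V .cx),
  setA .id (V .i + 1) (V .i + 1),
  setXV .h ((XA .pt (V .i * V .dim + V .ax) - XA .lo (V .ax)) * XV .iw),
  .branch (.wordLE (V .sg) 0) (setXV .h (toX (V .M) + XV .h))
    (setXV .h (toX (V .M) + toX (V .M) - XV .h)),
  setXA .ff (V .i + 1) (toX 0 - XV .h * XV .h),
  setV .tmp (V .cx % V .K),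
  setA .nx (V .i + 1) (A .hb (V .tmp)),
  setA .hb (V .tmp) (V .i + 1)]

/-- The word variables that `insertPoint` may change. -/
abbrev insertW : List WReg := [.key, .r, .jj, .cx, .ka, .xx, .id, .tmp, .nx, .hb]

theorem insertPoint_run {Γ : Grid} {σ : State} {e ax sg p : ℕ} (hv : Γ.Valid E e)
    (hΓ : Γ.InMem σ) (hax : σ.w .ax 0 = ax) (hsg : σ.w .sg 0 = sg)
    (hi : σ.w .i 0 = p) (hp : p < Γ.n)
    (hL : ∀ b < Γ.K, ListRep σ p (σ.w .hb b) ((Γ.face ax sg).digitList p b))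
    (hB : ∀ p' < p, σ.w .ka (p' + 1) = (Γ.face ax sg).bucket e Γ.A p') :
    Run E insertPoint σ (9 * e + 30) fun τ _ => Frame insertW [.h, .ff] σ τ ∧
      (∀ b < Γ.K, ListRep τ (p + 1) (τ.w .hb b) ((Γ.face ax sg).digitList (p + 1) b)) ∧
      (∀ p' < p + 1, τ.w .ka (p' + 1) = (Γ.face ax sg).bucket e Γ.A p') := by
  set F := Γ.face ax sg with hF
  have hx : ∀ k p, p < Γ.n → F.x k p < Γ.G := fun k p => hv.x_lt ax sg k p
  have hn := hv.n
  have hK0 := hv.K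
  have hKQ := hv.KQ
  have hGM := hv.G
  have hMQ := hv.MQ
  have hGe : 0 < Γ.G ^ e := by
    have : 0 < Γ.G := by omega
    positivity
  have hGQ : Γ.G ^ e ≤ E.Q := le_trans (Nat.le_mul_of_pos_right _ ((Nat.zero_le _).trans_lt hv.A)) hv.NQ
  have hkey : ∀ j k, k + j ≤ e + 1 → F.key k j p < Γ.G ^ j := fun j k h =>
    F.key_lt (m := e + 1) (fun k _ => hx k p hp) j k h
  refine Run.cons (Run.setV (by simp) (by omega) ?_)
  refine Run.cons (Run.forDown (N := e) (b := 6) (T₀ := 20) (fun k τ T' => T' = 20 ∧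
    Frame insertW [.h, .ff] σ τ ∧ τ.w .key 0 = F.key (k + 1) (e - k) p ∧
    (∀ k ≤ p, τ.w .xx k = σ.w .xx k ∧ τ.w .id k = σ.w .id k ∧ τ.w .nx k = σ.w .nx k) ∧
    τ.w .hb = σ.w .hb ∧ τ.w .ka = σ.w .ka ∧ τ.x .ff = σ.x .ff)
    (by have := hv.DQ; have := hv.D; omega) (by simp [hΓ.D, hv.D]) (by omega) ?_ ?_ ?_)
  · exact ⟨rfl, (Frame.refl _).setW.setW, by simp [Face.key], by simp, by simp, by simp, by simp⟩
  · rintro k τ T' hk hr ⟨rfl, hFr, hkey', hxx, hhb, hka, hff⟩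
    have hΓ' := hΓ.of_frame hFr
    apply Run.weaken
    refine Run.cons ((coordP_run (ax := ax) (p := p) (k := k + 1) sg hv
      (hΓ'.of_frame (S := [.r]) (S' := []) (Frame.setW (Frame.refl _)))
      (by simp [hFr.w .ax (by decide), hax]) (by simp [hFr.w .i (by decide), hi]) hp (by simp)).call
      (by omega) ?_)
    rintro ρ ⟨hF', hcx⟩
    have hkr : ρ.w .key 0 = F.key (k + 2) (e - (k + 1)) p := by
      rw [hF'.w _ (by decide)]; simpa using hkey'
    have hGr : ρ.w .G 0 = Γ.G := by rw [hF'.w _ (by decide)]; simpa using hΓ'.G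
    have hval : F.key (k + 2) (e - (k + 1)) p * Γ.G + F.x (k + 1) p = F.key (k + 1) (e - k) p := by
      rw [show e - k = e - (k + 1) + 1 by omega]; rfl
    refine Run.cons (Run.setV ?_ (by omega) ?_)
    · simp only [WExp.val_add, WExp.val_mul, val_V, hkr, hGr, hcx, ← hF]
      rw [hval]
      refine (hkey _ _ (by omega)).le.trans ((Nat.pow_le_pow_right (by omega) ?_).trans hGQ)
      omega
    · simp only [WExp.val_add, WExp.val_mul, val_V, hkr, hGr, hcx, ← hF]
      rw [hval]
      refine Run.nil (by omega) ⟨20, by omega, ?_, rfl, (hFr.setW.trans hF'.mono).setW, by simp, ?_,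
        ?_, ?_, ?_⟩
      · rw [State.w_setW_of_ne (by decide), hF'.w _ (by decide)]; simp
      · intro k' hk'
        rw [State.w_setW_of_ne (by decide), State.w_setW_of_ne (by decide),
          State.w_setW_of_ne (by decide), hF'.w _ (by decide), hF'.w _ (by decide),
          hF'.w _ (by decide)]
        simpa using hxx k' hk'
      · rw [State.w_setW_of_ne (by decide), hF'.w _ (by decide)]; simpa using hhb
      · rw [State.w_setW_of_ne (by decide), hF'.w _ (by decide)]; simpa using hka
      · rw [State.x_setW, hF'.x _ (by decide)]; simpa using hff
  · rintro τ T' - ⟨rfl, hFr, hkey', hxx, hhb, hka, hff⟩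
    have hΓ' := hΓ.of_frame hFr
    refine Run.cons ((coordP_run (ax := ax) (p := p) (k := 0) sg hv hΓ'
      (by rw [hFr.w .ax (by decide), hax]) (by rw [hFr.w .i (by decide), hi]) hp (by simp)).call
      (by omega) ?_)
    rintro τ₁ ⟨hF₁, hcx⟩
    have hΓ₁ := hΓ'.of_frame hF₁
    have hFr₁ : Frame insertW [.h, .ff] σ τ₁ := hFr.trans hF₁.mono
    have hkey₁ : τ₁.w .key 0 = F.key 1 e p := by rw [hF₁.w _ (by decide), hkey']; simp
    have hi₁ : τ₁.w .i 0 = p := by rw [hFr₁.w _ (by decide), hi]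
    have hax₁ : τ₁.w .ax 0 = ax := by rw [hFr₁.w _ (by decide), hax]
    have hsg₁ : τ₁.w .sg 0 = sg := by rw [hFr₁.w _ (by decide), hsg]
    have hxx₁ : ∀ k ≤ p, τ₁.w .xx k = σ.w .xx k ∧ τ₁.w .id k = σ.w .id k ∧
        τ₁.w .nx k = σ.w .nx k := by
      intro k hk
      rw [hF₁.w _ (by decide), hF₁.w _ (by decide), hF₁.w _ (by decide)]
      exact hxx k hk
    have hhb₁ : τ₁.w .hb = σ.w .hb := by rw [hF₁.w _ (by decide), hhb]
    have hka₁ : τ₁.w .ka = σ.w .ka := by rw [hF₁.w _ (by decide), hka]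
    have hff₁ : τ₁.x .ff = σ.x .ff := by rw [hF₁.x _ (by decide), hff]
    have hxM : F.x 0 p ≤ Γ.M := by have := hx 0 p hp; omega
    have hbk : F.bucket e Γ.A p < Γ.G ^ e * Γ.A := by
      have h1 := hkey e 1 (by omega)
      have h2 : F.x 0 p / Γ.K < Γ.A := (Nat.div_le_div_right hxM).trans_lt hv.A
      have h3 := Nat.mul_le_mul_right Γ.A (show F.key 1 e p + 1 ≤ Γ.G ^ e from h1)
      change F.key 1 e p * Γ.A + F.x 0 p / Γ.K < _
      linarith [add_mul (F.key 1 e p) 1 Γ.A]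
    have hNQ := hv.NQ
    change τ₁.w .cx 0 = F.x 0 p at hcx
    clear_value F
    have hbv : (V .key * V .A + V .cx / V .K).val τ₁ = F.bucket e Γ.A p := by
      simp only [WExp.val_add, WExp.val_mul, WExp.val_div, val_V, hkey₁, hΓ₁.A, hcx, hΓ₁.K]
      rw [hF]; rfl
    refine Run.cons (Run.setA_good ⟨WExp.good_of_clean _ rfl, ⟨WExp.good_of_clean _ rfl,
      WExp.good_of_clean _ rfl, fun _ => by simp [hΓ₁.K]; omega⟩, by simp [WordOp.partial?]⟩
      (by rw [hbv]; omega) (by omega) ?_)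
    rw [hbv]
    refine Run.cons (Run.setA (by simp [hcx]; omega) (by omega) ?_)
    refine Run.cons (Run.setA (by simp [hi₁]; omega) (by omega) ?_)
    refine Run.cons (Run.setXV (by omega) ?_)
    simp only [WExp.val_add, val_V, WExp.val_ofNat, hi₁, ne_eq, reduceCtorEq, not_false_eq_true,
      State.w_setW_of_ne, RExp.val_mul, RExp.val_sub, val_XA, WExp.val_mul, hcx, hΓ₁.D, hΓ₁.pt,
      hΓ₁.lo, hax₁, State.x_setW, val_XV, hΓ₁.iw]
    change Run E _ (State.setX _ _ _ (Γ.coord p ax)) _ _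
    set τ₂ := (((τ₁.setW .ka (p + 1) (F.bucket e Γ.A p)).setW .xx (p + 1) (F.x 0 p)).setW .id (p + 1)
      (p + 1)) with hτ₂
    have hFr₂ : Frame insertW [.h, .ff] σ τ₂ := hFr₁.setW.setW.setW
    have hΓ₂ := hΓ.of_frame hFr₂
    have hcx₂ : τ₂.w .cx 0 = F.x 0 p := by simpa [τ₂] using hcx
    refine Run.cons (Run.mono (post₁ := fun τ T' => T' = 8 ∧ τ = τ₂.setX .h 0 (F.h p)) (T₁ := 10) ?_
      (by omega) ?_)
    · have hFh : F.h p = if sg = 0 then Γ.M + Γ.coord p ax else Γ.M + Γ.M - Γ.coord p ax := by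
        rw [hF]; rfl
      refine Run.branch (by omega) (fun h0 => ?_) (fun h0 => ?_)
      · have h0 : sg = 0 := by simpa [τ₂, hsg₁] using h0
        refine Run.setXV (by omega) ⟨by omega, ?_⟩
        rw [State.setX_setX]
        simp [hFh, h0, hΓ₂.M]
      · have h0 : sg ≠ 0 := by simpa [τ₂, hsg₁] using h0
        refine Run.setXV (by omega) ⟨by omega, ?_⟩
        rw [State.setX_setX]
        simp [hFh, h0, hΓ₂.M]
    rintro _ _ ⟨rfl, rfl⟩
    refine Run.of_small fun hτs => ?_
    refine Run.cons (Run.setXA (by omega) ?_)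
    refine Run.cons (Run.setV_good ⟨WExp.good_of_clean _ rfl,
      WExp.good_of_clean _ rfl, fun _ => by simp [hΓ₂.K]; omega⟩ (by
        simp only [WExp.val_mod, val_V, State.w_setX, hcx₂, hΓ₂.K]
        exact (Nat.mod_le _ _).trans (by omega)) (by omega) ?_)
    refine Run.cons (Run.setA (by simpa using hτs.w .hb _) (by omega) ?_)
    refine Run.cons (Run.setA (by simp [τ₂, hi₁]; omega) (by omega) ?_)
    refine Run.nil (by omega) ⟨hFr₂.setX.setX.setW.setW.setW, ?_, ?_⟩
    · intro b hb
      have hFK : F.K = Γ.K := by rw [hF]; rfl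
      have hi₂ : τ₂.w .i 0 = p := by simpa [τ₂] using hi₁
      simp only [val_V, State.w_setX, WExp.val_add, WExp.val_ofNat, WExp.val_mod, hcx₂, hΓ₂.K, hi₂,
        ne_eq, reduceCtorEq, not_false_eq_true, State.w_setW_of_ne, State.w_setW_self,
        Function.update_self, val_A, RExp.val_sub, val_toX, RExp.val_mul, val_XV, State.x_setX_self]
      rw [Face.digitList, hFK]
      have hold : ListRep ((((τ₂.setX .h 0 (F.h p)).setX .ff (p + 1) (((0 : ℕ) : ℝ) - F.h p * F.h p)).setW
          .tmp 0 (F.x 0 p % Γ.K)).setW .nx (p + 1) (τ₂.w .hb (F.x 0 p % Γ.K)) |>.setW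
          .hb (F.x 0 p % Γ.K) (p + 1)) p (σ.w .hb b) (F.digitList p b) := by
        refine (hL b hb).congr ?_ ?_ ?_ ?_ <;> intro k' hk' <;> simp [τ₂] <;>
          rw [Function.update_of_ne (by omega)]
        exacts [(hxx₁ k' hk').1, by rw [hff₁], (hxx₁ k' hk').2.1, (hxx₁ k' hk').2.2]
      split_ifs with hb'
      · subst hb'
        rw [Function.update_self]
        refine ⟨by omega, le_rfl, by simp [τ₂, Face.item], by simp [Face.item, sq],
          by simp [τ₂, Face.item], ?_⟩
        simp only [ne_eq, reduceCtorEq, not_false_eq_true, State.w_setW_of_ne, State.w_setW_self,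
          Function.update_self]
        rw [show τ₂.w .hb = σ.w .hb by simpa [τ₂] using hhb₁] at hold ⊢
        exact hold.mono (Nat.le_succ p)
      · rw [Function.update_of_ne (Ne.symm hb'), show τ₂.w .hb = σ.w .hb by simpa [τ₂] using hhb₁]
        rw [show τ₂.w .hb = σ.w .hb by simpa [τ₂] using hhb₁] at hold
        exact hold.mono (Nat.le_succ p)
    · intro p' hp'
      by_cases hpp : p' = p
      · subst hpp; simp [τ₂]
      · simp only [ne_eq, reduceCtorEq, not_false_eq_true, State.w_setW_of_ne, State.w_setX,
          State.w_setW_self, τ₂]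
        rw [Function.update_of_ne (by omega), hka₁]
        exact hB p' (by omega)

end

section

variable {E : Env} [E.Full]

/-- Sort the points into lists by the last digit of their first coordinate. -/
def digitPass : Program := block [
  forUp .j (V .K) (setA .hb (V .j) 0),
  forUp .i (V .n) insertPoint]

/-- The word variables that `digitPass` may change. -/
abbrev digitW : List WReg := .i :: .j :: insertW

theorem digitPass_run {Γ : Grid} {σ : State} {e ax sg : ℕ} (hv : Γ.Valid E e)
    (hΓ : Γ.InMem σ) (hax : σ.w .ax 0 = ax) (hsg : σ.w .sg 0 = sg) :
    Run E digitPass σ (Γ.K * 4 + Γ.n * (9 * e + 33) + 9) fun τ _ =>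
      Frame digitW [.h, .ff] σ τ ∧
      (∀ b < Γ.K, ListRep τ Γ.n (τ.w .hb b) ((Γ.face ax sg).digitList Γ.n b)) ∧
      (∀ p < Γ.n, τ.w .ka (p + 1) = (Γ.face ax sg).bucket e Γ.A p) := by
  have hn := hv.n
  refine Run.cons (Run.forUp (N := Γ.K) (b := 1) (T₀ := Γ.n * (9 * e + 33) + 5) (fun k τ T' =>
    T' = Γ.n * (9 * e + 33) + 5 ∧ Frame [.j, .hb] [] σ τ ∧ ∀ b < k, τ.w .hb b = 0) hv.KQ ?_
    (by omega) ⟨rfl, (Frame.refl _).setW, by simp⟩ ?_ ?_)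
  · rintro k τ T' - - ⟨-, hF, -⟩
    simp [hF.w .K (by decide), hΓ.K]
  · rintro k τ T' hk hj ⟨rfl, hF, h0⟩
    refine Run.setA (by simp) (by omega) ⟨by simpa using hj, by omega, hF.setW.setW, ?_⟩
    intro b hb
    by_cases hbk : b = k
    · subst hbk; simp [hj]
    · simp [hj, Function.update_of_ne hbk, h0 b (by omega)]
  · rintro τ T' - ⟨rfl, hF, h0⟩
    have hF' : Frame digitW [.h, .ff] σ τ := hF.mono
    refine Run.cons (Run.forUp (N := Γ.n) (b := 9 * e + 30) (T₀ := 1) (fun k ρ T' => T' = 1 ∧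
      Frame digitW [.h, .ff] σ ρ ∧
      (∀ b < Γ.K, ListRep ρ k (ρ.w .hb b) ((Γ.face ax sg).digitList k b)) ∧
      (∀ p < k, ρ.w .ka (p + 1) = (Γ.face ax sg).bucket e Γ.A p)) (by omega) ?_ ?_ ?_ ?_ ?_)
    · rintro k ρ T' - - ⟨-, hF, -⟩
      simp [hF.w .n (by decide), hΓ.n]
    · change 1 + Γ.n * (9 * e + 33) + 4 ≤ _
      omega
    · refine ⟨rfl, hF'.setW, fun b hb => ?_, by simp⟩
      simpa [Face.digitList, ListRep] using h0 b hb
    · rintro k ρ T' hk hi ⟨rfl, hFρ, hL, hB⟩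
      refine (insertPoint_run hv (hΓ.of_frame hFρ) (by rw [hFρ.w _ (by decide), hax])
        (by rw [hFρ.w _ (by decide), hsg]) hi hk hL hB).call (by omega) ?_
      rintro ρ' ⟨hF₂, hL', hB'⟩
      refine ⟨by rw [hF₂.w _ (by decide), hi], by omega, (hFρ.trans hF₂.mono).setW, ?_,
        by simpa using hB'⟩
      intro b hb
      simpa using (hL' b hb).congr (by simp) (by simp) (by simp) (by simp)
    · rintro ρ T' - ⟨rfl, hFρ, hL, hB⟩
      exact Run.nil le_rfl ⟨hFρ, hL, hB⟩

/-- Distribute the items to the buckets of the first round. The lists are built from new nodes, and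
from the largest digit to the smallest. -/
def bucketPass : Program := block [
  setV .cn (V .n),
  forUp .i (V .NG * V .R) (setA .hd (V .i) 0),
  forDown .j (V .K) <| block [
    setV .it (A .hb (V .j)),
    .loop (.wordLT 0 (V .it)) <| block [
      setV .cn (V .cn + 1),
      setA .xx (V .cn) (A .xx (V .it)),
      setXA .ff (V .cn) (XA .ff (V .it)),
      setA .id (V .cn) (A .id (V .it)),
      setV .tmp (A .ka (A .id (V .it))),
      setA .nx (V .cn) (A .hd (V .tmp)),
      setA .hd (V .tmp) (V .cn),
      setV .it (A .nx (V .it))]]]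

/-- The word variables that `bucketPass` may change. -/
abbrev bucketW : List WReg := [.cn, .i, .hd, .j, .it, .xx, .id, .tmp, .nx]

theorem Face.length_done_succ_le {F : Face} (hK : 0 < F.K) (k : ℕ) :
    (F.done k).length ≤ F.n := by
  induction k with
  | zero => rw [F.length_done hK]
  | succ k ih =>
    by_cases h : k < F.K
    · rw [F.done_eq h, List.length_append] at ih
      omega
    · rw [F.done_of_le (by omega)]
      simp

theorem bucketPass_run {Γ : Grid} {σ : State} {e ax sg N : ℕ} (hv : Γ.Valid E e)
    (hΓ : Γ.InMem σ) (hN : σ.w .NG 0 * σ.w .R 0 = N) (hNQ : N ≤ E.Q)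
    (hL : ∀ b < Γ.K, ListRep σ Γ.n (σ.w .hb b) ((Γ.face ax sg).digitList Γ.n b))
    (hB : ∀ p < Γ.n, σ.w .ka (p + 1) = (Γ.face ax sg).bucket e Γ.A p) :
    Run E bucketPass σ (N * 4 + Γ.n * 12 + Γ.K * 8 + 12) fun τ _ =>
      Frame bucketW [.ff] σ τ ∧
      BucketRep τ N (2 * Γ.n) ((Γ.face ax sg).dist e Γ.A ((Γ.face ax sg).done 0)) := by
  have hn := hv.n
  have hK0 := hv.K
  set F := Γ.face ax sg with hF
  have hFK : F.K = Γ.K := by rw [hF]; rfl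
  have hFn : F.n = Γ.n := by rw [hF]; rfl
  clear_value F
  refine Run.cons (Run.setV (by simp [hΓ.n]; omega) (by omega) ?_)
  simp only [val_V, hΓ.n]
  refine Run.cons (Run.forUp (N := N) (b := 1) (T₀ := Γ.n * 12 + Γ.K * 8 + 6) (fun k τ T' =>
    T' = Γ.n * 12 + Γ.K * 8 + 6 ∧ Frame bucketW [.ff] σ τ ∧ τ.w .cn 0 = Γ.n ∧
    τ.w .nx = σ.w .nx ∧ τ.w .xx = σ.w .xx ∧ τ.w .id = σ.w .id ∧ τ.x .ff = σ.x .ff ∧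
    ∀ b < k, τ.w .hd b = 0) hNQ ?_
    (by omega) ⟨rfl, (Frame.refl _).setW.setW, by simp, by simp, by simp, by simp, by simp, by simp⟩
    ?_ ?_)
  · rintro k τ T' - - ⟨-, hF, -⟩
    simp [hF.w .NG (by decide), hF.w .R (by decide), hN]
  · rintro k τ T' hk hj ⟨rfl, hF, h1, h2, h3, h4, h5, h0⟩
    refine Run.setA (by simp) (by omega) ⟨by simpa using hj, by omega, hF.setW.setW, by simpa using h1,
      by simpa using h2, by simpa using h3, by simpa using h4, by simpa using h5, ?_⟩
    intro b hb
    by_cases hbk : b = k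
    · subst hbk; simp [hj]
    · simp [hj, Function.update_of_ne hbk, h0 b (by omega)]
  rintro τ T' - ⟨rfl, hFτ, h1, h2, h3, h4, h5, h0⟩
  -- the nodes of the lists by digits are not touched, since the new ones have larger numbers
  have hLτ : ∀ ρ : State, (∀ k ≤ Γ.n, ρ.w .xx k = σ.w .xx k) → (∀ k ≤ Γ.n, ρ.x .ff k = σ.x .ff k) →
      (∀ k ≤ Γ.n, ρ.w .id k = σ.w .id k) → (∀ k ≤ Γ.n, ρ.w .nx k = σ.w .nx k) →
      ∀ b < Γ.K, ListRep ρ Γ.n (σ.w .hb b) (F.digitList Γ.n b) :=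
    fun ρ e1 e2 e3 e4 b hb => (hL b hb).congr e1 e2 e3 e4
  refine Run.cons (Run.forDown (N := Γ.K) (b := 4) (T₀ := Γ.n * 12 + 1) (fun k ρ T' =>
    Frame bucketW [.ff] σ ρ ∧ ρ.w .cn 0 = Γ.n + (F.done k).length ∧
    (∀ k ≤ Γ.n, ρ.w .xx k = σ.w .xx k ∧ ρ.x .ff k = σ.x .ff k ∧ ρ.w .id k = σ.w .id k ∧
      ρ.w .nx k = σ.w .nx k) ∧
    (∀ b < N, ListRep ρ (Γ.n + (F.done k).length) (ρ.w .hd b) (F.dist e Γ.A (F.done k) b)) ∧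
    (Γ.n - (F.done k).length) * 12 + 1 ≤ T') hv.KQ ?_ (by omega) ?_ ?_ ?_)
  · simp [hFτ.w .K (by decide), hΓ.K]
  · rw [F.done_of_le hFK.le]
    refine ⟨hFτ.setW, by simpa using h1, by simp [h2, h3, h4, h5], ?_, by simp⟩
    intro b hb
    simpa [Face.dist, ListRep] using h0 b hb
  · rintro k ρ T' hk hj ⟨hFρ, hcn, hold, hnew, hT'⟩
    have hdone := F.done_eq (k := k) (by omega)
    rw [hFn] at hdone
    have hhb : ρ.w .hb = σ.w .hb := hFρ.w _ (by decide)
    refine Run.of_small fun hρs => ?_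
    refine Run.cons (Run.setV (hρs.w _ _) (by omega) ?_)
    simp only [val_A, val_V, State.w_setW_self, Function.update_self, ne_eq, reduceCtorEq,
      not_false_eq_true, State.w_setW_of_ne, hhb]
    apply Run.weaken
    refine Run.cons (Run.loop (fun τ' T' => ∃ done rem h, done ++ rem = F.done k ∧
      Frame bucketW [.ff] σ τ' ∧ τ'.w .j 0 = k ∧ τ'.w .cn 0 = Γ.n + done.length ∧
      τ'.w .it 0 = h ∧ ListRep τ' Γ.n h rem ∧ (∀ a ∈ rem, a ∈ F.digitList Γ.n k) ∧
      (∀ k ≤ Γ.n, τ'.w .xx k = σ.w .xx k ∧ τ'.x .ff k = σ.x .ff k ∧ τ'.w .id k = σ.w .id k ∧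
        τ'.w .nx k = σ.w .nx k) ∧
      (∀ b < N, ListRep τ' (Γ.n + done.length) (τ'.w .hd b) (F.dist e Γ.A done b)) ∧
      (Γ.n - done.length) * 12 + 3 ≤ T') ?_
      ⟨F.done (k + 1), F.digitList Γ.n k, σ.w .hb k, hdone.symm, hFρ.setW.setW, by simp,
        by simpa using hcn, by simp, ?_, fun a ha => ha, by simpa using hold, ?_, by omega⟩)
    · rintro τ' T' ⟨done, rem, h, hdr, hF', hj', hcn', hit', hrem, hmem, hold', hnew', hT₂⟩
      refine ⟨by omega, fun ht => ?_, fun ht => ?_⟩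
      · simp only [Test.holds_wordLT, WExp.val_ofNat, val_V, hit'] at ht
        obtain _ | ⟨a, rem⟩ := rem
        · exact absurd (show h = 0 from hrem) (by omega)
        obtain ⟨f1, f2, f3, f4, f5, f6⟩ := hrem
        obtain ⟨p, hp, -, rfl⟩ := Face.mem_digitList.1 (hmem a (List.mem_cons_self ..))
        have hlen : done.length + 1 ≤ Γ.n := by
          have e1 := F.length_done_succ_le (by omega) k
          rw [← hdr, List.length_append, List.length_cons, hFn] at e1
          omega
        have hka : τ'.w .ka (p + 1) = F.bucket e Γ.A p := by
          rw [hF'.w _ (by decide)]; exact hB p hp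
        have hid : τ'.w .id h = p + 1 := f5
        set β := F.bucket e Γ.A p with hβ
        refine Run.of_small fun hs => ?_
        have hne : h ≠ Γ.n + done.length + 1 := by omega
        have hxQ := hs.w .xx h
        have hnQ := hs.w .nx h
        have hdQ := hs.w .hd β
        have hkQ := hs.w .ka (p + 1)
        rw [hka] at hkQ
        refine Run.cons (Run.setV (by simp [hcn']; omega) (by omega) ?_)
        refine Run.cons (Run.setA (by simpa [hit'] using hxQ) (by omega) ?_)
        refine Run.cons (Run.setXA (by omega) ?_)
        refine Run.cons (Run.setA (by simp [hit', hid]; omega) (by omega) ?_)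
        refine Run.cons (Run.setV ?_ (by omega) ?_)
        · simp [hit', hcn', Function.update_of_ne hne, hid, hka, hkQ]
        refine Run.cons (Run.setA ?_ (by omega) ?_)
        · simp [hit', hcn', Function.update_of_ne hne, hid, hka, hdQ]
        refine Run.cons (Run.setA (by simp [hcn']; omega) (by omega) ?_)
        refine Run.cons (Run.setV ?_ (by omega) ?_)
        · simp [hit', hcn', Function.update_of_ne hne, hnQ]
        simp only [val_A, val_V, ne_eq, reduceCtorEq, not_false_eq_true, State.w_setW_of_ne, hit',
          State.w_setX, WExp.val_add, hcn', WExp.val_ofNat, State.w_setW_self, Function.update_self,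
          val_XA, State.x_setW, f4, f3, f5, Function.update_of_ne hne, Face.item, hka]
        set ρ₂ := State.setW _ .it 0 (τ'.w .nx h) with hρ₂
        have hcell : ∀ k ≤ Γ.n + done.length, k ≠ Γ.n + done.length + 1 := fun k hk => by omega
        have hkeep : ∀ k ≤ Γ.n + done.length, ρ₂.w .xx k = τ'.w .xx k ∧ ρ₂.x .ff k = τ'.x .ff k ∧
            ρ₂.w .id k = τ'.w .id k ∧ ρ₂.w .nx k = τ'.w .nx k := by
          intro k hk
          simp [ρ₂, Function.update_of_ne (hcell k hk)]
        refine Run.nil (by omega) ⟨done ++ [F.item p], rem, τ'.w .nx h, by simpa using hdr, ?_, ?_,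
          ?_, by simp [ρ₂], ?_, fun a ha => hmem a (List.mem_cons_of_mem _ ha), ?_, ?_, ?_⟩
        · exact hF'.setW.setW.setX.setW.setW.setW.setW.setW
        · simpa [ρ₂] using hj'
        · simp [ρ₂, add_assoc]
        · refine f6.congr ?_ ?_ ?_ ?_ <;> intro k hk <;>
            simp only [hkeep k (by omega)]
        · intro k hk
          obtain ⟨o1, o2, o3, o4⟩ := hkeep k (by omega)
          rw [o1, o2, o3, o4]
          exact hold' k hk
        · intro b hb
          rw [Face.dist_snoc]
          have hbk : F.bucket e Γ.A ((F.item p).id - 1) = β := rfl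
          rw [hbk, List.length_append, List.length_singleton, ← add_assoc]
          have hL2 : ListRep ρ₂ (Γ.n + done.length + 1) (τ'.w .hd b) (F.dist e Γ.A done b) := by
            refine ((hnew' b hb).congr ?_ ?_ ?_ ?_).mono (Nat.le_succ _) <;> intro k hk <;>
              simp only [hkeep k hk]
          split_ifs with hbb
          · subst hbb
            have : ρ₂.w .hd β = Γ.n + done.length + 1 := by simp [ρ₂]
            rw [this]
            refine ⟨by omega, le_rfl, by simp [ρ₂, Face.item], by simp [ρ₂, Face.item],
              by simp [ρ₂, Face.item], ?_⟩
            have : ρ₂.w .nx (Γ.n + done.length + 1) = τ'.w .hd β := by simp [ρ₂]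
            rw [this]
            exact hL2
          · have : ρ₂.w .hd b = τ'.w .hd b := by
              simp [ρ₂, Function.update_of_ne (Ne.symm hbb)]
            rw [this]
            exact hL2
        · simp only [List.length_append, List.length_singleton]; omega
      · simp only [Test.holds_wordLT, WExp.val_ofNat, val_V, hit', not_lt] at ht
        obtain _ | ⟨a, rem⟩ := rem
        · rw [List.append_nil] at hdr
          subst hdr
          exact Run.nil (by omega) ⟨(Γ.n - (F.done k).length) * 12 + 1, by omega, hj', hF', hcn',
            hold', hnew', le_rfl⟩
        · exact absurd hrem.1 (by omega)
    · refine hLτ _ ?_ ?_ ?_ ?_ k hk <;> intro k' hk' <;> simp [hold k' hk']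
    · intro b hb
      exact ((hnew b hb).congr (by simp) (by simp) (by simp) (by simp))
  · rintro ρ T' - ⟨hFρ, -, -, hnew, hT'⟩
    have := F.length_done_succ_le (by omega) 0
    refine Run.nil (by omega) ⟨hFρ, fun b hb => (hnew b hb).mono (by omega)⟩

end

section

/-! ### All faces of the box -/

/-- The number `B` bounds the sizes of all tables. -/
structure Grid.Bound (Γ : Grid) (e B : ℕ) : Prop where
  K : Γ.K ≤ B
  A : Γ.G ^ e * Γ.A ≤ B
  T : ∀ k ≤ e, Γ.T ^ k * Γ.G ^ (e - k) * Γ.T ≤ B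
  G : ∀ k, 1 ≤ k → k ≤ e → Γ.T ^ k * Γ.G ^ (e - k) * Γ.G ≤ B

variable {E : Env} [E.Full]

/-- Find optimal points for all points of the grid on a face. -/
def facePass : Program := block [
  setV .NG 1, forUp .i (V .dim - 2) (setV .NG (V .NG * V .G)), setV .R (V .A),
  digitPass, bucketPass,
  forUp .k (V .dim - 1) (block [phase, load])]

/-- The word variables that a round may change. -/
abbrev roundW : List WReg := .g :: groupW ++ loadW

/-- The word variables that `facePass` may change. -/
abbrev faceW : List WReg := .k :: roundW ++ digitW ++ bucketW

/-- The real variables that `facePass` may change. -/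
abbrev faceX : List XReg := .h :: .ff :: groupX

theorem facePass_run {Γ : Grid} {σ : State} {e ax sg B : ℕ} (hv : Γ.Valid E e)
    (hb : Γ.Bound e B) (hBQ : B < E.Q) (hn0 : 0 < Γ.n)
    (hΓ : Γ.InMem σ) (hax : σ.w .ax 0 = ax) (hsg : σ.w .sg 0 = sg) :
    Run E facePass σ ((200 * e + 300) * (Γ.n + B)) fun τ _ => Frame faceW faceX σ τ ∧
      τ.w .key 0 = Γ.T ^ (e + 1) ∧ (Γ.face ax sg).Winners (e + 1) 0 τ := by
  have hn := hv.n
  have hK0 := hv.K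
  have hT0 := hv.T
  have hGM := hv.G
  have hG0 : 0 < Γ.G := by omega
  have hDe := hv.D
  have hDQ := hv.DQ
  have hA0 : 0 < Γ.A := (Nat.zero_le _).trans_lt hv.A
  set F := Γ.face ax sg with hF
  have hx : ∀ k < e + 1, ∀ p < F.n, F.x k p < F.G := fun k _ p hp => hv.x_lt ax sg k p hp
  have hGe : Γ.G ^ e ≤ E.Q := le_trans (Nat.le_mul_of_pos_right _ hA0) hv.NQ
  have hTB := hb.T
  have hGB := hb.G
  have hKB := hb.K
  have hAB := hb.A
  have hTB1 : ∀ k ≤ e, Γ.T ^ k * Γ.G ^ (e - k) ≤ B := fun k hk =>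
    (Nat.le_mul_of_pos_right _ hT0).trans (hTB k hk)
  -- The costs of the steps are listed one by one; `extra` is what remains of the bound.
  have hcost : (200 * e + 300) * (Γ.n + B) = 1 + (e * 4 + 4) + 1 + (Γ.K * 4 + Γ.n * (9 * e + 33) + 9) +
      (Γ.G ^ e * Γ.A * 4 + Γ.n * 12 + Γ.K * 8 + 12) + ((e + 1) * (55 * Γ.n + 109 * B + 21 + 3) + 4) +
      1 + ((200 * e + 300) * (Γ.n + B) - (1 + (e * 4 + 4) + 1 + (Γ.K * 4 + Γ.n * (9 * e + 33) + 9) +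
      (Γ.G ^ e * Γ.A * 4 + Γ.n * 12 + Γ.K * 8 + 12) + ((e + 1) * (55 * Γ.n + 109 * B + 21 + 3) + 4) +
      1)) := by
    refine (Nat.add_sub_cancel' ?_).symm
    nlinarith [Nat.mul_le_mul_left e hn0]
  set extra := (200 * e + 300) * (Γ.n + B) - (1 + (e * 4 + 4) + 1 + (Γ.K * 4 + Γ.n * (9 * e + 33) + 9) +
      (Γ.G ^ e * Γ.A * 4 + Γ.n * 12 + Γ.K * 8 + 12) + ((e + 1) * (55 * Γ.n + 109 * B + 21 + 3) + 4) +
      1) with hextra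
  clear_value extra
  rw [hcost]
  clear hcost hextra
  set X₁ := Γ.n * (9 * e + 33)
  set X₂ := (e + 1) * (55 * Γ.n + 109 * B + 21 + 3) with hX₂
  refine Run.cons (Run.setV (by simp; omega) (by omega) ?_)
  refine Run.cons (Run.forUp (N := e) (b := 1)
    (T₀ := 1 + (Γ.K * 4 + X₁ + 9) +
      (Γ.G ^ e * Γ.A * 4 + Γ.n * 12 + Γ.K * 8 + 12) + (X₂ + 4) + 1 + extra) (fun k τ T' =>
    T' = 1 + (Γ.K * 4 + X₁ + 9) +
      (Γ.G ^ e * Γ.A * 4 + Γ.n * 12 + Γ.K * 8 + 12) + (X₂ + 4) + 1 + extra ∧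
    Frame [.NG, .i] [] σ τ ∧ τ.w .NG 0 = Γ.G ^ k) (by omega) ?_ (by omega) ?_ ?_ ?_)
  · rintro k τ T' - - ⟨-, hF, -⟩
    simp [hF.w .dim (by decide), hΓ.D, hDe]
  · exact ⟨rfl, (Frame.refl _).setW.setW, by simp⟩
  · rintro k τ T' hk hi ⟨rfl, hFr, hNG⟩
    have hG' : τ.w .G 0 = Γ.G := by rw [hFr.w _ (by decide), hΓ.G]
    have hle : Γ.G ^ (k + 1) ≤ E.Q := (Nat.pow_le_pow_right hG0 hk).trans hGe
    refine Run.setV (by simpa [hNG, hG', ← pow_succ] using hle) (by omega)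
      ⟨by simpa using hi, by omega, hFr.setW.setW, by simp [hNG, hG', pow_succ]⟩
  rintro τ T' - ⟨rfl, hFr, hNG⟩
  have hΓτ := hΓ.of_frame hFr
  refine Run.of_small fun hτs => ?_
  refine Run.cons (Run.setV (by simpa using hτs.w .A 0) (by omega) ?_)
  have hFr' : Frame faceW faceX σ (τ.setW .R 0 ((V .A).val τ)) := hFr.mono.setW
  have hR' : (τ.setW .R 0 ((V .A).val τ)).w .R 0 = Γ.A := by simp [hΓτ.A]
  have hNG' : (τ.setW .R 0 ((V .A).val τ)).w .NG 0 = Γ.G ^ e := by simpa using hNG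
  generalize τ.setW .R 0 ((V .A).val τ) = τ₁ at hFr' hR' hNG' ⊢
  refine Run.cons ((digitPass_run hv (hΓ.of_frame hFr') (by rw [hFr'.w _ (by decide), hax])
    (by rw [hFr'.w _ (by decide), hsg])).call (by omega) ?_)
  rintro τ₂ ⟨hF₂, hdig, hka⟩
  refine Run.cons ((bucketPass_run (N := Γ.G ^ e * Γ.A) hv ((hΓ.of_frame hFr').of_frame hF₂)
    (by rw [hF₂.w _ (by decide), hF₂.w _ (by decide), hNG', hR']) hv.NQ hdig hka).call
    (by omega) ?_)
  rintro τ₃ ⟨hF₃, hbuck⟩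
  have hFr₃ : Frame faceW faceX σ τ₃ := (hFr'.trans hF₂.mono).trans hF₃.mono
  have hR₃ : τ₃.w .R 0 = Γ.A := by rw [hF₃.w _ (by decide), hF₂.w _ (by decide), hR']
  have hNG₃ : τ₃.w .NG 0 = Γ.G ^ e := by rw [hF₃.w _ (by decide), hF₂.w _ (by decide), hNG']
  refine Run.cons (Run.forUp (N := e + 1) (b := 55 * Γ.n + 109 * B + 21) (T₀ := 1)
    (fun k ρ T' => T' = 1 ∧ Frame faceW faceX σ ρ ∧
      (k ≤ e → ρ.w .NG 0 = Γ.T ^ k * Γ.G ^ (e - k) ∧ ∃ R c L, ρ.w .R 0 = R ∧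
        BucketRep ρ (Γ.T ^ k * Γ.G ^ (e - k) * R) c L ∧ F.Buckets k (e - k) R L ∧
        Γ.T ^ k * Γ.G ^ (e - k) * R ≤ B ∧ (cat L 0 (Γ.T ^ k * Γ.G ^ (e - k) * R)).length ≤ Γ.n + B) ∧
      (k = e + 1 → ρ.w .key 0 = Γ.T ^ (e + 1) ∧ F.Winners (e + 1) 0 ρ))
    (by omega) ?_ (by omega) ?_ ?_ ?_)
  · rintro k τ T' - - ⟨-, hF, -⟩
    simp [hF.w .dim (by decide), hΓ.D, hDe]
  · refine ⟨rfl, hFr₃.setW, fun _ => ⟨by simpa using hNG₃, Γ.A, 2 * Γ.n, _, by simpa using hR₃, ?_,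
      F.buckets_zero hK0 ?_, by simpa using hAB, ?_⟩, by omega⟩
    · rw [pow_zero, one_mul, Nat.sub_zero]
      exact hbuck.of_frame (S := [.k]) (S' := []) (Frame.setW (Frame.refl _))
    · intro p hp
      have := hx 0 (by omega) p hp
      exact (Nat.div_le_div_right (Nat.lt_succ_iff.1 (this.trans_eq hv.G))).trans_lt hv.A
    · exact (F.length_dist_le _ _).trans ((F.length_done hK0).le.trans (Nat.le_add_right _ _))
  · rintro k ρ T' hk hkr ⟨rfl, hFρ, hcur, -⟩
    obtain ⟨hNGρ, R, c, L, hRρ, hrep, hbk, hRB, hlen⟩ := hcur (by omega)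
    have hΓρ := hΓ.of_frame hFρ
    have hke : k ≤ e := by omega
    set NG := Γ.T ^ k * Γ.G ^ (e - k) with hNGdef
    have hNG0 : 0 < NG := by positivity
    have h1 : NG * Γ.T ≤ B := hTB k hke
    have h2 : NG ≤ B := hTB1 k hke
    have hRQ : R ≤ E.Q := by
      have := Nat.le_mul_of_pos_left R hNG0
      omega
    have h3 : NG * (R * 12 + Γ.T * 15 + 15) = 12 * (NG * R) + 15 * (NG * Γ.T) + 15 * NG := by ring
    have h4 : Γ.T * NG = NG * Γ.T := mul_comm _ _
    apply Run.weaken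
    refine Run.cons ((phase_run hΓρ.params hK0 hT0 hv.TQ hNGρ hRρ (by omega) (by omega)
      hRQ hrep hlen hbk.sorted).call (by omega) ?_)
    rintro ρ₁ ⟨hF₄, hbest⟩
    have hwin : F.Winners (k + 1) (e - k) ρ₁ := hbk.winners hT0 hx (by omega) hbest
    refine Run.cons ((load_run (T := Γ.T) (NG := NG) (G := Γ.G) (by rw [hF₄.w _ (by decide), hΓρ.T])
      (by rw [hF₄.w _ (by decide), hNGρ]) (by rw [hF₄.w _ (by decide), hΓρ.G]) hG0
      (by omega)).call (by omega) ?_)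
    rintro ρ₂ ⟨hF₅, hkey, hNG₂, hR₂, hrep₂⟩
    refine Run.nil (by omega) ⟨1, by omega, ?_, rfl, ((hFρ.trans hF₄.mono).trans hF₅.mono).setW,
      ?_, ?_⟩
    · rw [hF₅.w _ (by decide), hF₄.w _ (by decide), hkr]
    · intro hk'
      have he : e - k = e - (k + 1) + 1 := by omega
      have hTN : Γ.T * NG = Γ.T ^ (k + 1) * Γ.G ^ (e - (k + 1)) * Γ.G := by
        rw [hNGdef, he]; ring
      have h5 := hGB (k + 1) (by omega) hk'
      refine ⟨?_, Γ.G, Γ.T * NG, winnerList Γ.G ρ₁, by simpa using hR₂, ?_, ?_, h5, ?_⟩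
      · rw [State.w_setW_of_ne (by decide), hNG₂, hTN, Nat.mul_div_cancel _ hG0]
      · rw [← hTN]
        exact hrep₂.of_frame (S := [.k]) (S' := []) (Frame.setW (Frame.refl _))
      · rw [he] at hwin
        exact hwin.buckets hx (by omega) hG0
      · refine (length_cat_le (length_winnerList_le _ _) _ _).trans ?_
        omega
    · intro hk'
      obtain rfl : k = e := by omega
      refine ⟨?_, ?_⟩
      · rw [State.w_setW_of_ne (by decide), hkey, hNGdef]; simp [pow_succ']
      · rw [Nat.sub_self] at hwin
        have ho : (ρ₂.setW .k 0 (k + 1)).w .oi = ρ₁.w .oi := by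
          rw [State.w_setW_of_ne (by decide), hF₅.w _ (by decide)]
        have hd : (ρ₂.setW .k 0 (k + 1)).x .od = ρ₁.x .od := by
          rw [State.x_setW, hF₅.x _ (by decide)]
        exact ⟨by simpa only [ho, hd] using hwin.sound, by simpa only [ho, hd] using hwin.complete⟩
  · rintro ρ T' - ⟨rfl, hFρ, -, hfin⟩
    obtain ⟨h1, h2⟩ := hfin rfl
    exact Run.nil le_rfl ⟨hFρ, h1, h2⟩

/-- Append the winners to the list of the selected points. -/
def collect : Program := forUp .i (V .key) <| block [
  setV .tmp (A .oi (V .i) - 1),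
  forUp .j (V .dim) (setXA .out (V .oc * V .dim + V .dim + 1 + V .j)
    (XA .pt (V .tmp * V .dim + V .j))),
  setV .oc (V .oc + 1)]

/-- The selected point number `t` is the point `p`. -/
def Grid.Selected (Γ : Grid) (σ : State) (t p : ℕ) : Prop :=
  p < Γ.n ∧ ∀ j < Γ.D, σ.x .out (t * Γ.D + Γ.D + 1 + j) = Γ.pt (p * Γ.D + j)

theorem collect_run {Γ : Grid} {σ : State} {e N c : ℕ} (hv : Γ.Valid E e) (hΓ : Γ.InMem σ)
    (hN : σ.w .key 0 = N) (hc : σ.w .oc 0 = c) (hcN : c + N ≤ E.Q)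
    (hoi : ∀ b < N, ∃ p < Γ.n, σ.w .oi b = p + 1) :
    Run E collect σ (N * (Γ.D * 4 + 13) + 4) fun τ _ => Frame [.i, .tmp, .j, .oc] [.out] σ τ ∧
      τ.w .oc 0 = c + N ∧ (∀ t < c, ∀ p, Γ.Selected σ t p → Γ.Selected τ t p) ∧
      ∀ b < N, Γ.Selected τ (c + b) (σ.w .oi b - 1) := by
  have hDQ := hv.DQ
  have hn := hv.n
  refine Run.forUp (N := N) (b := Γ.D * 4 + 10) (T₀ := 0) (fun k τ _ =>
    Frame [.i, .tmp, .j, .oc] [.out] σ τ ∧ τ.w .oc 0 = c + k ∧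
    (∀ i < c * Γ.D + Γ.D + 1, τ.x .out i = σ.x .out i) ∧
    ∀ b < k, Γ.Selected τ (c + b) (σ.w .oi b - 1)) (by omega) ?_ (le_of_eq ?_) ?_ ?_ ?_
  · rintro k τ T' - - ⟨hF, -⟩
    simp [hF.w .key (by decide), hN]
  · ring
  · exact ⟨(Frame.refl _).setW, by simpa using hc, by simp, by simp⟩
  · rintro k τ T' hk hi ⟨hF, hoc, hold, hnew⟩
    have hΓτ := hΓ.of_frame hF
    have hoiτ : τ.w .oi = σ.w .oi := hF.w _ (by decide)
    obtain ⟨p, hp, hpo⟩ := hoi k hk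
    refine Run.cons (Run.setV (by simp [hi, hoiτ, hpo]; omega) (by omega) ?_)
    refine Run.cons (Run.forUp (N := Γ.D) (b := 1) (T₀ := 4) (fun j ρ T' =>
      T' = 4 ∧ Frame [.i, .tmp, .j, .oc] [.out] σ ρ ∧ ρ.w .i 0 = k ∧ ρ.w .tmp 0 = p ∧
        ρ.w .oc 0 = c + k ∧
      (∀ i < (c + k) * Γ.D + Γ.D + 1, ρ.x .out i = τ.x .out i) ∧
      ∀ i < j, ρ.x .out ((c + k) * Γ.D + Γ.D + 1 + i) = Γ.pt (p * Γ.D + i)) (by omega) ?_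
      (by omega) ?_ ?_ ?_)
    · rintro j ρ T'' - - ⟨-, hF, -⟩
      simp [hF.w .dim (by decide), hΓ.D]
    · exact ⟨rfl, hF.setW.setW, by simpa using hi, by simp [hi, hoiτ, hpo],
        by simpa using hoc, by simp, by simp⟩
    · rintro j ρ T'' hj hjr ⟨rfl, hFρ, h1, h2, h3, h4, h5⟩
      have hΓρ := hΓ.of_frame hFρ
      refine Run.setXA (by omega) ⟨by simpa using hjr, by omega, hFρ.setX.setW, by simpa using h1,
        by simpa using h2, by simpa using h3, ?_, ?_⟩
      · intro i hi'
        simp only [WExp.val_add, WExp.val_mul, val_V, h3, hΓρ.D, hjr, State.x_setW,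
          State.x_setX_self, WExp.val_ofNat]
        rw [Function.update_of_ne (by omega), h4 i hi']
      · intro i hi'
        simp only [WExp.val_add, WExp.val_mul, val_V, h3, hΓρ.D, hjr, State.x_setW,
          State.x_setX_self, WExp.val_ofNat, val_XA, h2, hΓρ.pt]
        by_cases hij : i = j
        · subst hij; rw [Function.update_self]
        · rw [Function.update_of_ne (by omega), h5 i (by omega)]
    · rintro ρ T'' - ⟨rfl, hFρ, h1, h2, h3, h4, h5⟩
      refine Run.cons (Run.setV (by simp [h3]; omega) (by omega) ?_)
      refine Run.nil (by omega) ⟨by simpa using h1, hFρ.setW.setW, by simp [h3, add_assoc], ?_, ?_⟩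
      · intro i hi'
        have : c * Γ.D ≤ (c + k) * Γ.D := Nat.mul_le_mul_right _ (by omega)
        simp only [State.x_setW]
        rw [h4 i (by omega), hold i hi']
      · intro b hb
        by_cases hbk : b = k
        · subst hbk
          refine ⟨by omega, fun j hj => ?_⟩
          simp only [State.x_setW]
          rw [h5 j hj, hpo, Nat.add_sub_cancel]
        · obtain ⟨s1, s2⟩ := hnew b (by omega)
          refine ⟨s1, fun j hj => ?_⟩
          have : (c + b + 1) * Γ.D ≤ (c + k) * Γ.D := Nat.mul_le_mul_right _ (by omega)
          rw [add_mul, one_mul] at this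
          simp only [State.x_setW]
          rw [h4 _ (by omega), s2 j hj]
  · rintro τ T' - ⟨hF, hoc, hold, hnew⟩
    refine ⟨hF, hoc, ?_, hnew⟩
    rintro t ht p ⟨s1, s2⟩
    refine ⟨s1, fun j hj => ?_⟩
    have : (t + 1) * Γ.D ≤ c * Γ.D := Nat.mul_le_mul_right _ (by omega)
    rw [add_mul, one_mul] at this
    rw [hold _ (by omega), s2 j hj]

/-- For every point of every face grid, a nearest point has been selected, up to rounding. -/
def Grid.Covered (Γ : Grid) (σ : State) (cnt m ax sg : ℕ) : Prop :=
  ∀ c < Γ.T ^ m, ∃ t < cnt, ∃ r, Γ.Selected σ t r ∧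
    ∀ p < Γ.n, (Γ.face ax sg).obj m p c ≤ (Γ.face ax sg).obj m r c

/-- Select points for all points of all face grids. -/
def faces : Program := block [
  setV .oc 0,
  forUp .ax (V .dim) (forUp .sg 2 (block [facePass, collect]))]

/-- The word variables that `faces` may change. -/
abbrev facesW : List WReg := .oc :: .ax :: .sg :: .i :: .tmp :: .j :: faceW

/-- The real variables that `faces` may change. -/
abbrev facesX : List XReg := .out :: faceX

theorem facePass_collect_run {Γ : Grid} {σ : State} {e ax sg B c : ℕ} (hv : Γ.Valid E e)
    (hb : Γ.Bound e B) (hn0 : 0 < Γ.n) (hcQ : c + B < E.Q)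
    (hΓ : Γ.InMem σ) (hax : σ.w .ax 0 = ax) (hsg : σ.w .sg 0 = sg) (hc : σ.w .oc 0 = c) :
    Run E (block [facePass, collect]) σ ((204 * e + 326) * (Γ.n + B)) fun τ _ =>
      Frame (.oc :: .i :: .tmp :: .j :: faceW) facesX σ τ ∧ τ.w .oc 0 = c + Γ.T ^ (e + 1) ∧
      (∀ t < c, ∀ p, Γ.Selected σ t p → Γ.Selected τ t p) ∧
      (∀ t < Γ.T ^ (e + 1), ∃ p, Γ.Selected τ (c + t) p) ∧
      Γ.Covered τ (c + Γ.T ^ (e + 1)) (e + 1) ax sg := by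
  have hTB : Γ.T ^ (e + 1) ≤ B := by
    have := hb.T e le_rfl
    rwa [Nat.sub_self, pow_zero, mul_one, ← pow_succ] at this
  have hD := hv.D
  have hcost : (200 * e + 300) * (Γ.n + B) + (Γ.T ^ (e + 1) * (Γ.D * 4 + 13) + 4) + 1 ≤
      (204 * e + 326) * (Γ.n + B) := by
    rw [hD]
    nlinarith [Nat.mul_le_mul_right ((e + 2) * 4 + 13) hTB]
  refine Run.cons ((facePass_run hv hb (by omega) hn0 hΓ hax hsg).call (by omega) ?_)
  rintro τ ⟨hF, hkey, hW⟩
  have hsound : ∀ b < Γ.T ^ (e + 1), ∃ p < Γ.n, τ.w .oi b = p + 1 ∧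
      τ.x .od b = (Γ.face ax sg).obj (e + 1) p b := by
    intro b hbT
    have h0 : τ.w .oi b ≠ 0 := by
      have := (hW.complete 0 hn0 b hbT).1
      simpa [Face.key] using this
    obtain ⟨p, hp, c, -, h1, h2, h3⟩ := hW.sound b (by simpa [Grid.face] using hbT) h0
    simp only [pow_zero, mul_one, Face.key, add_zero] at h1
    exact ⟨p, hp, h2, h1 ▸ h3⟩
  have hoc : τ.w .oc 0 = c := by rw [hF.w _ (by decide), hc]
  refine Run.cons ((collect_run hv (hΓ.of_frame hF) hkey hoc (by omega)
    fun b hbT => by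
      obtain ⟨p, hp, h, -⟩ := hsound b hbT
      exact ⟨p, hp, h⟩).call (by omega) ?_)
  rintro ρ ⟨hF', hoc', hold, hnew⟩
  refine Run.nil (by omega) ⟨hF.mono.trans hF'.mono, hoc', ?_, ?_, ?_⟩
  · rintro t ht p ⟨s1, s2⟩
    exact hold t ht p ⟨s1, by rw [hF.x _ (by decide)]; exact s2⟩
  · exact fun t ht => ⟨_, hnew t ht⟩
  · intro b hbT
    obtain ⟨r, hr, h1, h2⟩ := hsound b hbT
    refine ⟨c + b, by omega, r, ?_, fun p hp => ?_⟩
    · have := hnew b hbT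
      rwa [h1, Nat.add_sub_cancel] at this
    · rw [← h2]
      simpa [Face.key] using (hW.complete p hp b hbT).2

theorem faces_run {Γ : Grid} {σ : State} {e B : ℕ} (hv : Γ.Valid E e)
    (hb : Γ.Bound e B) (hn0 : 0 < Γ.n) (hQ : 2 * Γ.D * B < E.Q) (hΓ : Γ.InMem σ) :
    Run E faces σ ((e + 2) * ((408 * e + 662) * (Γ.n + B) + 3) + 6) fun τ _ =>
      Frame facesW facesX σ τ ∧ τ.w .oc 0 = Γ.D * 2 * Γ.T ^ (e + 1) ∧
      (∀ t < Γ.D * 2 * Γ.T ^ (e + 1), ∃ p, Γ.Selected τ t p) ∧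
      ∀ ax < Γ.D, ∀ sg < 2, Γ.Covered τ (Γ.D * 2 * Γ.T ^ (e + 1)) (e + 1) ax sg := by
  have hTB : Γ.T ^ (e + 1) ≤ B := by
    have := hb.T e le_rfl
    rwa [Nat.sub_self, pow_zero, mul_one, ← pow_succ] at this
  have hD := hv.D
  set N := Γ.T ^ (e + 1) with hN
  have hDQ := hv.DQ
  have hCov : ∀ {τ ρ : State} {c c' ax sg : ℕ}, c ≤ c' →
      (∀ t < c, ∀ p, Γ.Selected τ t p → Γ.Selected ρ t p) →
      Γ.Covered τ c (e + 1) ax sg → Γ.Covered ρ c' (e + 1) ax sg := by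
    intro τ ρ c c' ax sg hcc h1 h2 b hb
    obtain ⟨t, ht, r, hr, h3⟩ := h2 b hb
    exact ⟨t, by omega, r, h1 t ht r hr, h3⟩
  refine Run.cons (Run.setV (by simp) (by omega) ?_)
  refine Run.cons (Run.forUp (N := e + 2) (b := (408 * e + 662) * (Γ.n + B)) (T₀ := 1)
    (fun ax τ T' => T' = 1 ∧ Frame facesW facesX σ τ ∧ τ.w .oc 0 = ax * 2 * N ∧
      (∀ t < ax * 2 * N, ∃ p, Γ.Selected τ t p) ∧
      ∀ a < ax, ∀ s < 2, Γ.Covered τ (ax * 2 * N) (e + 1) a s) (by omega) ?_ (by omega) ?_ ?_ ?_)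
  · rintro k τ T' - - ⟨-, hF, -⟩
    simp [hF.w .dim (by decide), hΓ.D, hD]
  · exact ⟨rfl, (Frame.refl _).setW.setW, by simp, by simp, by simp⟩
  · rintro ax τ T' hax haxr ⟨rfl, hF, hoc, hsel, hcov⟩
    refine Run.forUp (N := 2) (b := (204 * e + 326) * (Γ.n + B)) (T₀ := 1)
      (fun sg ρ T' => T' = 1 ∧ Frame facesW facesX σ ρ ∧ ρ.w .ax 0 = ax ∧
        ρ.w .oc 0 = (ax * 2 + sg) * N ∧
        (∀ t < (ax * 2 + sg) * N, ∃ p, Γ.Selected ρ t p) ∧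
        (∀ a < ax, ∀ s < 2, Γ.Covered ρ ((ax * 2 + sg) * N) (e + 1) a s) ∧
        ∀ s < sg, Γ.Covered ρ ((ax * 2 + sg) * N) (e + 1) ax s) (by omega) ?_ ?_ ?_ ?_ ?_
    · intros; rfl
    · have : (408 * e + 662) * (Γ.n + B) = 2 * ((204 * e + 326) * (Γ.n + B)) + 10 * (Γ.n + B) := by
        ring
      omega
    · exact ⟨rfl, hF.setW, by simpa using haxr, by simpa using hoc, hsel, hcov, by simp⟩
    · rintro sg ρ T' hsg hsgr ⟨rfl, hFρ, haxρ, hocρ, hselρ, hcovρ, hcovρ'⟩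
      have hle : (ax * 2 + sg + 1) * N ≤ 2 * Γ.D * B :=
        Nat.mul_le_mul (by omega) hTB
      have hle' : (ax * 2 + sg) * N + B ≤ 2 * Γ.D * B := by
        have h1 : (ax * 2 + sg) * N ≤ (2 * Γ.D - 1) * B := Nat.mul_le_mul (by omega) hTB
        have h2 : 2 * Γ.D * B = (2 * Γ.D - 1) * B + B := by
          rw [← Nat.succ_mul]; congr 1; omega
        omega
      refine (facePass_collect_run hv hb hn0 (by omega) (hΓ.of_frame hFρ) haxρ hsgr hocρ).call
        (by omega) ?_
      rintro ρ₁ ⟨hF₁, hoc₁, hold, hnew, hcov₁⟩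
      have hs : (ax * 2 + (sg + 1)) * N = (ax * 2 + sg) * N + N := by ring
      refine ⟨by rw [hF₁.w _ (by decide), hsgr], by omega, (hFρ.trans hF₁.mono).setW, ?_, ?_, ?_,
        ?_, ?_⟩
      · rw [State.w_setW_of_ne (by decide), hF₁.w _ (by decide), haxρ]
      · rw [hs]; simpa using hoc₁
      · intro t ht
        by_cases htc : t < (ax * 2 + sg) * N
        · obtain ⟨p, hp⟩ := hselρ t htc
          exact ⟨p, hold t htc p hp⟩
        · obtain ⟨u, rfl⟩ := Nat.exists_eq_add_of_le (not_lt.1 htc)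
          exact hnew u (by omega)
      · intro a ha s hs'
        exact hCov (by omega) hold (hcovρ a ha s hs')
      · intro s hs'
        rw [hs]
        rcases Nat.lt_succ_iff_lt_or_eq.1 hs' with h | rfl
        · exact hCov (by omega) hold (hcovρ' s h)
        · exact hcov₁
    · rintro ρ T' - ⟨rfl, hFρ, haxρ, hocρ, hselρ, hcovρ, hcovρ'⟩
      have hs : (ax + 1) * 2 * N = (ax * 2 + 2) * N := by ring
      rw [hs]
      refine ⟨haxρ, by omega, hFρ.setW, by simpa using hocρ, hselρ, ?_⟩
      intro a ha s hs'
      rcases Nat.lt_succ_iff_lt_or_eq.1 ha with h | rfl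
      · exact hcovρ a h s hs'
      · exact hcovρ' s hs'
  · rintro τ T' - ⟨rfl, hF, hoc, hsel, hcov⟩
    rw [hD]
    exact Run.nil le_rfl ⟨hF, hoc, hsel, hcov⟩

end

section

/-! ### The bounding box and the size of the grid -/

variable {E : Env} [E.Full]

/-- Move the coordinates of the points from the real cells `1, 2, …` to the region `pt`. The
coordinates at the end of the input are moved first, so that the other ones are not overwritten. -/
def spread (D : ℕ) : Program := block [
  setV .dim (.lit D),
  forDown .i (V .n * V .dim) (setXA .pt (V .i) (.read (V .i + 1)))]

theorem spread_run {σ : State} {D n : ℕ} (hn : σ.w .n 0 = n) (hD : D ≤ E.Q) (hnD : n * D ≤ E.Q) :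
    Run E (spread D) σ (n * D * 4 + 6) fun τ _ => Frame [.dim, .i] [.pt] σ τ ∧
      τ.w .dim 0 = D ∧ ∀ a < n * D, τ.x .pt a = σ.real (a + 1) := by
  refine Run.cons (Run.setV_good hD hD (by omega) ?_)
  refine Run.cons (Run.forDown (N := n * D) (b := 1) (T₀ := 1)
    (fun k τ T' => T' = 1 ∧ Frame [.dim, .i] [.pt] σ τ ∧ τ.w .dim 0 = D ∧
      (∀ a < k, τ.real (a + 1) = σ.real (a + 1)) ∧
      ∀ a, k ≤ a → a < n * D → τ.x .pt a = σ.real (a + 1))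
    hnD (by simp [hn]) (by omega) ?_ ?_ ?_)
  · exact ⟨rfl, (Frame.refl σ).setW.setW, by simp, fun _ _ => rfl, fun a h h' => by omega⟩
  · rintro k τ T' hk hkr ⟨rfl, hF, hd, h1, h2⟩
    refine Run.setXA (by omega) ⟨by simp, rfl, (hF.setW).setX, by simpa using hd, ?_, ?_⟩
    · intro a ha
      -- The target lies behind all coordinates that still have to be moved.
      have hne : a + 1 ≠ 64 * k + XReg.pt.ctorIdx := by
        have : XReg.pt.ctorIdx = 1 := rfl
        omega
      have : ((τ.setW .i 0 k).setX .pt k ((RExp.read (V .i + 1)).val (τ.setW .i 0 k))).real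
          (a + 1) = τ.real (a + 1) := by
        simp [State.setX, State.setReal, State.setW, State.setWord, Function.update_of_ne hne]
      have hi : (V .i).val (τ.setW .i 0 k) = k := by simp
      rw [hi]
      exact this.trans (h1 a (by omega))
    · intro a ha ha'
      have hval : (RExp.read (V .i + 1)).val (τ.setW .i 0 k) = τ.real (k + 1) := by
        simp [RExp.val, State.setW, State.setWord, State.w]
      rw [hval]
      by_cases hak : a = k
      · subst hak
        simpa using h1 a (by omega)
      · simpa [hak] using h2 a (by omega) ha'
  · rintro τ T' - ⟨rfl, hF, hd, -, h2⟩
    exact Run.nil le_rfl ⟨hF, hd, fun a ha => h2 a (Nat.zero_le _) ha⟩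

/-- Compute the smallest coordinates `lo` of the points and the largest extent `L` of their
bounding box. -/
def box : Program := block [
  setXV .L (toX 0),
  forUp .j (V .dim) <| block [
    setXA .lo (V .j) (XA .pt (V .j)),
    setXV .hi (XA .pt (V .j)),
    forUp .i (V .n) <| block [
      setXV .y (XA .pt (V .i * V .dim + V .j)),
      .branch (.realLT (XV .y) (XA .lo (V .j))) (setXA .lo (V .j) (XV .y)) .skip,
      .branch (.realLT (XV .hi) (XV .y)) (setXV .hi (XV .y)) .skip],
    .branch (.realLT (XV .L) (XV .hi - XA .lo (V .j))) (setXV .L (XV .hi - XA .lo (V .j))) .skip]]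

/-- `L` is the largest extent of the bounding box of the `n` points with the coordinates `x`, and
`lo` is its corner; only the first `J` coordinates are taken into account. -/
structure IsBox (n J : ℕ) (x : ℕ → ℕ → ℝ) (lo : ℕ → ℝ) (L : ℝ) : Prop where
  nonneg : 0 ≤ L
  lo_mem : ∀ j < J, ∃ i < n, lo j = x i j
  lo_le : ∀ j < J, ∀ i < n, lo j ≤ x i j
  le_add : ∀ j < J, ∀ i < n, x i j ≤ lo j + L
  attained : L = 0 ∨ ∃ j < J, ∃ i < n, ∃ i' < n, L = x i j - x i' j

theorem box_run {σ : State} {D n : ℕ} (hn : σ.w .n 0 = n) (hD : σ.w .dim 0 = D) (hn0 : 0 < n)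
    (hnQ : n ≤ E.Q) (hDQ : D ≤ E.Q) :
    Run E box σ (D * (n * 10 + 18) + 7) fun τ _ => Frame [.i, .j] [.L, .lo, .hi, .y] σ τ ∧
      IsBox n D (fun i j => σ.x .pt (i * D + j)) (τ.x .lo) (τ.x .L 0) := by
  set x : ℕ → ℕ → ℝ := fun i j => σ.x .pt (i * D + j) with hx
  refine Run.cons (Run.setXV (by omega) ?_)
  refine Run.cons (Run.forUp (N := D) (b := n * 10 + 15) (T₀ := 1)
    (fun j τ T' => T' = 1 ∧ Frame [.i, .j] [.L, .lo, .hi, .y] σ τ ∧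
      IsBox n j x (τ.x .lo) (τ.x .L 0)) hDQ ?_ (by
        have : n * 10 + 15 + 3 = n * 10 + 18 := rfl
        rw [this]; omega) ?_ ?_ ?_)
  · rintro k τ T' - - ⟨-, hF, -⟩
    simp [hF.w .dim (by decide), hD]
  · exact ⟨rfl, (Frame.refl σ).setX.setW, by
      constructor <;> simp⟩
  · rintro j τ T' hj hjr ⟨rfl, hF, hB⟩
    refine Run.cons (Run.setXA (by omega) ?_)
    refine Run.cons (Run.setXV (by omega) ?_)
    have hpt : τ.x .pt = σ.x .pt := hF.x _ (by decide)
    have hx0 : τ.x .pt j = x 0 j := by simp [hx, hpt]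
    refine Run.cons (Run.forUp (N := n) (b := 7) (T₀ := 4)
      (fun k ρ T' => T' = 4 ∧ Frame [.i, .j] [.L, .lo, .hi, .y] σ ρ ∧ ρ.w .j 0 = j ∧
        ρ.x .L = τ.x .L ∧ (∀ j' < j, ρ.x .lo j' = τ.x .lo j') ∧
        (∃ i < n, ρ.x .lo j = x i j) ∧ (∃ i < n, ρ.x .hi 0 = x i j) ∧
        ∀ i < k, ρ.x .lo j ≤ x i j ∧ x i j ≤ ρ.x .hi 0) hnQ ?_ (by omega) ?_ ?_ ?_)
    · rintro k ρ T' - - ⟨-, hF, -⟩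
      simp [hF.w .n (by decide), hn]
    · refine ⟨rfl, hF.setX.setX.setW, by simpa using hjr, by simp, ?_, ⟨0, hn0, ?_⟩,
        ⟨0, hn0, ?_⟩, by simp⟩
      · intro j' hj'
        simp [hjr, hj'.ne]
      · simp [hjr, hx0]
      · simp [hjr, hx0]
    · rintro k ρ T' hk hkr ⟨rfl, hFρ, hj', hL, hlo, hl, hh, hb⟩
      have hd : ρ.w .dim 0 = D := by rw [hFρ.w _ (by decide), hD]
      have hptρ : ρ.x .pt = σ.x .pt := hFρ.x _ (by decide)
      refine Run.cons (Run.setXV (by omega) ?_)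
      have hy : (XA .pt (V .i * V .dim + V .j)).val ρ = x k j := by
        simp [hkr, hd, hj', hptρ, hx]
      rw [hy]
      have hfin : ∀ {ρ₁ : State}, Frame [.i, .j] [.L, .lo, .hi, .y] σ ρ₁ → ρ₁.w .j 0 = j →
          ρ₁.w .i 0 = k → ρ₁.x .L = τ.x .L → (∀ j' < j, ρ₁.x .lo j' = τ.x .lo j') →
          ρ₁.x .y 0 = x k j → (∃ i < n, ρ₁.x .lo j = x i j) → (∃ i < n, ρ₁.x .hi 0 = x i j) →
          (∀ i < k, ρ₁.x .lo j ≤ x i j ∧ x i j ≤ ρ₁.x .hi 0) → ρ₁.x .lo j ≤ x k j →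
          Run E (block [.branch (.realLT (XV .hi) (XV .y)) (setXV .hi (XV .y)) .skip]) ρ₁ 7
            fun ρ T' => ρ.w .i 0 = k ∧ T' = 4 ∧ Frame [.i, .j] [.L, .lo, .hi, .y] σ
              (ρ.setW .i 0 (k + 1)) ∧ (ρ.setW .i 0 (k + 1)).w .j 0 = j ∧
              ρ.x .L = τ.x .L ∧ (∀ j' < j, ρ.x .lo j' = τ.x .lo j') ∧
              (∃ i < n, ρ.x .lo j = x i j) ∧ (∃ i < n, ρ.x .hi 0 = x i j) ∧
              ∀ i < k + 1, ρ.x .lo j ≤ x i j ∧ x i j ≤ ρ.x .hi 0 := by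
        intro ρ₁ f1 f2 f3 f4 f5 f6 f7 f8 f9 f10
        refine Run.cons (Run.branch (by omega) (fun h => ?_) fun h => ?_)
        · simp only [Test.holds_realLT, val_XV, f6] at h
          refine Run.setXV (by omega) (Run.nil (by omega) ⟨f3, rfl, f1.setX.setW,
            by simpa using f2, by simpa using f4, by simpa using f5, by simpa using f7,
            ⟨k, hk, by simp [f6]⟩, ?_⟩)
          intro i hi
          simp only [val_XV, State.x_setX_self, Function.update_self, f6, ne_eq, reduceCtorEq,
            not_false_eq_true, State.x_setX_of_ne]
          by_cases hik : i = k
          · subst hik; exact ⟨f10, le_rfl⟩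
          · have := f9 i (by omega)
            exact ⟨this.1, this.2.trans h.le⟩
        · simp only [Test.holds_realLT, val_XV, f6, not_lt] at h
          refine Run.skip (by omega) (Run.nil (by omega) ⟨f3, rfl, f1.setW,
            by simpa using f2, f4, f5, f7, f8, ?_⟩)
          intro i hi
          by_cases hik : i = k
          · subst hik; exact ⟨f10, h⟩
          · exact f9 i (by omega)
      refine Run.cons (Run.branch (by omega) (fun h => ?_) fun h => ?_)
      · simp only [Test.holds_realLT, val_XV, val_XA, val_V, State.x_setX_self,
          Function.update_self, State.w_setX, hj', ne_eq, reduceCtorEq, not_false_eq_true,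
          State.x_setX_of_ne] at h
        refine Run.setXA (by omega) ((hfin hFρ.setX.setX (by simpa using hj') (by simpa using hkr)
          (by simpa using hL) ?_ (by simp) ⟨k, hk, by simp [hj']⟩ (by simpa using hh) ?_
          (by simp [hj'])).mono (by omega) fun _ _ h => h)
        · intro j'' hj''
          simp [hj', hj''.ne, hlo j'' hj'']
        · intro i hi
          have := hb i hi
          simp only [val_V, State.w_setX, hj', State.x_setX_self, Function.update_self, val_XV,
            ne_eq, reduceCtorEq, not_false_eq_true, State.x_setX_of_ne]
          exact ⟨h.le.trans this.1, this.2⟩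
      · simp only [Test.holds_realLT, val_XV, val_XA, val_V, State.x_setX_self,
          Function.update_self, State.w_setX, hj', ne_eq, reduceCtorEq, not_false_eq_true,
          State.x_setX_of_ne, not_lt] at h
        exact Run.skip (by omega) ((hfin hFρ.setX (by simpa using hj') (by simpa using hkr)
          (by simpa using hL) (by simpa using hlo) (by simp) (by simpa using hl)
          (by simpa using hh) (by simpa using hb) (by simpa using h)).mono (by omega)
          fun _ _ h => h)
    · rintro ρ T' - ⟨rfl, hFρ, hj', hL, hlo, ⟨i₀, hi₀, hl⟩, ⟨i₁, hi₁, hh⟩, hb⟩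
      have hfin : ∀ L', τ.x .L 0 ≤ L' → ρ.x .hi 0 - ρ.x .lo j ≤ L' →
          (L' = τ.x .L 0 ∨ L' = ρ.x .hi 0 - ρ.x .lo j) → IsBox n (j + 1) x (ρ.x .lo) L' := by
        intro L' h1 h2 h3
        refine ⟨hB.nonneg.trans h1, ?_, ?_, ?_, ?_⟩
        · intro j' hj'
          by_cases h : j' = j
          · subst h; exact ⟨i₀, hi₀, hl⟩
          · rw [hlo j' (by omega)]; exact hB.lo_mem j' (by omega)
        · intro j' hj' i hi
          by_cases h : j' = j
          · subst h; exact (hb i hi).1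
          · rw [hlo j' (by omega)]; exact hB.lo_le j' (by omega) i hi
        · intro j' hj' i hi
          by_cases h : j' = j
          · subst h; linarith [(hb i hi).2]
          · rw [hlo j' (by omega)]; linarith [hB.le_add j' (by omega) i hi]
        · rcases h3 with h3 | h3
          · rcases hB.attained with h | ⟨j', hj', i, hi, i', hi', h⟩
            · exact .inl (h3.trans h)
            · exact .inr ⟨j', by omega, i, hi, i', hi', h3.trans h⟩
          · exact .inr ⟨j, by omega, i₁, hi₁, i₀, hi₀, by rw [h3, hh, hl]⟩
      have hL0 : ρ.x .L 0 = τ.x .L 0 := by rw [hL]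
      refine Run.cons (Run.branch (by omega) (fun h => ?_) fun h => ?_)
      · simp only [Test.holds_realLT, val_XV, RExp.val_sub, val_XA, val_V, hj', hL0] at h
        refine Run.setXV (by omega) (Run.nil (by omega) ⟨hj', rfl, hFρ.setX.setW, ?_⟩)
        simpa [hj'] using hfin _ h.le le_rfl (.inr rfl)
      · simp only [Test.holds_realLT, val_XV, RExp.val_sub, val_XA, val_V, hj', hL0,
          not_lt] at h
        refine Run.skip (by omega) (Run.nil (by omega) ⟨hj', rfl, hFρ.setW, ?_⟩)
        simpa [hL0] using hfin _ le_rfl h (.inl rfl)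
  · rintro τ T' - ⟨rfl, hF, hB⟩
    exact Run.nil le_rfl ⟨hF, hB⟩

end

section

/-! ### The selected points contain approximate farthest neighbours -/

theorem Face.exists_obj_eq (F : Face) (y : ℕ → ℕ) :
    ∀ m, (∀ k < m, y k < F.T) → ∃ c < F.T ^ m, ∀ p, F.obj m p c =
      -(F.h p) ^ 2 - ∑ k ∈ Finset.range m, ((F.x k p : ℝ) - ((F.K : ℝ) * y k - (2 * F.M : ℕ))) ^ 2
  | 0, _ => ⟨0, by simp, fun p => by simp [Face.obj]⟩
  | m + 1, hy => by
    obtain ⟨c, hc, h⟩ := F.exists_obj_eq y m fun k hk => hy k (by omega)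
    have hm := hy m (by omega)
    refine ⟨y m * F.T ^ m + c, ?_, fun p => ?_⟩
    · have := Nat.mul_le_mul_right (F.T ^ m) hm
      rw [pow_succ']
      calc y m * F.T ^ m + c < y m * F.T ^ m + F.T ^ m := by omega
        _ = (y m + 1) * F.T ^ m := by ring
        _ ≤ _ := this
    · rw [Face.obj, Nat.mul_add_mod_self_right, Nat.mod_eq_of_lt hc, add_comm (y m * _) c,
        Nat.add_mul_div_right _ _ (by omega), Nat.div_eq_of_lt hc, zero_add, h p,
        Finset.sum_range_succ]
      ring

/-- The `40 * D * K + 1` grid positions cover the interval `[-2 * M, 3 * M]`, which contains the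
intersection of a facet with all rays that start in the box, if the entry of the direction vector
for the axis is the largest one. -/
theorem exists_grid_position {D K M : ℕ} (hK : 0 < K) (hM : M = 8 * D * K * K) {z : ℝ}
    (h1 : -(2 * M) ≤ z) (h2 : z ≤ 3 * M) :
    ∃ y < 40 * D * K + 1, |(K : ℝ) * y - (2 * M : ℕ) - z| ≤ K := by
  have hK' : (0 : ℝ) < K := by exact_mod_cast hK
  have h0 : 0 ≤ (z + 2 * M) / K := div_nonneg (by linarith) hK'.le
  refine ⟨⌊(z + 2 * M) / K⌋₊, Nat.lt_succ_of_le (Nat.floor_le_of_le ?_), ?_⟩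
  · rw [div_le_iff₀ hK']
    push_cast
    have : (M : ℝ) = 8 * D * K * K := by exact_mod_cast hM
    linarith
  · have f1 := Nat.floor_le h0
    have f2 := Nat.lt_floor_add_one ((z + 2 * M) / K)
    rw [le_div_iff₀ hK'] at f1
    rw [div_lt_iff₀ hK'] at f2
    push_cast
    rw [abs_le]
    constructor <;> linarith

/-- If `b` is at least as close as `a` to a point `Y` near the ray that starts in `a` in the
direction `v`, then `b` is hardly behind `a` in this direction. The coordinate in the direction of
the axis of the face is treated separately: the distances `ha` and `hb` from the face stand for
it, and the direction vector has the entry `1` there. -/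
theorem face_bound {m : ℕ} {a b v Y : ℕ → ℝ} {ha hb κ μ : ℝ} (hμ : 0 < μ) (hha : μ ≤ ha)
    (hY : ∀ k < m, |Y k - (a k + ha * v k)| ≤ κ)
    (h : -ha ^ 2 - ∑ k ∈ Finset.range m, (a k - Y k) ^ 2 ≤
      -hb ^ 2 - ∑ k ∈ Finset.range m, (b k - Y k) ^ 2) :
    -(m * κ ^ 2 / (2 * μ)) ≤ ∑ k ∈ Finset.range m, v k * (b k - a k) + (ha - hb) := by
  have h1 : ∑ k ∈ Finset.range m, ((a k - Y k) ^ 2 - (b k - Y k) ^ 2) ≤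
      ∑ k ∈ Finset.range m, (2 * ha * (v k * (b k - a k)) + κ ^ 2) := by
    refine Finset.sum_le_sum fun k hk => ?_
    have hδ := sq_le_sq' (abs_le.1 (hY k (Finset.mem_range.1 hk))).1
      (abs_le.1 (hY k (Finset.mem_range.1 hk))).2
    -- Complete the square of `b k - a k` and the deviation of `Y k` from the ray.
    nlinarith [sq_nonneg (b k - a k - (Y k - (a k + ha * v k)))]
  rw [Finset.sum_sub_distrib, Finset.sum_add_distrib, ← Finset.mul_sum, Finset.sum_const,
    Finset.card_range, nsmul_eq_mul] at h1
  set s := ∑ k ∈ Finset.range m, v k * (b k - a k)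
  have h2 : -(m * κ ^ 2) ≤ 2 * ha * (s + (ha - hb)) := by nlinarith [sq_nonneg (ha - hb)]
  by_contra hc
  push Not at hc
  have h3 : 0 ≤ m * κ ^ 2 / (2 * μ) := by positivity
  have h4 : 2 * μ * (m * κ ^ 2 / (2 * μ)) = m * κ ^ 2 := by field_simp
  nlinarith

theorem sum_rotate (D a : ℕ) (f : ℕ → ℝ) :
    ∑ k ∈ Finset.range D, f ((a + k) % D) = ∑ k ∈ Finset.range D, f k := by
  induction a with
  | zero =>
    refine Finset.sum_congr rfl fun k hk => ?_
    rw [zero_add, Nat.mod_eq_of_lt (Finset.mem_range.1 hk)]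
  | succ a ih =>
    rw [← ih]
    have h := Finset.sum_range_succ' (fun k => f ((a + k) % D)) D
    rw [Finset.sum_range_succ] at h
    simp only [Nat.add_mod_right, add_zero, add_left_inj] at h
    rw [h]
    exact Finset.sum_congr rfl fun k _ => by rw [add_right_comm, add_assoc]

/-- Split off one coordinate. -/
theorem sum_eq_axis_add {D e ax : ℕ} (hD : D = e + 2) (hax : ax < D) (f : ℕ → ℝ) :
    ∑ j ∈ Finset.range D, f j =
      f ax + ∑ k ∈ Finset.range (e + 1), f ((ax + 1 + k) % D) := by
  rw [← sum_rotate D ax f]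
  subst hD
  rw [Finset.sum_range_succ', add_zero, Nat.mod_eq_of_lt hax, add_comm]
  congr 1
  exact Finset.sum_congr rfl fun k _ => by rw [add_comm k 1, add_assoc]

/-- The parameters of the grid are chosen such that the error is a fraction of the extent `L` of
the box. -/
structure Grid.Sized (Γ : Grid) (e : ℕ) (L : ℝ) : Prop where
  D : Γ.D = e + 2
  K : 0 < Γ.K
  M : Γ.M = 8 * Γ.D * Γ.K * Γ.K
  T : Γ.T = 40 * Γ.D * Γ.K + 1
  iw : Γ.iw = Γ.M / L
  box : IsBox Γ.n Γ.D (fun i j => Γ.pt (i * Γ.D + j)) Γ.lo L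

section
variable {Γ : Grid} {e : ℕ} {L : ℝ}

theorem Grid.Sized.coord_nonneg (h : Γ.Sized e L) {p j : ℕ} (hp : p < Γ.n) (hj : j < Γ.D) :
    0 ≤ Γ.coord p j := by
  rw [Grid.coord, h.iw]
  exact mul_nonneg (sub_nonneg.2 (h.box.lo_le j hj p hp)) (div_nonneg (by simp) h.box.nonneg)

theorem Grid.Sized.coord_le (h : Γ.Sized e L) {p j : ℕ} (hp : p < Γ.n) (hj : j < Γ.D) :
    Γ.coord p j ≤ Γ.M := by
  have hL := h.box.nonneg
  have h1 := h.box.le_add j hj p hp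
  have h2 := h.box.lo_le j hj p hp
  rw [Grid.coord, h.iw, mul_div_assoc']
  refine div_le_of_le_mul₀ hL (by simp) ?_
  rw [mul_comm]
  exact mul_le_mul_of_nonneg_left (by linarith) (by simp)

/-- For every direction `v`, scaled such that its largest entry is `±1`, and every point `p`, one
of the selected points is hardly behind `p` in this direction. -/
theorem Grid.Sized.exists_extreme (h : Γ.Sized e L) (hL : 0 < L) {S : ℕ → Prop}
    (hcov : ∀ ax < Γ.D, ∀ sg < 2, ∀ c < Γ.T ^ (e + 1), ∃ r < Γ.n, S r ∧
      ∀ p < Γ.n, (Γ.face ax sg).obj (e + 1) p c ≤ (Γ.face ax sg).obj (e + 1) r c)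
    {v : ℕ → ℝ} {ax p : ℕ} (hax : ax < Γ.D) (hp : p < Γ.n) (hv1 : v ax = 1 ∨ v ax = -1)
    (hv : ∀ j < Γ.D, |v j| ≤ 1) :
    ∃ r < Γ.n, S r ∧ -(Γ.D * (L / Γ.M)) ≤
      ∑ j ∈ Finset.range Γ.D, v j * (Γ.pt (r * Γ.D + j) - Γ.pt (p * Γ.D + j)) := by
  have hK := h.K
  have hK' : (0 : ℝ) < Γ.K := by exact_mod_cast hK
  have hDe := h.D
  have hD0 : (0 : ℝ) < Γ.D := by rw [h.D]; positivity
  have hMr : (Γ.M : ℝ) = 8 * Γ.D * Γ.K * Γ.K := by exact_mod_cast h.M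
  have hM0 : (0 : ℝ) < Γ.M := by rw [hMr]; positivity
  -- The ray leaves through the upper face if `v ax` is positive, through the lower one otherwise.
  obtain ⟨sg, hsg, hsgv⟩ : ∃ sg < 2, v ax = if sg = 0 then -1 else 1 := by
    rcases hv1 with h | h
    · exact ⟨1, by norm_num, by simp [h]⟩
    · exact ⟨0, by norm_num, by simp [h]⟩
  set F := Γ.face ax sg with hF
  have hFh : ∀ r < Γ.n, (Γ.M : ℝ) ≤ F.h r ∧ F.h r ≤ 2 * Γ.M := by
    intro r hr
    have h1 := h.coord_nonneg hr hax
    have h2 := h.coord_le hr hax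
    simp only [hF, Grid.face]
    split_ifs <;> constructor <;> linarith
  have hmod : ∀ k, (ax + 1 + k) % Γ.D < Γ.D := fun k => Nat.mod_lt _ (by omega)
  have hx : ∀ r < Γ.n, ∀ k, (F.x k r : ℝ) ≤ Γ.coord r ((ax + 1 + k) % Γ.D) ∧
      Γ.coord r ((ax + 1 + k) % Γ.D) < F.x k r + 1 := fun r hr k =>
    ⟨Nat.floor_le (h.coord_nonneg hr (hmod k)), Nat.lt_floor_add_one _⟩
  have hgrid : ∀ k, ∃ y < 40 * Γ.D * Γ.K + 1,
      |(Γ.K : ℝ) * y - (2 * Γ.M : ℕ) - (F.x k p + F.h p * v ((ax + 1 + k) % Γ.D))| ≤ Γ.K := by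
    intro k
    have hvk := abs_le.1 (hv _ (hmod k))
    have h1 := hFh p hp
    have h2 := hx p hp k
    have h3 := h.coord_le hp (hmod k)
    have h4 : (0 : ℝ) ≤ F.x k p := by simp
    refine exists_grid_position hK h.M ?_ ?_ <;> nlinarith
  choose y hyT hy using hgrid
  obtain ⟨c, hc, hobj⟩ := F.exists_obj_eq y (e + 1) fun k _ => by
    simpa [hF, Grid.face, h.T] using hyT k
  obtain ⟨r, hr, hS, hbest⟩ := hcov ax hax sg hsg c (by simpa [hF, Grid.face] using hc)
  refine ⟨r, hr, hS, ?_⟩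
  have hb := hbest p hp
  rw [← hF, hobj, hobj] at hb
  have hfb := face_bound hM0 (hFh p hp).1 (fun k _ => hy k) hb
  have hsmall : ((e + 1 : ℕ) : ℝ) * (Γ.K : ℝ) ^ 2 / (2 * Γ.M) ≤ 1 := by
    rw [div_le_one (by positivity), hMr]
    have : ((e + 1 : ℕ) : ℝ) ≤ Γ.D := by exact_mod_cast (by omega : e + 1 ≤ Γ.D)
    nlinarith [mul_nonneg hD0.le (sq_nonneg (Γ.K : ℝ)), mul_le_mul_of_nonneg_right this
      (sq_nonneg (Γ.K : ℝ))]
  have haxis : v ax * (Γ.coord r ax - Γ.coord p ax) = F.h p - F.h r := by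
    rw [hsgv]
    simp only [hF, Grid.face]
    split_ifs <;> ring
  -- Rounding changes every coordinate difference by less than `1`.
  have hround : ∑ k ∈ Finset.range (e + 1), (v ((ax + 1 + k) % Γ.D) * (F.x k r - F.x k p) - 1) ≤
      ∑ k ∈ Finset.range (e + 1), v ((ax + 1 + k) % Γ.D) *
        (Γ.coord r ((ax + 1 + k) % Γ.D) - Γ.coord p ((ax + 1 + k) % Γ.D)) := by
    refine Finset.sum_le_sum fun k _ => ?_
    have hvk := abs_le.1 (hv _ (hmod k))
    have h1 := hx p hp k
    have h2 := hx r hr k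
    have h3 : |v ((ax + 1 + k) % Γ.D) * ((Γ.coord r ((ax + 1 + k) % Γ.D) - F.x k r) -
        (Γ.coord p ((ax + 1 + k) % Γ.D) - F.x k p))| ≤ 1 := by
      rw [abs_mul]
      refine mul_le_one₀ (hv _ (hmod k)) (abs_nonneg _) ?_
      rw [abs_le]
      constructor <;> linarith
    have h4 := (abs_le.1 h3).1
    linarith
  rw [Finset.sum_sub_distrib] at hround
  simp only [Finset.sum_const, Finset.card_range, nsmul_eq_mul, mul_one] at hround
  have htotal : -(Γ.D : ℝ) ≤
      ∑ j ∈ Finset.range Γ.D, v j * (Γ.coord r j - Γ.coord p j) := by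
    rw [sum_eq_axis_add hDe hax, haxis]
    have : (Γ.D : ℝ) = ((e + 1 : ℕ) : ℝ) + 1 := by rw [hDe]; push_cast; ring
    linarith
  have hscale : ∑ j ∈ Finset.range Γ.D, v j * (Γ.coord r j - Γ.coord p j) =
      (∑ j ∈ Finset.range Γ.D, v j * (Γ.pt (r * Γ.D + j) - Γ.pt (p * Γ.D + j))) *
        (Γ.M / L) := by
    rw [Finset.sum_mul]
    refine Finset.sum_congr rfl fun j _ => ?_
    rw [Grid.coord, Grid.coord, h.iw]
    ring
  rw [hscale, ← div_le_iff₀ (by positivity)] at htotal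
  refine le_of_eq_of_le ?_ htotal
  field_simp

end

/-- The Euclidean distance of two points given by their coordinates. -/
noncomputable def eucl (D : ℕ) (a b : ℕ → ℝ) : ℝ :=
  √(∑ j ∈ Finset.range D, (a j - b j) ^ 2)

theorem abs_sub_le_eucl {D j : ℕ} (hj : j < D) (a b : ℕ → ℝ) : |a j - b j| ≤ eucl D a b :=
  Real.abs_le_sqrt (Finset.single_le_sum (f := fun j => (a j - b j) ^ 2)
    (fun _ _ => sq_nonneg _) (Finset.mem_range.2 hj))

theorem eucl_nonneg (D : ℕ) (a b : ℕ → ℝ) : 0 ≤ eucl D a b := Real.sqrt_nonneg _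

/-- The distance from any point to a farthest point is at least half of the extent of the box. -/
theorem IsBox.le_two_mul {n D : ℕ} {x : ℕ → ℕ → ℝ} {lo : ℕ → ℝ} {L R : ℝ} (h : IsBox n D x lo L)
    {q : ℕ → ℝ} (hR0 : 0 ≤ R) (hR : ∀ i < n, eucl D q (x i) ≤ R) : L ≤ 2 * R := by
  rcases h.attained with h | ⟨j, hj, i, hi, i', hi', rfl⟩
  · linarith
  · have h1 := abs_le.1 ((abs_sub_le_eucl hj q (x i)).trans (hR i hi))
    have h2 := abs_le.1 ((abs_sub_le_eucl hj q (x i')).trans (hR i' hi'))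
    linarith

/-- A point that is hardly behind a farthest point `p` of `q`, in the direction `v` from `q` to
`p`, is almost as far from `q` as `p`. -/
theorem sub_le_eucl {D : ℕ} {q p r v : ℕ → ℝ} {a η : ℝ} (ha : 0 ≤ a) (hη : 0 ≤ η)
    (hv : ∀ j < D, p j - q j = a * v j) (hv1 : 1 ≤ ∑ j ∈ Finset.range D, v j ^ 2)
    (h : -η ≤ ∑ j ∈ Finset.range D, v j * (r j - p j)) : eucl D q p - η ≤ eucl D q r := by
  set s := ∑ j ∈ Finset.range D, v j ^ 2 with hs
  have hp : eucl D q p = a * √s := by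
    rw [eucl, ← Real.sqrt_sq ha, ← Real.sqrt_mul (sq_nonneg a), hs, Finset.mul_sum]
    congr 1
    refine Finset.sum_congr rfl fun j hj => ?_
    rw [← neg_sub, neg_sq, hv j (Finset.mem_range.1 hj)]
    ring
  have hsum : ∑ j ∈ Finset.range D, v j * (r j - q j) =
      a * s + ∑ j ∈ Finset.range D, v j * (r j - p j) := by
    rw [hs, Finset.mul_sum, ← Finset.sum_add_distrib]
    refine Finset.sum_congr rfl fun j hj => ?_
    have := hv j (Finset.mem_range.1 hj)
    linear_combination v j * this
  have hcs : ∑ j ∈ Finset.range D, v j * (r j - q j) ≤ √s * eucl D q r := by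
    refine (Real.sum_mul_le_sqrt_mul_sqrt _ _ _).trans_eq ?_
    congr 2
    exact Finset.sum_congr rfl fun j _ => by ring
  have h1 : 1 ≤ √s := Real.one_le_sqrt.2 hv1
  have h2 : √s * √s = s := Real.mul_self_sqrt (by linarith)
  rw [hp]
  by_contra hc
  push Not at hc
  nlinarith

/-- The points that are selected for the grid points of all faces contain an approximate farthest
neighbour of every point `q`. -/
theorem Grid.Sized.exists_approx {Γ : Grid} {e : ℕ} {L ε : ℝ} (h : Γ.Sized e L) (hn0 : 0 < Γ.n)
    (hε0 : 0 ≤ ε) (hε1 : ε ≤ 1) (hε : 1 ≤ (Γ.K : ℝ) * Γ.K * ε) {S : ℕ → Prop}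
    (hcov : ∀ ax < Γ.D, ∀ sg < 2, ∀ c < Γ.T ^ (e + 1), ∃ r < Γ.n, S r ∧
      ∀ p < Γ.n, (Γ.face ax sg).obj (e + 1) p c ≤ (Γ.face ax sg).obj (e + 1) r c)
    (q : ℕ → ℝ) : ∃ r < Γ.n, S r ∧ ∀ p < Γ.n,
      (1 - ε) * eucl Γ.D q (fun j => Γ.pt (p * Γ.D + j)) ≤
        eucl Γ.D q fun j => Γ.pt (r * Γ.D + j) := by
  set x : ℕ → ℕ → ℝ := fun i j => Γ.pt (i * Γ.D + j) with hx
  have hD : 0 < Γ.D := by rw [h.D]; omega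
  obtain ⟨p, hp, hmax⟩ := Finset.exists_max_image (Finset.range Γ.n) (fun p => eucl Γ.D q (x p))
    ⟨0, Finset.mem_range.2 hn0⟩
  simp only [Finset.mem_range] at hp hmax
  set R := eucl Γ.D q (x p) with hR
  have hR0 : 0 ≤ R := eucl_nonneg _ _ _
  suffices H : ∃ r < Γ.n, S r ∧ (1 - ε) * R ≤ eucl Γ.D q (x r) by
    obtain ⟨r, hr, hS, h⟩ := H
    exact ⟨r, hr, hS, fun p' hp' =>
      (mul_le_mul_of_nonneg_left (hmax p' hp') (by linarith)).trans h⟩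
  -- If all points are equal, the scale factor `iw` is a division by zero, and any point will do.
  rcases h.box.nonneg.eq_or_lt with hL | hL
  · obtain ⟨r, hr, hS, -⟩ := hcov 0 hD 0 (by norm_num) 0 (by rw [h.T]; positivity)
    have heq : eucl Γ.D q (x r) = R := by
      rw [hR, eucl, eucl]
      congr 1
      refine Finset.sum_congr rfl fun j hj => ?_
      have hj := Finset.mem_range.1 hj
      have h1 := h.box.le_add j hj p hp
      have h2 := h.box.lo_le j hj p hp
      have h3 := h.box.le_add j hj r hr
      have h4 := h.box.lo_le j hj r hr
      have : x r j = x p j := by simp only [hx]; linarith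
      rw [this]
    exact ⟨r, hr, hS, by rw [heq]; nlinarith⟩
  · have hLR := h.box.le_two_mul hR0 hmax
    obtain ⟨ax, hax, haxmax⟩ := Finset.exists_max_image (Finset.range Γ.D)
      (fun j => |x p j - q j|) ⟨0, Finset.mem_range.2 hD⟩
    simp only [Finset.mem_range] at hax haxmax
    set a := |x p ax - q ax| with ha
    have ha0 : 0 < a := by
      refine (abs_nonneg _).lt_of_ne fun h0 => ?_
      have hz : R = 0 := by
        rw [hR, eucl, Real.sqrt_eq_zero (Finset.sum_nonneg fun _ _ => sq_nonneg _)]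
        refine Finset.sum_eq_zero fun j hj => ?_
        have := haxmax j (Finset.mem_range.1 hj)
        rw [← neg_sub, neg_sq, ← sq_abs, le_antisymm (this.trans_eq h0.symm) (abs_nonneg _)]
        norm_num
      linarith
    have hv : ∀ j < Γ.D, |(x p j - q j) / a| ≤ 1 := by
      intro j hj
      rw [abs_div, abs_of_pos ha0, div_le_one ha0]
      exact haxmax j hj
    have hvax : (x p ax - q ax) / a = 1 ∨ (x p ax - q ax) / a = -1 := by
      rcases abs_choice (x p ax - q ax) with hc | hc
      · left; rw [← hc]; exact div_self ha0.ne'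
      · right; rw [div_eq_iff ha0.ne', ha, hc]; ring
    obtain ⟨r, hr, hS, hext⟩ := h.exists_extreme hL hcov hax hp
      (v := fun j => (x p j - q j) / a) hvax hv
    have hK' : (0 : ℝ) < Γ.K := by exact_mod_cast h.K
    have hD0 : (0 : ℝ) < Γ.D := by exact_mod_cast hD
    have hMr : (Γ.M : ℝ) = 8 * Γ.D * Γ.K * Γ.K := by exact_mod_cast h.M
    have hη : (Γ.D : ℝ) * (L / Γ.M) = L / (8 * (Γ.K * Γ.K)) := by
      rw [hMr]; field_simp
    have hfar := sub_le_eucl (q := q) (p := x p) (r := x r) ha0.le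
      (by positivity : (0 : ℝ) ≤ Γ.D * (L / Γ.M))
      (fun j _ => by field_simp) ?_ hext
    · refine ⟨r, hr, hS, le_trans ?_ hfar⟩
      have : L / (8 * (Γ.K * Γ.K)) ≤ ε * R := by
        rw [div_le_iff₀ (by positivity)]
        nlinarith [mul_nonneg hε0 hR0, mul_le_mul_of_nonneg_right hε hR0]
      rw [hη]
      linarith
    · have := Finset.single_le_sum (f := fun j => ((x p j - q j) / a) ^ 2)
        (fun _ _ => sq_nonneg _) (Finset.mem_range.2 hax)
      refine le_trans ?_ this
      rcases hvax with h | h <;> simp only [h] <;> norm_num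

end

section

/-! ### The preprocessing program -/

variable {E : Env} [E.Full]

/-- Compute the parameters of the grids: `K` is the smallest natural number with
`1 ≤ K ^ 2 * ε`. -/
def gridSize : Program := block [
  setV .K 1,
  .loop (.realLT (toX (V .K * V .K) * XV .eps) (toX 1)) (setV .K (V .K + 1)),
  setV .M (8 * V .dim * V .K * V .K),
  setV .G (V .M + 1),
  setV .T (40 * V .dim * V .K + 1),
  setV .A (8 * V .dim * V .K + 1),
  .branch (.realLT (toX 0) (XV .L)) (setXV .iw (toX (V .M) / XV .L)) (setXV .iw (toX 0))]

theorem gridSize_run {σ : State} {D K : ℕ} (hD : σ.w .dim 0 = D) (hK0 : 0 < K)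
    (hK : ∀ k : ℕ, (k : ℝ) * k * σ.x .eps 0 < 1 ↔ k < K) (hL : 0 ≤ σ.x .L 0)
    (h1 : K ≤ E.Q) (h2 : 8 * D * K * K + 1 ≤ E.Q) (h3 : 40 * D * K + 1 ≤ E.Q) :
    Run E gridSize σ (3 * K + 12) fun τ _ => Frame [.K, .M, .G, .T, .A] [.iw] σ τ ∧
      τ.w .K 0 = K ∧ τ.w .M 0 = 8 * D * K * K ∧ τ.w .G 0 = 8 * D * K * K + 1 ∧
      τ.w .T 0 = 40 * D * K + 1 ∧ τ.w .A 0 = 8 * D * K + 1 ∧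
      τ.x .iw 0 = (8 * D * K * K : ℕ) / σ.x .L 0 := by
  have h4 : 8 * D * K + 1 ≤ E.Q := by nlinarith
  refine Run.cons (Run.setV (by simp; omega) (by omega) ?_)
  refine Run.cons (Run.loop (fun τ T' => ∃ k, 1 ≤ k ∧ k ≤ K ∧ τ.w .K 0 = k ∧
    Frame [.K, .M, .G, .T, .A] [.iw] σ τ ∧ 3 * (K - k) + 11 ≤ T') ?_
    ⟨1, le_rfl, hK0, by simp, (Frame.refl σ).setW, by omega⟩)
  rintro τ T' ⟨k, hk1, hkK, hk, hF, hT'⟩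
  have heps : τ.x .eps = σ.x .eps := hF.x _ (by decide)
  have hd : τ.w .dim 0 = D := by rw [hF.w _ (by decide), hD]
  have hL' : τ.x .L = σ.x .L := hF.x _ (by decide)
  have htest : (Test.realLT (toX (V .K * V .K) * XV .eps) (toX 1)).holds τ ↔ k < K := by
    rw [← hK]
    simp [hk, heps]
  refine ⟨by omega, fun hb => ?_, fun hb => ?_⟩
  · rw [htest] at hb
    refine Run.setV (by simp [hk]; omega) (by omega) ⟨k + 1, by omega, hb, by simp [hk],
      hF.setW, by omega⟩
  · rw [htest] at hb
    obtain rfl : k = K := by omega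
    refine Run.cons (Run.setV (by simp [hk, hd]; omega) (by omega) ?_)
    refine Run.cons (Run.setV (by simpa [hk, hd] using h2) (by omega) ?_)
    refine Run.cons (Run.setV (by simpa [hk, hd] using h3) (by omega) ?_)
    refine Run.cons (Run.setV (by simpa [hk, hd] using h4) (by omega) ?_)
    have hF' := (((hF.setW (r := .M) (i := 0) (v := 8 * D * k * k)).setW (r := .G) (i := 0)
      (v := 8 * D * k * k + 1)).setW (r := .T) (i := 0) (v := 40 * D * k + 1)).setW (r := .A)
      (i := 0) (v := 8 * D * k + 1)
    simp only [WExp.val_mul, WExp.val_ofNat, val_V, hd, hk, WExp.val_add, ne_eq, reduceCtorEq,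
      not_false_eq_true, State.w_setW_of_ne, State.w_setW_self, Function.update_self]
    refine Run.cons (Run.branch (by omega) (fun hb' => ?_) fun hb' => ?_)
    · simp only [Test.holds_realLT, val_toX, WExp.val_ofNat, val_XV, State.x_setW, hL',
        Nat.cast_zero] at hb'
      refine Run.setXV_good ⟨RExp.good_of_clean _ rfl, RExp.good_of_clean _ rfl, fun _ => ?_⟩
        (by omega) (Run.nil (by omega) ⟨hF'.setX, by simp [hk], by simp, by simp, by simp,
          by simp, by simp [hL']⟩)
      simpa [hL'] using hb'.ne'
    · simp only [Test.holds_realLT, val_toX, WExp.val_ofNat, val_XV, State.x_setW, hL',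
        Nat.cast_zero, not_lt] at hb'
      refine Run.setXV (by omega) (Run.nil (by omega) ⟨hF'.setX, by simp [hk], by simp, by simp,
        by simp, by simp, ?_⟩)
      simp [le_antisymm hb' hL]

/-- The data structure: a list of `c` of the points `x`, such that the farthest one among them
is an approximate farthest neighbour of any point. The number of the points and their
coordinates are stored in the regions `ct` and `out`, from the index `D + 1` on. -/
structure Coreset (D n : ℕ) (x : ℕ → ℕ → ℝ) (ε : ℝ) (c : ℕ) (σ : State) : Prop where
  count : σ.w .ct (D + 1) = c
  mem : ∀ t < c, ∃ p < n, ∀ j < D, σ.x .out (t * D + D + 1 + j) = x p j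
  approx : ∀ q : ℕ → ℝ, ∃ t < c, ∀ p < n,
    (1 - ε) * eucl D q (x p) ≤ eucl D q fun j => σ.x .out (t * D + D + 1 + j)

theorem eucl_congr {D : ℕ} {a b b' : ℕ → ℝ} (h : ∀ j < D, b j = b' j) :
    eucl D a b = eucl D a b' := by
  rw [eucl, eucl]
  congr 1
  exact Finset.sum_congr rfl fun j hj => by rw [h j (Finset.mem_range.1 hj)]

/-- The preprocessing program in dimension `1`, where the extreme points are the data structure. -/
def buildLine : Program := block [
  spread 1,
  box,
  setXA .out 2 (XA .lo 0),
  setXA .out 3 (XA .lo 0 + XV .L),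
  setA .ct 2 2]

theorem buildLine_run {σ : State} {n : ℕ} {ε : ℝ} (hn : σ.w .n 0 = n) (hn0 : 0 < n)
    (hnQ : n ≤ E.Q) (hε : 0 ≤ ε) :
    Run E buildLine σ (n * 14 + 36) fun τ _ =>
      Coreset 1 n (fun p j => σ.real (p * 1 + j + 1)) ε 2 τ := by
  have hQ := E.hQ
  refine Run.cons ((spread_run hn (by omega) (by omega)).call (by omega) ?_)
  rintro τ ⟨hF, hd, hpt⟩
  refine Run.cons ((box_run (by rw [hF.w _ (by decide), hn]) hd hn0 hnQ (by omega)).call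
    (by omega) ?_)
  rintro ρ ⟨-, hB⟩
  refine Run.cons (Run.setXA (by omega) ?_)
  refine Run.cons (Run.setXA (by omega) ?_)
  refine Run.cons (Run.setA (by simp; omega) (by omega) (Run.nil (by omega) ?_))
  have hx : ∀ p < n, τ.x .pt (p * 1 + 0) = σ.real (p * 1 + 0 + 1) :=
    fun p hp => hpt _ (by omega)
  obtain ⟨i, hi, hlo⟩ := hB.lo_mem 0 (by norm_num)
  obtain ⟨i', hi', hhi⟩ : ∃ i' < n, ρ.x .lo 0 + ρ.x .L 0 = τ.x .pt (i' * 1 + 0) := by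
    rcases hB.attained with h | ⟨j, hj, a, ha, b, hb, h⟩
    · exact ⟨i, hi, by rw [h, hlo, add_zero]⟩
    · obtain rfl : j = 0 := by omega
      refine ⟨a, ha, ?_⟩
      have h1 := hB.lo_le 0 hj b hb
      have h2 := hB.le_add 0 hj a ha
      linarith
  have hout0 : ∀ j, ((((ρ.setX .out 2 (ρ.x .lo 0)).setX .out 3 (ρ.x .lo 0 + ρ.x .L 0)).setW .ct 2
      2).x .out (0 * 1 + 1 + 1 + j)) = if j = 0 then ρ.x .lo 0 else if j = 1 then
      ρ.x .lo 0 + ρ.x .L 0 else ρ.x .out (2 + j) := by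
    intro j
    simp only [State.x_setW, State.x_setX_self, Function.update_apply]
    rcases j with - | - | j
    · simp
    · simp
    · simp only [show 0 * 1 + 1 + 1 + (j + 1 + 1) = 2 + (j + 1 + 1) by ring,
        show ¬ (2 + (j + 1 + 1) = 3) by omega, show ¬ (2 + (j + 1 + 1) = 2) by omega,
        show ¬ (j + 1 + 1 = 0) by omega, show ¬ (j + 1 + 1 = 1) by omega, if_false]
  have hlo1 : ∀ (σ : State) (k : ℕ), σ.x .out (1 * 1 + 1 + 1 + k) =
      σ.x .out (0 * 1 + 1 + 1 + (k + 1)) := fun σ k => by congr 1; ring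
  have hval0 : (XA .lo 0).val ρ = ρ.x .lo 0 := rfl
  have hval1 : (XA .lo 0 + XV .L).val (ρ.setX .out 2 (ρ.x .lo 0)) = ρ.x .lo 0 + ρ.x .L 0 := by
    simp [WExp.val]
  simp only [WExp.val_ofNat, hval0, hval1]
  refine ⟨by simp, ?_, ?_⟩
  · intro t ht
    obtain rfl | rfl : t = 0 ∨ t = 1 := by omega
    · refine ⟨i, hi, fun j hj => ?_⟩
      obtain rfl : j = 0 := by omega
      rw [hout0, if_pos rfl, hlo, hx i hi]
    · refine ⟨i', hi', fun j hj => ?_⟩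
      obtain rfl : j = 0 := by omega
      rw [hlo1, hout0]
      simp only [zero_add, one_ne_zero, if_false, if_true]
      rw [hhi, hx i' hi']
  · intro q
    have habs : ∀ b : ℕ → ℝ, eucl 1 q b = |q 0 - b 0| := fun b => by
      simp [eucl, Real.sqrt_sq_eq_abs]
    have hle : ∀ p < n, ρ.x .lo 0 ≤ σ.real (p * 1 + 0 + 1) ∧
        σ.real (p * 1 + 0 + 1) ≤ ρ.x .lo 0 + ρ.x .L 0 := fun p hp => by
      rw [← hx p hp]
      exact ⟨hB.lo_le 0 (by norm_num) p hp, hB.le_add 0 (by norm_num) p hp⟩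
    have hfac : ∀ a : ℝ, 0 ≤ a → (1 - ε) * a ≤ a := fun a ha => by nlinarith
    by_cases hq : q 0 ≤ ρ.x .lo 0 + ρ.x .L 0 / 2
    · refine ⟨1, by norm_num, fun p hp => ?_⟩
      refine (hfac _ (eucl_nonneg _ _ _)).trans ?_
      rw [habs, habs, hlo1, hout0]
      simp only [zero_add, one_ne_zero, if_false, if_true]
      have := hle p hp
      have h0 := hB.nonneg
      simp only [add_zero] at this
      rw [abs_sub_comm (q 0) (_ + _), abs_of_nonneg (a := _ + _ - q 0) (by linarith)]
      exact abs_le.2 ⟨by linarith, by linarith⟩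
    · refine ⟨0, by norm_num, fun p hp => ?_⟩
      refine (hfac _ (eucl_nonneg _ _ _)).trans ?_
      rw [habs, habs, hout0, if_pos rfl]
      have := hle p hp
      have h0 := hB.nonneg
      simp only [add_zero] at this
      rw [abs_of_nonneg (a := _ - ρ.x .lo 0) (by linarith)]
      exact abs_le.2 ⟨by linarith, by linarith⟩

/-- The preprocessing program in dimension at least `2`. -/
def buildSpace (D : ℕ) : Program := block [
  spread D,
  box,
  gridSize,
  faces,
  setA .ct (V .dim + 1) (V .oc)]

theorem buildSpace_run {σ : State} {e n K b : ℕ} {ε : ℝ} (hn : σ.w .n 0 = n) (hn0 : 0 < n)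
    (hε : σ.x .eps 0 = ε) (hε0 : 0 ≤ ε) (hε1 : ε ≤ 1) (hK0 : 0 < K)
    (hK : ∀ k : ℕ, (k : ℝ) * k * ε < 1 ↔ k < K) (hnb : n ≤ b) (hKb : K ≤ b)
    (hQ : 100 * (41 * (e + 2) * b) ^ (2 * e + 4) ≤ E.Q) :
    Run E (buildSpace (e + 2)) σ
      ((e + 2) * (408 * e + 800) * (n + (41 * (e + 2) * K) ^ (2 * e + 1))) fun τ _ =>
      Coreset (e + 2) n (fun p j => σ.real (p * (e + 2) + j + 1)) ε
        ((e + 2) * 2 * (40 * (e + 2) * K + 1) ^ (e + 1)) τ := by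
  -- All quantities are bounded by powers of `H`, or of `H'`, with exponents at most `2 * D`.
  set D := e + 2 with hD
  set H := 41 * D * K with hH
  set H' := 41 * D * b with hH'
  have hHH : H ≤ H' := Nat.mul_le_mul_left _ hKb
  have hH1 : 82 ≤ H := by
    calc 82 = 41 * 2 * 1 := rfl
      _ ≤ 41 * D * K := Nat.mul_le_mul (by omega) hK0
  have hpow : ∀ i, i ≤ 2 * e + 4 → H' ^ i ≤ H' ^ (2 * e + 4) := fun i hi =>
    Nat.pow_le_pow_right (by omega) hi
  set P := H' ^ (2 * e + 4) with hP
  have hP1 : H' ≤ P := by simpa using hpow 1 (by omega)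
  have hP2 : H ^ 2 ≤ P := (Nat.pow_le_pow_left hHH 2).trans (hpow 2 (by omega))
  set B := H ^ (2 * e + 1) with hB
  have hHB : H ≤ B := Nat.le_self_pow (by omega) H
  have hDK : D ≤ D * K := Nat.le_mul_of_pos_right _ hK0
  have hKD : K ≤ D * K := Nat.le_mul_of_pos_left _ (by omega)
  have hDn : n * D ≤ H' := by
    rw [mul_comm]
    calc D * n ≤ D * b := Nat.mul_le_mul_left _ hnb
      _ ≤ 41 * (D * b) := by omega
      _ = _ := by rw [hH', mul_assoc]
  have hnD : n ≤ n * D := Nat.le_mul_of_pos_right _ (by omega)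
  have hHeq : H = 41 * (D * K) := by rw [hH, mul_assoc]
  have hT : 40 * D * K + 1 ≤ H := by rw [hHeq, mul_assoc]; omega
  have hA : 8 * D * K + 1 ≤ H := by rw [hHeq, mul_assoc]; omega
  have hG : 8 * D * K * K + 1 ≤ H ^ 2 := by
    have h1 : 8 * D * K * K ≤ 8 * D * K * H := Nat.mul_le_mul_left _ (by omega)
    have h2 : (8 * D * K + 1) * H ≤ H * H := Nat.mul_le_mul_right _ hA
    rw [pow_two]
    linarith
  -- The costs of the passes, in their order.
  have hcost : (n * D * 4 + 6) + (D * (n * 10 + 18) + 7) + (3 * K + 12) +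
      (D * ((408 * e + 662) * (n + B) + 3) + 6) + 2 ≤ D * (408 * e + 800) * (n + B) := by
    have h1 : D ≤ D * (n + B) := Nat.le_mul_of_pos_right _ (by omega)
    have h2 : n + B ≤ D * (n + B) := Nat.le_mul_of_pos_left _ (by omega)
    have h3 : D * n ≤ D * (n + B) := Nat.mul_le_mul_left _ (by omega)
    have e1 : D * (408 * e + 800) * (n + B) =
      D * ((408 * e + 662) * (n + B)) + 138 * (D * (n + B)) := by ring
    have e2 : D * (n * 10 + 18) = 10 * (D * n) + 18 * D := by ring
    have e3 : n * D * 4 = 4 * (D * n) := by ring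
    rw [e1, e2, e3, mul_add D]
    omega
  refine Run.cons ((spread_run hn (by omega) (by omega)).call (by omega) ?_)
  rintro σ₁ ⟨hF₁, hd₁, hpt⟩
  have hn₁ : σ₁.w .n 0 = n := by rw [hF₁.w _ (by decide), hn]
  refine Run.cons ((box_run hn₁ hd₁ hn0 (by omega) (by omega)).call (by omega) ?_)
  rintro σ₂ ⟨hF₂, hBox⟩
  have hd₂ : σ₂.w .dim 0 = D := by rw [hF₂.w _ (by decide), hd₁]
  have heps : σ₂.x .eps 0 = ε := by rw [hF₂.x _ (by decide), hF₁.x _ (by decide), hε]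
  refine Run.cons ((gridSize_run hd₂ hK0 (by rw [heps]; exact hK) hBox.nonneg (by omega)
    (by omega) (by omega)).call (by omega) ?_)
  rintro σ₃ ⟨hF₃, k1, k2, k3, k4, k5, k6⟩
  set Γ : Grid := ⟨n, D, K, 8 * D * K * K, 40 * D * K + 1, 8 * D * K * K + 1, 8 * D * K + 1,
    σ₁.x .pt, σ₂.x .lo, (8 * D * K * K : ℕ) / σ₂.x .L 0⟩ with hΓ
  have hΓσ : Γ.InMem σ₃ := ⟨by rw [hF₃.w _ (by decide), hF₂.w _ (by decide), hn₁],
    by rw [hF₃.w _ (by decide), hd₂], k1, k2, k4, k3, k5,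
    by rw [hF₃.x _ (by decide), hF₂.x _ (by decide)], by rw [hF₃.x _ (by decide)], k6⟩
  have hSized : Γ.Sized e (σ₂.x .L 0) := ⟨rfl, hK0, rfl, rfl, rfl, hBox⟩
  have hBP : 2 * D * B ≤ P := by
    calc 2 * D * B ≤ H' * H' ^ (2 * e + 1) :=
          Nat.mul_le_mul (by omega) (Nat.pow_le_pow_left hHH _)
      _ = H' ^ (2 * e + 2) := by rw [← pow_succ']
      _ ≤ P := hpow _ (by omega)
  have hBP' : B ≤ P := (Nat.le_mul_of_pos_left _ (by omega)).trans hBP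
  have hGA : (8 * D * K * K + 1) ^ e * (8 * D * K + 1) ≤ B := by
    calc _ ≤ (H ^ 2) ^ e * H := Nat.mul_le_mul (Nat.pow_le_pow_left hG _) hA
      _ = B := by rw [← pow_mul, ← pow_succ]
  have hTG : ∀ k i j, k + 2 * i + j ≤ 2 * e + 1 →
      (40 * D * K + 1) ^ k * (8 * D * K * K + 1) ^ i * H ^ j ≤ B := by
    intro k i j h
    calc _ ≤ H ^ k * (H ^ 2) ^ i * H ^ j := Nat.mul_le_mul_right _
          (Nat.mul_le_mul (Nat.pow_le_pow_left hT _) (Nat.pow_le_pow_left hG _))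
      _ = H ^ (k + 2 * i + j) := by rw [← pow_mul, ← pow_add, ← pow_add]
      _ ≤ B := Nat.pow_le_pow_right (by omega) h
  have hValid : Γ.Valid E e := by
    refine ⟨by simp only [hΓ]; omega, rfl, hK0, by simp [hΓ], rfl, ?_,
      fun p hp j hj => hSized.coord_nonneg hp hj, fun p hp j hj => hSized.coord_le hp hj,
      by simp only [hΓ]; omega, by simp only [hΓ]; omega, by simp only [hΓ]; omega,
      by simp only [hΓ]; omega, ?_⟩
    · simp only [hΓ]
      rw [Nat.mul_div_cancel _ hK0]
      omega
    · simp only [hΓ]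
      omega
  have hBound : Γ.Bound e B := by
    refine ⟨by simp only [hΓ]; omega, hGA, fun k hk => ?_, fun k hk1 hk => ?_⟩
    · have h1 := hTG k (e - k) 1 (by omega)
      rw [pow_one] at h1
      exact (Nat.mul_le_mul_left _ hT).trans h1
    · exact (Nat.mul_le_mul_left _ hG).trans (hTG k (e - k) 2 (by omega))
  have hfaces := faces_run hValid hBound hn0 (by simp only [hΓ]; omega) hΓσ
  change Run E faces σ₃ (D * ((408 * e + 662) * (n + B) + 3) + 6) _ at hfaces
  refine Run.cons (hfaces.call (by omega) ?_)
  rintro σ₄ ⟨hF₄, hoc, hsel, hcov⟩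
  have hd₄ : σ₄.w .dim 0 = D := by rw [hF₄.w _ (by decide), hF₃.w _ (by decide), hd₂]
  have hocB : D * 2 * (40 * D * K + 1) ^ (e + 1) ≤ P := by
    refine le_trans ?_ hBP
    rw [mul_comm D 2]
    refine Nat.mul_le_mul_left _ ?_
    have := hTG (e + 1) 0 0 (by omega)
    simpa using this
  refine Run.cons (Run.setA (by simp only [val_V, hoc, hΓ]; omega) (by omega)
    (Run.nil (by omega) ?_))
  have hx : ∀ p < n, ∀ j < D, σ₁.x .pt (p * D + j) = σ.real (p * D + j + 1) := by
    intro p hp j hj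
    refine hpt _ ?_
    calc p * D + j < p * D + D := by omega
      _ = (p + 1) * D := by ring
      _ ≤ n * D := Nat.mul_le_mul_right _ hp
  refine ⟨by simp [hd₄, hoc, hΓ], ?_, ?_⟩
  · intro t ht
    obtain ⟨p, hp, h⟩ := hsel t ht
    exact ⟨p, hp, fun j hj => (h j hj).trans (hx p hp j hj)⟩
  · intro q
    have hKε : 1 ≤ (K : ℝ) * K * ε := not_lt.1 fun h => lt_irrefl _ ((hK K).1 h)
    obtain ⟨r, hr, ⟨t, ht, hS⟩, h⟩ := hSized.exists_approx hn0 hε0 hε1 hKε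
      (S := fun r => ∃ t < D * 2 * (40 * D * K + 1) ^ (e + 1), Γ.Selected σ₄ t r) (by
        intro ax hax sg hsg c hc
        obtain ⟨t, ht, r, hS, h⟩ := hcov ax hax sg hsg c hc
        exact ⟨r, hS.1, ⟨t, ht, hS⟩, h⟩) q
    refine ⟨t, ht, fun p hp => ?_⟩
    have h1 := h p hp
    rw [eucl_congr (b := fun j => Γ.pt (p * Γ.D + j)) fun j hj => hx p hp j hj] at h1
    refine h1.trans_eq (eucl_congr fun j hj => ?_)
    exact (hS.2 j hj).symm

/-- The preprocessing program. -/
def build (D : ℕ) : Program := if D = 1 then buildLine else buildSpace D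

theorem build_run {σ : State} {D n K b : ℕ} {ε : ℝ} (hD : 1 ≤ D) (hn : σ.w .n 0 = n)
    (hn0 : 0 < n) (hε : σ.x .eps 0 = ε) (hε0 : 0 ≤ ε) (hε1 : ε ≤ 1) (hK0 : 0 < K)
    (hK : ∀ k : ℕ, (k : ℝ) * k * ε < 1 ↔ k < K) (hnb : n ≤ b) (hKb : K ≤ b)
    (hQ : 100 * (41 * D * b) ^ (2 * D) ≤ E.Q) :
    Run E (build D) σ (D * (408 * D + 800) * (n + (41 * D * K) ^ (2 * D - 3))) fun τ _ =>
      Coreset D n (fun p j => σ.real (p * D + j + 1)) ε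
        (D * 2 * (40 * D * K + 1) ^ (D - 1)) τ := by
  rw [build]
  split_ifs with h1
  · subst h1
    refine (buildLine_run (ε := ε) hn hn0 ?_ hε0).mono (by norm_num; omega) fun τ _ h => by
      simpa using h
    have : b ≤ (41 * 1 * b) ^ (2 * 1) :=
      (by omega : b ≤ 41 * 1 * b).trans (Nat.le_self_pow (by norm_num) _)
    omega
  · obtain ⟨e, rfl⟩ : ∃ e, D = e + 2 := ⟨D - 2, by omega⟩
    have h2 : 2 * (e + 2) - 3 = 2 * e + 1 := by omega
    rw [h2]
    refine (buildSpace_run hn hn0 hε hε0 hε1 hK0 hK hnb hKb (by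
      rwa [mul_add 2 e 2] at hQ)).mono ?_ fun _ _ h => h
    gcongr
    omega

end

section

/-! ### The query program -/

section good
variable {E : Env} {σ : State}

theorem good_V (r : WReg) : (V r).Good E σ ↔ E.InMem r.ctorIdx :=
  ⟨fun h => h.2, Env.good_V r⟩

theorem good_lit (n : ℕ) : (WExp.lit n).Good E σ ↔ n ≤ E.Q := Iff.rfl

theorem good_one : (1 : WExp).Good E σ ↔ True := iff_true_intro Env.good_one

theorem good_zero : (0 : WExp).Good E σ ↔ True := iff_true_intro (Nat.zero_le E.Q)

theorem good_wadd (a b : WExp) : (a + b).Good E σ ↔ a.Good E σ ∧ b.Good E σ :=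
  ⟨fun h => ⟨h.1, h.2.1⟩, fun h => ⟨h.1, h.2, by simp [WordOp.partial?]⟩⟩

theorem good_wmul (a b : WExp) : (a * b).Good E σ ↔ a.Good E σ ∧ b.Good E σ :=
  ⟨fun h => ⟨h.1, h.2.1⟩, fun h => ⟨h.1, h.2, by simp [WordOp.partial?]⟩⟩

theorem good_cell {c : ℕ} (hc : c < 64) (i : WExp) : (cell c i).Good E σ ↔ i.Good E σ := by
  have := E.hQ
  refine ⟨fun h => h.1.2.1, fun h => ⟨⟨?_, h, by simp [WordOp.partial?]⟩, ?_,
    by simp [WordOp.partial?]⟩⟩ <;> simp only [WExp.Good] <;> omega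

theorem good_A (r : WReg) (i : WExp) :
    (A r i).Good E σ ↔ i.Good E σ ∧ E.InMem (64 * i.val σ + r.ctorIdx) := by
  rw [A, WExp.Good, good_cell r.ctorIdx_lt, val_cell]

theorem good_XA (r : XReg) (i : WExp) :
    (XA r i).Good E σ ↔ i.Good E σ ∧ E.InMem (64 * i.val σ + r.ctorIdx) := by
  rw [XA, RExp.Good, good_cell r.ctorIdx_lt, val_cell]

theorem good_toX (i : WExp) : (toX i).Good E σ ↔ i.Good E σ := Iff.rfl

theorem good_read (i : WExp) :
    (RExp.read i).Good E σ ↔ i.Good E σ ∧ E.InMem (i.val σ) := Iff.rfl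

theorem good_xadd (a b : RExp) : (a + b).Good E σ ↔ a.Good E σ ∧ b.Good E σ :=
  ⟨fun h => ⟨h.1, h.2.1⟩, fun h => ⟨h.1, h.2, by simp [RealOp.partial?]⟩⟩

theorem good_xsub (a b : RExp) : (a - b).Good E σ ↔ a.Good E σ ∧ b.Good E σ :=
  ⟨fun h => ⟨h.1, h.2.1⟩, fun h => ⟨h.1, h.2, by simp [RealOp.partial?]⟩⟩

theorem good_xmul (a b : RExp) : (a * b).Good E σ ↔ a.Good E σ ∧ b.Good E σ :=
  ⟨fun h => ⟨h.1, h.2.1⟩, fun h => ⟨h.1, h.2, by simp [RealOp.partial?]⟩⟩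

theorem _root_.RealRAM.Run.setXA_inMem {T : ℕ} {post : State → ℕ → Prop} {r : XReg} {n : ℕ}
    {e : RExp} (hn : n ≤ E.Q) (hm : E.InMem (64 * n + r.ctorIdx)) (hg : e.Good E σ) (hT : 1 ≤ T)
    (hp : post (σ.setX r n (e.val σ)) (T - 1)) (hs : e.short = true := by rfl) :
    Run E (setXA r (.lit n) e) σ T post :=
  Run.setReal_good ((good_cell r.ctorIdx_lt _).2 hn) hm rfl hg hs hT hp

end good

/-- Scan the data structure for the point that is farthest from the query point. The real
variables of the program are the cells with index `D` of their regions, as the query point is in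
the cells `0, …, D - 1` of the memory. -/
def scan (D : ℕ) : Program := block [
  setV .dim (.lit D),
  setV .cn (A .ct (V .dim + 1)),
  setV .it 0,
  setXA .hi (.lit D) (toX 0),
  forUp .i (V .cn) <| block [
    setXA .L (.lit D) (toX 0),
    forUp .j (V .dim) (block [
      setXA .y (.lit D) (.read (V .j) - XA .out (V .i * V .dim + V .dim + 1 + V .j)),
      setXA .L (.lit D) (XA .L (.lit D) + XA .y (.lit D) * XA .y (.lit D))]),
    .branch (.realLT (XA .hi (.lit D)) (XA .L (.lit D)))
      (block [setXA .hi (.lit D) (XA .L (.lit D)), setV .it (V .i)]) .skip],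
  forUp .j (V .dim) (.setReal (V .j) (XA .out (V .it * V .dim + V .dim + 1 + V .j)))]

/-- The stored data and the first `J` coordinates of the query point are still in place, and so
are the dimension and the number of stored points. -/
structure ScanFrame (D J c : ℕ) (σ τ : State) : Prop where
  word : ∀ a, 64 * (D + 1) ≤ a → τ.word a = σ.word a
  real : ∀ a, 64 * (D + 1) ≤ a → τ.real a = σ.real a
  q : ∀ j < J, τ.real j = σ.real j
  dim : τ.w .dim 0 = D
  cn : τ.w .cn 0 = c

namespace ScanFrame
variable {D J c : ℕ} {σ τ : State}

theorem setW (h : ScanFrame D J c σ τ) {r : WReg} {v : ℕ} (h1 : r ≠ .dim := by decide)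
    (h2 : r ≠ .cn := by decide) : ScanFrame D J c σ (τ.setW r 0 v) := by
  refine ⟨fun a ha => ?_, h.real, h.q, by rw [State.w_setW_of_ne h1.symm, h.dim],
    by rw [State.w_setW_of_ne h2.symm, h.cn]⟩
  have := r.ctorIdx_lt
  rw [← h.word a ha]
  exact Function.update_of_ne (by omega) _ _

theorem setX (h : ScanFrame D J c σ τ) {r : XReg} {v : ℝ} (hJ : J ≤ D) :
    ScanFrame D J c σ (τ.setX r D v) := by
  have := r.ctorIdx_lt
  refine ⟨h.word, fun a ha => ?_, fun j hj => ?_, h.dim, h.cn⟩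
  · rw [← h.real a ha]
    exact Function.update_of_ne (by omega) _ _
  · rw [← h.q j hj]
    exact Function.update_of_ne (by omega) _ _

theorem setReal (h : ScanFrame D J c σ τ) {j : ℕ} {v : ℝ} (hj : j < D) :
    ScanFrame D 0 c σ (τ.setReal j v) := by
  refine ⟨h.word, fun a ha => ?_, fun j hj => by omega, h.dim, h.cn⟩
  rw [← h.real a ha]
  exact Function.update_of_ne (by omega) _ _

theorem out (h : ScanFrame D J c σ τ) (i : ℕ) : τ.x .out (D + 1 + i) = σ.x .out (D + 1 + i) :=
  h.real _ (by omega)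

end ScanFrame

theorem scan_run {E : Env} {σ : State} {D c : ℕ} (hD : 0 < D) (hc : 0 < c) (hDQ : D ≤ E.Q)
    (hcQ : c ≤ E.Q) (hct : σ.w .ct (D + 1) = c) (hm : E.m = 64 * (c * D + D + 1)) :
    Run E (scan D) σ (c * (10 * D + 40)) fun τ _ =>
      (∀ a, 64 * (D + 1) ≤ a → τ.word a = σ.word a ∧ τ.real a = σ.real a) ∧
      ∃ t < c, (∀ j < D, τ.real j = σ.x .out (t * D + D + 1 + j)) ∧
        ∀ t' < c, eucl D σ.real (fun j => σ.x .out (t' * D + D + 1 + j)) ≤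
          eucl D σ.real fun j => σ.x .out (t * D + D + 1 + j) := by
  set d : ℕ → ℕ → ℝ := fun t J =>
    ∑ j ∈ Finset.range J, (σ.real j - σ.x .out (t * D + D + 1 + j)) ^ 2 with hd
  have hcD : D ≤ c * D := Nat.le_mul_of_pos_left _ hc
  have hW : ∀ r : WReg, E.InMem r.ctorIdx := fun r => .inr (by have := r.ctorIdx_lt; omega)
  have hX : ∀ r : XReg, E.InMem (64 * D + r.ctorIdx) := fun r => .inr (by
    have := r.ctorIdx_lt; omega)
  have hout : ∀ t < c, ∀ j < D, E.InMem (64 * (t * D + D + 1 + j) + XReg.out.ctorIdx) := by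
    intro t ht j hj
    have h1 : (t + 1) * D ≤ c * D := Nat.mul_le_mul_right _ ht
    have h2 : XReg.out.ctorIdx < 64 := XReg.ctorIdx_lt _
    rw [add_mul, one_mul] at h1
    exact .inr (by omega)
  have hct' : E.InMem (64 * (D + 1) + WReg.ct.ctorIdx) := .inr (by
    have : WReg.ct.ctorIdx < 64 := WReg.ctorIdx_lt _
    omega)
  have hq : ∀ j < D, E.InMem j := fun j hj => .inr (by omega)
  have hcost : c * (10 * D + 40) = c * (6 * D + 15) + c * (4 * D) + 25 * c := by ring
  have hcost' : D * 4 ≤ c * (4 * D) := by nlinarith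
  refine Run.cons (Run.setV_inMem (hW _) hDQ hDQ (by omega) ?_)
  refine Run.cons (Run.setV_inMem (hW _) (by
    simp only [good_A, good_wadd, good_V, good_one, hW]
    simpa using hct') (by simpa [hct] using hcQ) (by omega) ?_)
  refine Run.cons (Run.setV_inMem (hW _) (good_zero.2 trivial) (by simp) (by omega) ?_)
  refine Run.cons (Run.setXA_inMem hDQ (hX _) ((good_toX _).2 (good_zero.2 trivial))
    (by omega) ?_)
  have h0 : ScanFrame D D c σ ((((σ.setW .dim 0 D).setW .cn 0 c).setW .it 0 0).setX .hi D 0) := by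
    have h : ScanFrame D D c σ ((σ.setW .dim 0 D).setW .cn 0 c) := by
      refine ⟨fun a ha => ?_, fun a ha => rfl, fun j hj => rfl, by simp, by simp⟩
      have h1 := WReg.dim.ctorIdx_lt
      have h2 := WReg.cn.ctorIdx_lt
      simp only [State.setW, State.setWord]
      rw [Function.update_of_ne (by omega), Function.update_of_ne (by omega)]
    exact h.setW.setX le_rfl
  simp only [WExp.val_lit, val_A, WExp.val_add, val_V, State.w_setW_self, Function.update_self,
    WExp.val_ofNat, ne_eq, reduceCtorEq, not_false_eq_true, State.w_setW_of_ne, hct, val_toX,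
    Nat.cast_zero]
  refine Run.cons (Run.forUp_good (N := c) (b := 6 * D + 12) (T₀ := 4 * D + 8)
    (fun t τ T' => 4 * D + 8 ≤ T' ∧ ScanFrame D D c σ τ ∧ τ.w .it 0 < c ∧
      τ.x .hi D ≤ d (τ.w .it 0) D ∧ ∀ t' < t, d t' D ≤ τ.x .hi D)
    (hW _) hcQ (fun τ => (good_V _).2 (hW _)) ?_ (by
      have : 6 * D + 12 + 3 = 6 * D + 15 := rfl
      rw [this]; omega) ?_ ?_ ?_)
  · rintro t τ T' - - ⟨-, hF, -⟩
    simp [hF.cn]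
  · refine ⟨le_rfl, h0.setW, by simpa using hc, ?_, by simp⟩
    simpa using Finset.sum_nonneg fun _ _ => sq_nonneg _
  · rintro t τ T' ht htr ⟨hT', hF, hit, hbest, hmax⟩
    refine Run.cons (Run.setXA_inMem hDQ (hX _) ((good_toX _).2 (good_zero.2 trivial))
      (by omega) ?_)
    refine Run.cons (Run.forUp_good (N := D) (b := 3) (T₀ := 4 * D + 13)
      (fun J ρ T' => T' = 4 * D + 13 ∧ ScanFrame D D c σ ρ ∧ ρ.w .i 0 = t ∧ ρ.w .it = τ.w .it ∧
        ρ.x .hi = τ.x .hi ∧ ρ.x .L D = d t J)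
      (hW _) hDQ (fun τ => (good_V _).2 (hW _)) ?_ (by omega) ?_ ?_ ?_)
    · rintro J ρ T' - - ⟨-, hF, -⟩
      simp [hF.dim]
    · exact ⟨rfl, (hF.setX le_rfl).setW, by simpa using htr, by simp, by simp, by simp [hd]⟩
    · rintro J ρ T' hJ hJr ⟨rfl, hFρ, htρ, hitρ, hhi, hL⟩
      refine Run.cons (Run.setXA_inMem hDQ (hX _) ?_ (by omega) ?_)
      · simp only [good_xsub, good_read, good_XA, good_wadd, good_wmul, good_V, good_one, hW]
        simpa [hJr, htρ, hFρ.dim, hq J hJ] using hout t ht J hJ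
      have hval : (RExp.read (V .j) - XA .out (V .i * V .dim + V .dim + 1 + V .j)).val ρ =
          σ.real J - σ.x .out (t * D + D + 1 + J) := by
        have h1 := hFρ.out (t * D + J)
        rw [show D + 1 + (t * D + J) = t * D + D + 1 + J by ring] at h1
        simp [RExp.val, hJr, htρ, hFρ.dim, hFρ.q J hJ, h1]
      rw [hval]
      refine Run.cons (Run.setXA_inMem hDQ (hX _) ?_ (by omega) ?_)
      · simp only [good_xadd, good_xmul, good_XA, good_lit, WExp.val_lit, hX, hDQ, and_self]
      refine Run.nil (by omega) ⟨by simpa using hJr, rfl,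
        ((hFρ.setX le_rfl).setX le_rfl).setW, by simpa using htρ, by simpa using hitρ,
        by simpa using hhi, ?_⟩
      simp only [RExp.val_add, val_XA, WExp.val_lit, RExp.val_mul, State.x_setX_self,
        Function.update_self, ne_eq, reduceCtorEq, not_false_eq_true, State.x_setX_of_ne,
        State.x_setW, hL]
      rw [hd]
      simp only
      rw [Finset.sum_range_succ]
      ring
    · rintro ρ T' - ⟨rfl, hFρ, htρ, hitρ, hhi, hL⟩
      refine Run.cons (Run.branch_good ?_ rfl (by omega) (fun hb => ?_) fun hb => ?_)
      · simp only [Test.Good, good_XA, good_lit, WExp.val_lit, hX, hDQ, and_self]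
      · simp only [Test.holds_realLT, val_XA, WExp.val_lit, hhi, hL] at hb
        refine Run.cons (Run.setXA_inMem hDQ (hX _) ?_ (by omega) ?_)
        · simp only [good_XA, good_lit, WExp.val_lit, hX, hDQ, and_self]
        refine Run.cons (Run.setV_inMem (hW _) ((good_V _).2 (hW _)) (by simp [htρ]; omega)
          (by omega) ?_)
        refine Run.nil (by omega) (Run.nil (by omega) ⟨by simpa using htρ, by omega,
          ((hFρ.setX le_rfl).setW).setW, by simpa [htρ] using ht, ?_, ?_⟩)
        · simp [htρ, hL]
        · intro t' ht'
          have h1 : ((((ρ.setX .hi D ((XA .L (.lit D)).val ρ)).setW .it 0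
            ((V .i).val (ρ.setX .hi D ((XA .L (.lit D)).val ρ)))).setW .i 0 (t + 1)).x .hi D) =
            d t D := by simp [hL]
          refine le_of_le_of_eq ?_ h1.symm
          by_cases h : t' = t
          · rw [h]
          · exact (hmax t' (by omega)).trans hb.le
      · simp only [Test.holds_realLT, val_XA, WExp.val_lit, hhi, hL, not_lt] at hb
        refine Run.skip (by omega) (Run.nil (by omega) ⟨htρ, by omega, hFρ.setW,
          by simpa [hitρ] using hit, by simpa [hitρ, hhi] using hbest, ?_⟩)
        intro t' ht'
        simp only [State.x_setW, hhi]
        by_cases h : t' = t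
        · rw [h]; exact hb
        · exact hmax t' (by omega)
  · rintro τ T' - ⟨hT', hF, hit, hbest, hmax⟩
    set t := τ.w .it 0 with ht
    refine Run.cons (Run.forUp_good (N := D) (b := 1) (T₀ := 1)
      (fun J ρ T' => T' = 1 ∧ ScanFrame D 0 c σ ρ ∧ ρ.w .it 0 = t ∧
        ∀ j < J, ρ.real j = σ.x .out (t * D + D + 1 + j))
      (hW _) hDQ (fun τ => (good_V _).2 (hW _)) ?_ (by omega) ?_ ?_ ?_)
    · rintro J ρ T' - - ⟨-, hF, -⟩
      simp [hF.dim]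
    · exact ⟨rfl, ScanFrame.setW ⟨hF.word, hF.real, fun j hj => by omega, hF.dim, hF.cn⟩,
        by simpa using ht.symm, fun j hj => by omega⟩
    · rintro J ρ T' hJ hJr ⟨rfl, hFρ, htρ, hJs⟩
      have hJv : (V .j).val ρ = J := by simp [hJr]
      have hval : (XA .out (V .it * V .dim + V .dim + 1 + V .j)).val ρ =
          σ.x .out (t * D + D + 1 + J) := by
        have h1 := hFρ.out (t * D + J)
        rw [show D + 1 + (t * D + J) = t * D + D + 1 + J by ring] at h1
        simp [hJr, htρ, hFρ.dim, h1]
      refine Run.setReal_good ((good_V _).2 (hW _)) (by rw [hJv]; exact hq J hJ) rfl ?_ rfl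
        (by omega) ?_
      · simp only [good_XA, good_wadd, good_wmul, good_V, good_one, hW]
        simpa [hJr, htρ, hFρ.dim] using hout t hit J hJ
      rw [hval, hJv]
      refine ⟨hJr, by omega, (hFρ.setReal hJ).setW, htρ, fun j hj => ?_⟩
      change Function.update ρ.real J _ j = _
      by_cases hjJ : j = J
      · rw [hjJ, Function.update_self]
      · rw [Function.update_of_ne hjJ, hJs j (by omega)]
    · rintro ρ T' - ⟨rfl, hFρ, htρ, hJs⟩
      refine Run.nil le_rfl ⟨fun a ha => ⟨hFρ.word a ha, hFρ.real a ha⟩, t, hit, hJs,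
        fun t' ht' => Real.sqrt_le_sqrt ((hmax t' ht').trans hbest)⟩

/-- Set all working cells of the word memory to `0`. -/
def clear (k : ℕ) : Program := block ((List.range k).map fun a => .setWord (.lit a) (.lit 0))

theorem exec_clear {M : Machine} {k : ℕ} (hW : k ≤ M.wordBound) (hm : k ≤ M.memSize)
    (h0 : 0 < M.wordBound) (σ : State) :
    Exec M (clear k) σ (k * 3 + 1) ⟨fun a => if a < k then 0 else σ.word a, σ.real⟩ := by
  have key : ∀ (l : List ℕ), (∀ a ∈ l, a < k) → ∀ σ : State,
      Exec M (block (l.map fun a => .setWord (.lit a) (.lit 0))) σ (l.length * 3 + 1)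
        ⟨fun a => if a ∈ l then 0 else σ.word a, σ.real⟩ := by
    intro l
    induction l with
    | nil => intro _ σ; simpa [block] using Exec.skip (M := M) σ
    | cons b l ih =>
      intro hl σ
      have hb : b < k := hl b (by simp)
      have h1 : Exec M (.setWord (.lit b) (.lit 0)) σ 3 (σ.setWord b 0) :=
        Exec.setWord (M := M) (addr := .lit b) (e := .lit 0) (i := b) (v := 0)
          (by simp [WExp.eval, Machine.fit]; omega) (by omega)
          (by simp [WExp.eval, Machine.fit]; omega)
      have h2 := ih (fun a ha => hl a (by simp [ha])) (σ.setWord b 0)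
      have h3 := Exec.seq h1 h2
      have e1 : 3 + (l.length * 3 + 1) = (b :: l).length * 3 + 1 := by
        rw [List.length_cons]; ring
      rw [e1] at h3
      convert h3 using 2
      · rfl
      · funext a
        simp only [State.setWord, List.mem_cons, Function.update_apply]
        by_cases h : a = b <;> simp [h]
      · rfl
  have h := key (List.range k) (fun a ha => List.mem_range.1 ha) σ
  rw [clear]
  simpa using h

/-- The two states agree on a memory of size `m`. -/
def Agree (m : ℕ) (σ τ : State) : Prop := ∀ a < m, σ.word a = τ.word a ∧ σ.real a = τ.real a

namespace Agree
variable {M : Machine} {σ τ : State}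

theorem wexp (h : Agree M.memSize σ τ) : ∀ e : WExp, e.eval M σ = e.eval M τ
  | .lit _ => rfl
  | .read a => by
    rw [WExp.eval, WExp.eval, h.wexp a]
    congr 1
    funext i
    split_ifs with hi
    · rw [(h i hi).1]
    · rfl
  | .op o a b => by rw [WExp.eval, WExp.eval, h.wexp a, h.wexp b]

theorem rexp (h : Agree M.memSize σ τ) : ∀ e : RExp, e.eval M σ = e.eval M τ
  | .read a => by
    rw [RExp.eval, RExp.eval, h.wexp a]
    congr 1
    funext i
    split_ifs with hi
    · rw [(h i hi).2]
    · rfl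
  | .ofWord a => by rw [RExp.eval, RExp.eval, h.wexp a]
  | .op o a b => by rw [RExp.eval, RExp.eval, h.rexp a, h.rexp b]

theorem test (h : Agree M.memSize σ τ) (b : Test) : b.eval M σ = b.eval M τ := by
  cases b <;> simp only [Test.eval, h.wexp, h.rexp]

theorem setWord (h : Agree M.memSize σ τ) (i v : ℕ) :
    Agree M.memSize (σ.setWord i v) (τ.setWord i v) := by
  intro a ha
  simp only [State.setWord, Function.update_apply, (h a ha).1, (h a ha).2, and_self]

theorem setReal (h : Agree M.memSize σ τ) (i : ℕ) (v : ℝ) :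
    Agree M.memSize (σ.setReal i v) (τ.setReal i v) := by
  intro a ha
  simp only [State.setReal, Function.update_apply, (h a ha).1, (h a ha).2, and_self]

/-- A computation does not depend on cells that are not in memory. -/
theorem exec {c : Program} {t : ℕ} {ρ : State} (he : Exec M c σ t ρ) :
    ∀ {τ}, Agree M.memSize σ τ → ∃ ρ', Exec M c τ t ρ' ∧ Agree M.memSize ρ ρ' := by
  induction he with
  | skip σ => exact fun h => ⟨_, .skip _, h⟩
  | setWord hi hM hv =>
    exact fun h => ⟨_, .setWord (by rwa [← h.wexp]) hM (by rwa [← h.wexp]), h.setWord _ _⟩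
  | setReal hi hM hv =>
    exact fun h => ⟨_, .setReal (by rwa [← h.wexp]) hM (by rwa [← h.rexp]), h.setReal _ _⟩
  | setFloor hi hM hv h0 hW =>
    exact fun h => ⟨_, .setFloor (by rwa [← h.wexp]) hM (by rwa [← h.rexp]) h0 hW,
      h.setWord _ _⟩
  | seq _ _ ih₁ ih₂ =>
    intro τ h
    obtain ⟨ρ₁, h1, h2⟩ := ih₁ h
    obtain ⟨ρ₂, h3, h4⟩ := ih₂ h2
    exact ⟨ρ₂, .seq h1 h3, h4⟩
  | branchTrue hb _ ih =>
    intro τ h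
    obtain ⟨ρ₁, h1, h2⟩ := ih h
    exact ⟨ρ₁, .branchTrue (by rwa [← h.test]) h1, h2⟩
  | branchFalse hb _ ih =>
    intro τ h
    obtain ⟨ρ₁, h1, h2⟩ := ih h
    exact ⟨ρ₁, .branchFalse (by rwa [← h.test]) h1, h2⟩
  | loopTrue hb _ _ ih₁ ih₂ =>
    intro τ h
    obtain ⟨ρ₁, h1, h2⟩ := ih₁ h
    obtain ⟨ρ₂, h3, h4⟩ := ih₂ h2
    exact ⟨ρ₂, .loopTrue (by rwa [← h.test]) h1 h3, h4⟩
  | loopFalse hb => exact fun h => ⟨_, .loopFalse (by rwa [← h.test]), h⟩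

end Agree

/-- The query program. -/
def query (D : ℕ) : Program := .seq (clear (64 * (D + 1))) (scan D)

/-- The query program answers a query, whatever the contents of its working cells. -/
theorem query_exec {Q W D n c : ℕ} {x : ℕ → ℕ → ℝ} {ε : ℝ} {τ σ : State} (hQ : 100 ≤ Q)
    (hW : Q ^ 40 < W) (hD : 0 < D) (hDQ : D ≤ Q) (hcQ : c ≤ Q) (hτ : ∀ a, τ.word a ≤ Q)
    (hτc : Coreset D n x ε c τ)
    (hσ : SameStructure (64 * (D + 1)) (64 * (c * D + D + 1)) σ τ) :
    ∃ t' σ', Exec ⟨W, 64 * (c * D + D + 1)⟩ (query D) σ t' σ' ∧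
      t' ≤ 64 * (D + 1) * 3 + 1 + 256 * (c * (10 * D + 40)) ∧
      SameStructure (64 * (D + 1)) (64 * (c * D + D + 1)) σ' τ ∧
      ∃ r < n, (∀ j < D, σ'.real j = x r j) ∧
        ∀ p < n, (1 - ε) * eucl D σ.real (x p) ≤ eucl D σ.real (x r) := by
  set s := 64 * (c * D + D + 1) with hs
  obtain ⟨t₀, ht₀, -⟩ := hτc.approx 0
  have hc : 0 < c := by omega
  have hcD : D ≤ c * D := Nat.le_mul_of_pos_left _ hc
  have hDW : 64 * (D + 1) ≤ W := by
    have h2 : Q ^ 2 ≤ Q ^ 40 := Nat.pow_le_pow_right (by omega) (by norm_num)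
    nlinarith
  -- Cells outside the memory do not matter, so that all words may be assumed to be small.
  set σ₀ : State := ⟨fun a => if a < s then σ.word a else 0, σ.real⟩ with hσ₀
  have hag : Agree s σ₀ σ := fun a ha => by simp [hσ₀, ha]
  have h1 := exec_clear (M := ⟨W, s⟩) (k := 64 * (D + 1)) hDW (by simp only [hs]; omega)
    (by simp only; omega) σ₀
  set σ₁ : State := ⟨fun a => if a < 64 * (D + 1) then 0 else σ₀.word a, σ₀.real⟩ with hσ₁
  have hsame : ∀ a, 64 * (D + 1) ≤ a → a < s →
      σ₁.word a = τ.word a ∧ σ₁.real a = τ.real a := by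
    intro a h1 h2
    have := hσ a h1 h2
    simpa [hσ₁, hσ₀, h2, not_lt.2 h1] using this
  let E : Env := ⟨Q, W, s, hQ, hW⟩
  have hsmall : E.Small σ₁ := by
    intro a
    by_cases ha : 64 * (D + 1) ≤ a
    · by_cases ha' : a < s
      · rw [(hsame a ha ha').1]; exact hτ a
      · simp [hσ₁, hσ₀, ha']
    · simp [hσ₁, not_le.1 ha]
  have hct : σ₁.w .ct (D + 1) = c := by
    rw [← hτc.count]
    have : WReg.ct.ctorIdx < 64 := WReg.ctorIdx_lt _
    exact (hsame _ (by omega) (by omega)).1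
  have hout : ∀ t < c, ∀ j < D,
      σ₁.x .out (t * D + D + 1 + j) = τ.x .out (t * D + D + 1 + j) := by
    intro t ht j hj
    have h1 : (t + 1) * D ≤ c * D := Nat.mul_le_mul_right _ ht
    have h2 : XReg.out.ctorIdx < 64 := XReg.ctorIdx_lt _
    rw [add_mul, one_mul] at h1
    exact (hsame _ (by omega) (by omega)).2
  obtain ⟨t₂, σ₂, T', h2, hT, -, hframe, t, ht, hans, hfar⟩ :=
    scan_run (E := E) hD hc hDQ hcQ hct rfl hsmall
  obtain ⟨σ', h3, hag'⟩ := Agree.exec (M := ⟨W, s⟩) (Exec.seq h1 h2) hag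
  obtain ⟨r, hr, hrx⟩ := hτc.mem t ht
  refine ⟨_, σ', h3, by omega, ?_, r, hr, fun j hj => ?_, fun p hp => ?_⟩
  · intro a ha ha'
    have e1 := hag' a ha'
    have e2 := hframe a ha
    have e3 := hsame a ha ha'
    exact ⟨by rw [← e1.1, e2.1, e3.1], by rw [← e1.2, e2.2, e3.2]⟩
  · rw [← (hag' j (by simp only [hs]; omega)).2, hans j hj, hout t ht j hj, hrx j hj]
  · obtain ⟨t', ht', happ⟩ := hτc.approx σ.real
    refine (happ p hp).trans ?_
    have := hfar t' ht'
    rw [eucl_congr (hout t' ht'),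
      eucl_congr (fun j hj => (hout t ht j hj).trans (hrx j hj))] at this
    exact this

end

/-! ### Time and space in terms of `ε` -/

theorem ceil_one_div_sqrt {ε : ℝ} (h0 : 0 < ε) (h1 : ε ≤ 1) :
    0 < ⌈1 / √ε⌉₊ ∧ (∀ k : ℕ, (k : ℝ) * k * ε < 1 ↔ k < ⌈1 / √ε⌉₊) ∧
      ⌈1 / √ε⌉₊ ≤ ⌈1 / ε⌉₊ ∧ (⌈1 / √ε⌉₊ : ℝ) ≤ 2 * ε ^ (-(1 / 2) : ℝ) := by
  have hs : 0 < √ε := Real.sqrt_pos.2 h0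
  have hs1 : √ε ≤ 1 := Real.sqrt_le_one.2 h1
  have hss : √ε * √ε = ε := Real.mul_self_sqrt h0.le
  have h2 : 1 ≤ 1 / √ε := (one_le_div hs).2 hs1
  refine ⟨Nat.ceil_pos.2 (by linarith), fun k => ?_, Nat.ceil_mono ?_, ?_⟩
  · have hk : (0 : ℝ) ≤ k * √ε := by positivity
    rw [Nat.lt_ceil, lt_div_iff₀ hs, ← pow_lt_one_iff_of_nonneg hk two_ne_zero]
    rw [mul_pow, Real.sq_sqrt h0.le, pow_two]
  · refine one_div_le_one_div_of_le h0 ?_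
    nlinarith
  · rw [Real.rpow_neg h0.le, ← Real.sqrt_eq_rpow, ← one_div]
    have := Nat.ceil_lt_add_one (by linarith : 0 ≤ 1 / √ε)
    linarith

theorem rpow_neg_half_pow {ε : ℝ} (h0 : 0 < ε) (i : ℕ) :
    (ε ^ (-(1 / 2) : ℝ)) ^ i = ε ^ (-(i / 2) : ℝ) := by
  rw [← Real.rpow_natCast, ← Real.rpow_mul h0.le]
  congr 1
  ring

theorem pow_grid_le {ε : ℝ} (h0 : 0 < ε) {D K i : ℕ} (hD : 1 ≤ D)
    (hK : (K : ℝ) ≤ 2 * ε ^ (-(1 / 2) : ℝ)) (hi : i ≤ 2 * D) :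
    ((41 * D * K : ℕ) : ℝ) ^ i ≤ (82 * D) ^ (2 * D) * ε ^ (-(i / 2) : ℝ) := by
  have hD' : (1 : ℝ) ≤ D := by exact_mod_cast hD
  have h1 : ((41 * D * K : ℕ) : ℝ) ≤ 82 * D * ε ^ (-(1 / 2) : ℝ) := by
    push_cast
    nlinarith
  refine (pow_le_pow_left₀ (by positivity) h1 i).trans ?_
  rw [mul_pow, rpow_neg_half_pow h0]
  gcongr
  linarith

theorem buildTime_le {ε : ℝ} (h0 : 0 < ε) {D K n : ℕ} (hD : 1 ≤ D) (hn : 1 ≤ n)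
    (hK : (K : ℝ) ≤ 2 * ε ^ (-(1 / 2) : ℝ)) :
    (n : ℝ) + ((41 * D * K : ℕ) : ℝ) ^ (2 * D - 3) ≤
      2 * (82 * D) ^ (2 * D) * (n + ε ^ ((3 : ℝ) / 2 - D)) := by
  have hn' : (1 : ℝ) ≤ n := by exact_mod_cast hn
  have hc : (1 : ℝ) ≤ (82 * D) ^ (2 * D) := by
    have hD' : (1 : ℝ) ≤ D := by exact_mod_cast hD
    exact one_le_pow₀ (by linarith)
  have hp : 0 < ε ^ ((3 : ℝ) / 2 - D) := Real.rpow_pos_of_pos h0 _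
  rcases hD.eq_or_lt with rfl | hD2
  · simp only [Nat.cast_one, mul_one, show (2 - 3 : ℕ) = 0 from rfl, pow_zero] at hc hp ⊢
    nlinarith [mul_pos (by linarith : (0 : ℝ) < 82 ^ 2) hp]
  · have h := pow_grid_le h0 hD hK (i := 2 * D - 3) (by omega)
    have he : (-(((2 * D - 3 : ℕ) : ℝ) / 2) : ℝ) = 3 / 2 - D := by
      rw [Nat.cast_sub (by omega)]
      push_cast
      ring
    rw [he] at h
    set c : ℝ := (82 * D) ^ (2 * D)
    nlinarith [mul_pos (by linarith : 0 < c) hp]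

theorem count_le {ε : ℝ} (h0 : 0 < ε) {D K : ℕ} (hD : 1 ≤ D) (hK0 : 0 < K)
    (hK : (K : ℝ) ≤ 2 * ε ^ (-(1 / 2) : ℝ)) :
    ((D * 2 * (40 * D * K + 1) ^ (D - 1) : ℕ) : ℝ) ≤
      2 * D * (82 * D) ^ (2 * D) * ε ^ ((1 - (D : ℝ)) / 2) := by
  have h := pow_grid_le h0 hD hK (i := D - 1) (by omega)
  have he : (-(((D - 1 : ℕ) : ℝ) / 2) : ℝ) = (1 - (D : ℝ)) / 2 := by
    rw [Nat.cast_sub hD]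
    push_cast
    ring
  rw [he] at h
  have h1 : (40 * D * K + 1) ^ (D - 1) ≤ (41 * D * K) ^ (D - 1) := by
    have : 1 ≤ D * K := Nat.mul_pos hD hK0
    refine Nat.pow_le_pow_left ?_ _
    rw [mul_assoc, mul_assoc]
    omega
  have h2 : ((40 * D * K + 1) ^ (D - 1) : ℕ) ≤ ((41 * D * K : ℕ) : ℝ) ^ (D - 1) := by
    exact_mod_cast h1
  rw [Nat.cast_mul]
  push_cast at h2 ⊢
  push_cast at h
  calc (D : ℝ) * 2 * (40 * D * K + 1) ^ (D - 1)
      ≤ D * 2 * ((82 * D) ^ (2 * D) * ε ^ ((1 - (D : ℝ)) / 2)) := by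
        gcongr
        exact h2.trans h
    _ = _ := by ring

/-- All words in memory are at most `(n + ⌈1 / ε⌉ + 1) ^ wordExponent D`. The summands of the
exponent account for a power of `n + ⌈1 / ε⌉ + 1`, and for factors that depend on `D` only. -/
def wordExponent (D : ℕ) : ℕ := 2 * D + (41 * D) ^ (2 * D) + 100

theorem le_pow_wordExponent {D b : ℕ} (hb : 2 ≤ b) :
    100 * (41 * D * b) ^ (2 * D) ≤ b ^ wordExponent D := by
  have h1 : 100 ≤ b ^ 100 := (Nat.lt_pow_self (by omega)).le
  have h2 : (41 * D) ^ (2 * D) ≤ b ^ (41 * D) ^ (2 * D) := (Nat.lt_pow_self (by omega)).le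
  rw [wordExponent, pow_add, pow_add, mul_pow]
  calc 100 * ((41 * D) ^ (2 * D) * b ^ (2 * D))
      ≤ b ^ 100 * (b ^ (41 * D) ^ (2 * D) * b ^ (2 * D)) :=
        Nat.mul_le_mul h1 (Nat.mul_le_mul_right _ h2)
    _ = _ := by ring

/-- The algorithm. The working cells of the query program are the cells with index at most `D` of
all regions. -/
def algorithm (D : ℕ) : Algorithm where
  build := build D
  query := query D
  work := 64 * (D + 1)
  wordFactor := 41 * wordExponent D

theorem dist_eq_eucl {D : ℕ} {a b : ℕ → ℝ} {x y : EuclideanSpace ℝ (Fin D)}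
    (ha : ∀ j : Fin D, a j = x j) (hb : ∀ j : Fin D, b j = y j) : dist x y = eucl D a b := by
  rw [EuclideanSpace.dist_eq, eucl, Finset.sum_range]
  congr 1
  exact Finset.sum_congr rfl fun j _ => by rw [Real.dist_eq, sq_abs, ha, hb]

theorem algorithm_solves {D n : ℕ} {ε : ℝ} (hD : 1 ≤ D) (h0 : 0 < ε) (h1 : ε ≤ 1) (hn : 1 ≤ n)
    (p : Fin n → EuclideanSpace ℝ (Fin D)) :
    (algorithm D).Solves ε p
      (256 * (D * (408 * D + 800)) * (2 * (82 * D) ^ (2 * D)) *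
        (n + ε ^ ((3 : ℝ) / 2 - (D : ℝ))))
      ((3000 * D + 12000) * (2 * D * (82 * D) ^ (2 * D)) * ε ^ ((1 - (D : ℝ)) / 2))
      ((3000 * D + 12000) * (2 * D * (82 * D) ^ (2 * D)) * ε ^ ((1 - (D : ℝ)) / 2)) := by
  obtain ⟨hK0, hK, hKε, hKle⟩ := ceil_one_div_sqrt h0 h1
  set K := ⌈1 / √ε⌉₊
  set b := n + ⌈1 / ε⌉₊ + 1 with hb
  have hb2 : 2 ≤ b := by omega
  set Q := b ^ wordExponent D with hQdef
  have hQ := le_pow_wordExponent (D := D) hb2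
  rw [← hQdef] at hQ
  have hbig : D ≤ 41 * D * b ∧ b ≤ 41 * D * b := by
    have h1 : D ≤ D * b := Nat.le_mul_of_pos_right _ (by omega)
    have h2 : b ≤ D * b := Nat.le_mul_of_pos_left _ hD
    rw [mul_assoc]
    omega
  have hself : 41 * D * b ≤ (41 * D * b) ^ (2 * D) := Nat.le_self_pow (mul_ne_zero two_ne_zero (by omega)) _
  have hW : Q ^ 40 < b ^ (41 * wordExponent D) := by
    rw [hQdef, ← pow_mul]
    refine Nat.pow_lt_pow_right (by omega) ?_
    rw [wordExponent]
    omega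
  rintro σ₀ ⟨hw0, hw, hr0, hr, -⟩
  set W := b ^ (41 * wordExponent D) with hWdef
  have hWB : wordBound (algorithm D).wordFactor n ε = W := by
    simp only [wordBound, algorithm, hWdef, hb]
  rw [hWB]
  let E : Env := ⟨Q, W, W, by omega, hW⟩
  have hE : E.Full := ⟨rfl⟩
  have hsmall : E.Small σ₀ := by
    intro a
    rcases Nat.eq_zero_or_pos a with rfl | ha
    · rw [hw0]; change n ≤ Q; omega
    · rw [hw a ha]; exact Nat.zero_le _
  obtain ⟨t, τ, T', hexec, hT, hτ, hcore⟩ := build_run (E := E) (σ := σ₀) hD hw0 hn hr0 h0.le h1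
    hK0 hK (by omega : n ≤ b) (by omega : K ≤ b) hQ hsmall
  set c := D * 2 * (40 * D * K + 1) ^ (D - 1) with hc
  set x : ℕ → ℕ → ℝ := fun p j => σ₀.real (p * D + j + 1) with hx
  have hxp : ∀ (i : Fin n) (j : Fin D), x i j = p i j := fun i j => by
    rw [← hr i j]
    change σ₀.real ((i : ℕ) * D + j + 1) = _
    rw [show (i : ℕ) * D + j + 1 = 1 + i * D + j by ring]
  have hcQ : c ≤ Q := by rw [← hcore.count]; exact hτ _
  have hc1 : 1 ≤ c := by
    obtain ⟨t, ht, -⟩ := hcore.approx 0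
    omega
  have hcr : (c : ℝ) ≤ 2 * D * (82 * D) ^ (2 * D) * ε ^ ((1 - (D : ℝ)) / 2) :=
    count_le h0 hD hK0 hKle
  have hD' : (1 : ℝ) ≤ D := by exact_mod_cast hD
  have hc1' : (1 : ℝ) ≤ c := by exact_mod_cast hc1
  clear_value c
  have hfinal : ∀ {m : ℕ}, m ≤ c * (3000 * D + 12000) → (m : ℝ) ≤
      (3000 * D + 12000) * (2 * D * (82 * D) ^ (2 * D)) * ε ^ ((1 - (D : ℝ)) / 2) := by
    intro m hm
    have hm' : (m : ℝ) ≤ c * (3000 * D + 12000) := by exact_mod_cast hm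
    refine hm'.trans ?_
    rw [mul_assoc, mul_comm]
    gcongr
  refine ⟨t, τ, hexec, ?_, 64 * (c * D + D + 1), ?_, ?_, ?_, ?_, ?_⟩
  · have h2 : (t : ℝ) ≤ 256 * (D * (408 * D + 800) *
        (n + ((41 * D * K : ℕ) : ℝ) ^ (2 * D - 3))) := by
      have : t ≤ 256 * (D * (408 * D + 800) * (n + (41 * D * K) ^ (2 * D - 3))) := by omega
      exact_mod_cast this
    have h3 := mul_le_mul_of_nonneg_left (buildTime_le h0 hD hn hKle)
      (by positivity : (0 : ℝ) ≤ 256 * (D * (408 * D + 800)))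
    linarith
  · have h2 : 64 * (c * D + D + 1) + 64 * (c * D + D + 1) ≤ c * (3000 * D + 12000) := by
      have e1 : c * (3000 * D + 12000) = 3000 * (c * D) + 12000 * c := by ring
      have e2 : D ≤ c * D := Nat.le_mul_of_pos_left _ hc1
      rw [e1]
      omega
    exact_mod_cast hfinal h2
  · simp only [algorithm]; omega
  · simp only [algorithm]
    have : D ≤ c * D := Nat.le_mul_of_pos_left _ hc1
    omega
  · have h2 : c * D ≤ Q * Q := Nat.mul_le_mul hcQ (by omega)
    have h3 : Q ^ 4 ≤ Q ^ 40 := Nat.pow_le_pow_right (by omega) (by norm_num)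
    have h4 : 100 * 100 * (Q * Q) ≤ Q ^ 4 := by
      have : 100 * 100 ≤ Q * Q := Nat.mul_le_mul (by omega) (by omega)
      calc 100 * 100 * (Q * Q) ≤ Q * Q * (Q * Q) := Nat.mul_le_mul_right _ this
        _ = Q ^ 4 := by ring
    have h5 : Q ≤ Q * Q := Nat.le_mul_of_pos_left _ (by omega)
    omega
  · intro q σ hq hσ
    obtain ⟨t', σ', hexec', ht', hsame, r, hrn, hans, hfar⟩ := query_exec (x := x) (by omega)
      hW hD (by omega) hcQ hτ hcore hσ
    refine ⟨t', σ', hexec', ?_, hsame, p ⟨r, hrn⟩, fun j => ?_, ⟨⟨r, hrn⟩, rfl⟩, ?_⟩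
    · refine hfinal (ht'.trans ?_)
      have e1 : c * (3000 * D + 12000) = 3000 * (c * D) + 12000 * c := by ring
      have e2 : 256 * (c * (10 * D + 40)) = 2560 * (c * D) + 10240 * c := by ring
      have e3 : D ≤ c * D := Nat.le_mul_of_pos_left _ hc1
      rw [e1, e2]
      omega
    · rw [hans j j.2]
      exact hxp ⟨r, hrn⟩ j
    · rintro _ ⟨i, rfl⟩
      rw [dist_eq_eucl hq (hxp i), dist_eq_eucl hq (hxp ⟨r, hrn⟩)]
      exact hfar i i.2

end FarthestNeighbor

theorem theorem3 (D : ℕ) (hD : 1 ≤ D) :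
    ∃ (A : FarthestNeighbor.Algorithm) (C : ℝ),
      ∀ (ε : ℝ), 0 < ε → ε ≤ 1 →
        ∀ (n : ℕ), 1 ≤ n → ∀ (p : Fin n → EuclideanSpace ℝ (Fin D)),
          A.Solves ε p
            (C * ((n : ℝ) + ε ^ ((3 : ℝ) / 2 - (D : ℝ))))
            (C * ε ^ ((1 - (D : ℝ)) / 2))
            (C * ε ^ ((1 - (D : ℝ)) / 2)) := by
  set C₁ : ℝ := 256 * (D * (408 * D + 800)) * (2 * (82 * D) ^ (2 * D)) with hC₁
  set C₂ : ℝ := (3000 * D + 12000) * (2 * D * (82 * D) ^ (2 * D)) with hC₂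
  refine ⟨FarthestNeighbor.algorithm D, max C₁ C₂, fun ε h0 h1 n hn p σ₀ hσ₀ => ?_⟩
  obtain ⟨t, τ, h2, h3, s, h4, h5, h6, h7, h8⟩ :=
    FarthestNeighbor.algorithm_solves hD h0 h1 hn p σ₀ hσ₀
  have hp : 0 ≤ ε ^ ((1 - (D : ℝ)) / 2) := Real.rpow_nonneg h0.le _
  have hp' : 0 ≤ (n : ℝ) + ε ^ ((3 : ℝ) / 2 - (D : ℝ)) :=
    add_nonneg (by simp) (Real.rpow_nonneg h0.le _)
  have hle := mul_le_mul_of_nonneg_right (le_max_right C₁ C₂) hp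
  refine ⟨t, τ, h2, h3.trans (mul_le_mul_of_nonneg_right (le_max_left C₁ C₂) hp'), s,
    h4.trans hle, h5, h6, h7, fun q σ hq hσ => ?_⟩
  obtain ⟨t', σ', k1, k2, k3⟩ := h8 q σ hq hσ
  exact ⟨t', σ', k1, k2.trans hle, k3⟩
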